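/- Consider the fractional covering problem $\min\{\vec 1^T x : Ax\ge \vec 1,\ x\ge 0\}$ for a matrix $A\in\mathbb{R}^{m\times n}_{\ge 0}$, $m\ge 1$, for which it is feasible. Let $\mathrm{OPT}$ be its optimal value, and let $N$ be the number of nonzero entries of $A$. A $(1+\delta)$-approximation is a vector $x\ge 0$ with $Ax\ge\vec 1$ and $\vec 1^Tx\le(1+\delta)\,\mathrm{OPT}$. There are a single randomized algorithm and absolute constants $K$, $C$, $d$ such that, for every such $A$ (given as a list of its nonzero entries with their row and column indices, in arbitrary order) and every $0<\epsilon\le 1$, the algorithm, on input $A$ and $\epsilon$, * outputs with probability at least $9/10$ a $(1+K\epsilon)$-approximation to the covering problem, and * has expected running time at most $C\,\frac{N}{\epsilon}\left(1+\log\frac{N}{\epsilon}\right)^d$, that is, $\tilde O(N/\epsilon)$, independently of the magnitudes of the entries of $A$. Running time is counted on a real random access machine with zero-initialized memory: one unit each for an arithmetic operation, an exponential, a logarithm or a comparison of exact real numbers, an addition, (truncated) subtraction or comparison of integers, a conversion of an integer to a real, a memory access, and a uniformly random choice from $\{0,\dots,k\}$ for a computed integer $k$. There is no rounding of reals to integers.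 -/

import Mathlib

open scoped ENNReal

/-! ### The fractional covering problem -/

namespace Covering

/-- The feasible region `{x : x ≥ 0, A x ≥ 1}` of the covering LP with matrix `A`. -/
def feasible {m n : ℕ} (A : Matrix (Fin m) (Fin n) ℝ) : Set (Fin n → ℝ) :=
  {x | (∀ i, 0 ≤ x i) ∧ ∀ j, 1 ≤ A.mulVec x j}

/-- The optimal value of `min {1ᵀx : A x ≥ 1, x ≥ 0}`.  For a feasible LP this is the infimum of a
nonempty set of reals that is bounded below by `0`. -/
noncomputable def opt {m n : ℕ} (A : Matrix (Fin m) (Fin n) ℝ) : ℝ :=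
  sInf ((fun x : Fin n → ℝ => ∑ i, x i) '' feasible A)

/-- `x` is a `(1 + δ)`-approximation for the covering LP. -/
def IsApprox {m n : ℕ} (A : Matrix (Fin m) (Fin n) ℝ) (δ : ℝ) (x : Fin n → ℝ) : Prop :=
  x ∈ feasible A ∧ ∑ i, x i ≤ (1 + δ) * opt A

/-- The positions of the nonzero entries of `A`. -/
abbrev NonzeroEntry {m n : ℕ} (A : Matrix (Fin m) (Fin n) ℝ) : Type :=
  {p : Fin m × Fin n // A p.1 p.2 ≠ 0}

/-- The number `N` of nonzero entries of `A`. -/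
noncomputable def nnz {m n : ℕ} (A : Matrix (Fin m) (Fin n) ℝ) : ℕ :=
  Nat.card (NonzeroEntry A)

end Covering

/-! ### A randomized real random access machine with a step count

The memory consists of arrays of natural numbers and arrays of real numbers; every array is indexed
by the natural numbers, and an entry may be accessed at a computed index.  A program is a finite
text, in which only finitely many arrays, and only rational numbers as real constants, occur.
There is no conversion from reals to integers (no rounding), and integers can only be added,
subtracted and compared. -/

namespace RealRAM

/-- Contents of the memory: `s.nat a k` is entry `k` of the integer array `a`, and
`s.real a k` is entry `k` of the real array `a`. -/
structure State where
  nat : ℕ → ℕ → ℕ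
  real : ℕ → ℕ → ℝ

/-- Expressions with values in the natural numbers. -/
inductive NExpr where
  | const (k : ℕ)
  | get (a : ℕ) (i : NExpr)
  | add (e f : NExpr)
  | sub (e f : NExpr)

/-- Expressions with real values. -/
inductive RExpr where
  | const (q : ℚ)
  | ofNat (e : NExpr)
  | get (a : ℕ) (i : NExpr)
  | add (e f : RExpr)
  | sub (e f : RExpr)
  | mul (e f : RExpr)
  | div (e f : RExpr)
  | exp (e : RExpr)
  | log (e : RExpr)

/-- Tests. -/
inductive BExpr where
  | natLt (e f : NExpr)
  | natEq (e f : NExpr)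
  | realLt (e f : RExpr)
  | realEq (e f : RExpr)
  | not (b : BExpr)
  | and (b c : BExpr)

/-- Programs.  `setNat a i e` and `setReal a i e` assign the value of `e` to entry `i` of the array
`a`; `sample a i e` assigns to entry `i` of the integer array `a` a fresh uniformly random element of
`{0, …, k}`, where `k` is the value of `e`. -/
inductive Cmd where
  | skip
  | setNat (a : ℕ) (i e : NExpr)
  | setReal (a : ℕ) (i : NExpr) (e : RExpr)
  | sample (a : ℕ) (i e : NExpr)
  | seq (c d : Cmd)
  | ite (b : BExpr) (c d : Cmd)
  | loop (b : BExpr) (c : Cmd)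

/-- Value of an integer expression (subtraction is truncated at `0`). -/
def NExpr.eval (s : State) : NExpr → ℕ
  | const k => k
  | get a i => s.nat a (i.eval s)
  | add e f => e.eval s + f.eval s
  | sub e f => e.eval s - f.eval s

/-- Value of a real expression. -/
noncomputable def RExpr.eval (s : State) : RExpr → ℝ
  | const q => (q : ℝ)
  | ofNat e => (e.eval s : ℝ)
  | get a i => s.real a (i.eval s)
  | add e f => e.eval s + f.eval s
  | sub e f => e.eval s - f.eval s
  | mul e f => e.eval s * f.eval s
  | div e f => e.eval s / f.eval s
  | exp e => Real.exp (e.eval s)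
  | log e => Real.log (e.eval s)

/-- Truth of a test. -/
def BExpr.Holds (s : State) : BExpr → Prop
  | natLt e f => e.eval s < f.eval s
  | natEq e f => e.eval s = f.eval s
  | realLt e f => e.eval s < f.eval s
  | realEq e f => e.eval s = f.eval s
  | not b => ¬ b.Holds s
  | and b c => b.Holds s ∧ c.Holds s

/-- Number of elementary operations in the evaluation of an integer expression. -/
def NExpr.cost : NExpr → ℕ
  | const _ => 1
  | get _ i => i.cost + 1
  | add e f => e.cost + f.cost + 1
  | sub e f => e.cost + f.cost + 1

/-- Number of elementary operations in the evaluation of a real expression. -/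
def RExpr.cost : RExpr → ℕ
  | const _ => 1
  | ofNat e => e.cost + 1
  | get _ i => i.cost + 1
  | add e f => e.cost + f.cost + 1
  | sub e f => e.cost + f.cost + 1
  | mul e f => e.cost + f.cost + 1
  | div e f => e.cost + f.cost + 1
  | exp e => e.cost + 1
  | log e => e.cost + 1

/-- Number of elementary operations in the evaluation of a test. -/
def BExpr.cost : BExpr → ℕ
  | natLt e f => e.cost + f.cost + 1
  | natEq e f => e.cost + f.cost + 1
  | realLt e f => e.cost + f.cost + 1
  | realEq e f => e.cost + f.cost + 1
  | not b => b.cost + 1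
  | and b c => b.cost + c.cost + 1

/-- Number of elementary operations in the first execution step of a command (for a branching or a
loop this is the evaluation of its test; the body is charged when it is executed). -/
def Cmd.cost : Cmd → ℕ
  | skip => 1
  | setNat _ i e => i.cost + e.cost + 1
  | setReal _ i e => i.cost + e.cost + 1
  | sample _ i e => i.cost + e.cost + 1
  | seq _ _ => 1
  | ite b _ _ => b.cost + 1
  | loop b _ => b.cost + 1

/-- Overwrite one entry of an integer array. -/
def State.writeNat (s : State) (a i v : ℕ) : State :=
  { s with nat := Function.update s.nat a (Function.update (s.nat a) i v) }

/-- Overwrite one entry of a real array. -/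
noncomputable def State.writeReal (s : State) (a i : ℕ) (v : ℝ) : State :=
  { s with real := Function.update s.real a (Function.update (s.real a) i v) }

/-- A configuration: the commands that are still to be executed, in this order, and the memory.
The machine has halted when no command is left. -/
structure Config where
  todo : List Cmd
  state : State

open Classical in
/-- One step of execution, as a probability distribution on the next configuration. -/
noncomputable def step : Config → PMF Config
  | ⟨[], s⟩ => PMF.pure ⟨[], s⟩
  | ⟨.skip :: K, s⟩ => PMF.pure ⟨K, s⟩
  | ⟨.setNat a i e :: K, s⟩ => PMF.pure ⟨K, s.writeNat a (i.eval s) (e.eval s)⟩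
  | ⟨.setReal a i e :: K, s⟩ => PMF.pure ⟨K, s.writeReal a (i.eval s) (e.eval s)⟩
  | ⟨.sample a i e :: K, s⟩ =>
      (PMF.uniformOfFintype (Fin (e.eval s + 1))).map
        fun v : Fin (e.eval s + 1) => ⟨K, s.writeNat a (i.eval s) (v : ℕ)⟩
  | ⟨.seq c d :: K, s⟩ => PMF.pure ⟨c :: d :: K, s⟩
  | ⟨.ite b c d :: K, s⟩ => PMF.pure (if b.Holds s then ⟨c :: K, s⟩ else ⟨d :: K, s⟩)
  | ⟨.loop b c :: K, s⟩ =>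
      PMF.pure (if b.Holds s then ⟨c :: .loop b c :: K, s⟩ else ⟨K, s⟩)

/-- The distribution of the configuration after `t` steps, started in the configuration `c`. -/
noncomputable def run (c : Config) : ℕ → PMF Config
  | 0 => PMF.pure c
  | t + 1 => (run c t).bind step

/-- Number of elementary operations in the next step; `0` once the machine has halted. -/
def Config.cost : Config → ℕ
  | ⟨[], _⟩ => 0
  | ⟨c :: _, _⟩ => c.cost

/-- Expected running time (total number of elementary operations until the machine halts) of the
program `P` started with memory `s`. -/
noncomputable def expectedTime (P : Cmd) (s : State) : ℝ≥0∞ :=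
  ∑' t : ℕ, ∑' c : Config, run ⟨[P], s⟩ t c * (c.cost : ℝ≥0∞)

/-- Probability that the program `P`, started with memory `s`, halts with a memory in `S`.  A halted
machine does not change any more, so this is a supremum of an increasing sequence. -/
noncomputable def haltProb (P : Cmd) (s : State) (S : Set State) : ℝ≥0∞ :=
  ⨆ t : ℕ, (run ⟨[P], s⟩ t).toOuterMeasure {c | c.todo = [] ∧ c.state ∈ S}

end RealRAM

/-! ### Input and output -/

namespace Covering

/-- The initial memory for the covering LP with matrix `A` and accuracy `ε`.  The matrix is given in
sparse form, as the list of its nonzero entries in the order `e`: integer array `0` holds `m`, `n` and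
the number `N` of nonzero entries, integer arrays `1` and `2` hold the row and the column index of the
`k`-th nonzero entry, and real array `0` holds its value, `k < N`.  Real array `1` holds `ε`.  All other
entries are `0`. -/
noncomputable def input {m n : ℕ} (A : Matrix (Fin m) (Fin n) ℝ)
    (e : Fin (nnz A) ≃ NonzeroEntry A) (ε : ℝ) : RealRAM.State where
  nat
    | 0, 0 => m
    | 0, 1 => n
    | 0, 2 => nnz A
    | 1, k => if h : k < nnz A then ((e ⟨k, h⟩).1.1 : ℕ) else 0
    | 2, k => if h : k < nnz A then ((e ⟨k, h⟩).1.2 : ℕ) else 0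
    | _, _ => 0
  real
    | 0, k => if h : k < nnz A then A (e ⟨k, h⟩).1.1 (e ⟨k, h⟩).1.2 else 0
    | 1, 0 => ε
    | _, _ => 0

/-- The output vector `x ∈ ℝⁿ` is read off from the first `n` entries of real array `2`. -/
def output (n : ℕ) (s : RealRAM.State) : Fin n → ℝ := fun i => s.real 2 i

end Covering

/-!
The algorithm is accelerated randomized coordinate descent on a smoothed form of the covering problem.
Three ideas make its running time nearly linear in `N / ε` and independent of the magnitudes of the
entries.

*Capping.*  Let `v` be `m` times the largest inverse of a row maximum, so that `OPT ≤ v ≤ m * OPT`.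
Every nonempty column is replaced by `lam = O(log (N / ε))` variables; the variable of level `l` has
its entries capped at `cap = 2 ^ l / v`.  An optimal solution may be changed such that every column
has a value of at least about `ε * OPT / N`; if a column with the value `t` is moved to the level at
which `2 ^ l * t` lies between `v` and `2 * v`, then an entry that is capped there covers its row
alone.  So the capped problem has a near-optimal solution (`Inst.OK.exists_comparison`) inside the box
in which variable `q` is at most `4 / cap q`, while in these units all entries have size at most a
constant.  Conversely, capping only shrinks the matrix, so that solutions of the capped problem are
solutions of the original one.

*Smoothing.*  With `μ = ε / (32 * lam)` the constraints are replaced by the penalty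
`μ * v * ∑ j, exp ((1 - (B x) j) / μ)`.  As `v` is at least `OPT`, this objective is at least `OPT` on
nonnegative vectors (`Inst.OK.opt_le_obj`), and a vector with objective at most `(1 + 110 * ε) * OPT`
covers every row up to `ε / 2`; dividing it by its smallest row value gives the output
(`Inst.OK.out_approx`).

*Accelerated coordinate descent.*  The penalty is not smooth with a fixed constant, but along a
coordinate its second derivative is proportional to `1 - grad`, where `grad ≤ 1` (`Valid.descent`).
Steps that truncate the derivative at `-1` are therefore possible with `L = 16 / μ`, and what the
truncation loses is paid for by the decrease of the objective (`mirror_progress`).  Linear coupling of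
the mirror iterate `z` and the averaged iterate `y`, with a weight `s` that shrinks by the factor
`1 - τ`, where `τ = 1 / (2 * Q * L)`, makes the potential `2 / s * (obj y - obj u) + dist2 u z` a
supermartingale (`Valid.potential_step`).  The average is kept in the form `y = z - s R`, so that one
step changes only one coordinate of `z` and `R` and costs as much as the column is long.  A run ends
when `s` has decreased to about `1 / L`; then the expected objective is at most that of the comparison
point plus `O(μ)` times the initial objective (`bounds_run`).  So `lam` runs suffice from the
polynomially bad starting point `box`, and Markov's inequality gives the probability `9 / 10`.  A run takes `O(Q * L * log L)` steps, of average cost `O(N / nc)` for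
`nc` nonempty columns, where `Q = lam * nc`; this is `N / ε` up to powers of `1 + log (N / ε)`
(`expectedTime_solver`).

The machine is treated by two program logics.  `RealRAM.Ends` is total correctness with a cost bound
for deterministic commands.  `RealRAM.Bounds` is its analogue for randomized ones: expected remaining
time, and lower bounds for the halting probability that are affine in a function of the memory, are
pulled back along a command.  The supermartingale property enters only in `Bounds.sample`, one random
choice at a time, and no probability space of executions is needed.
-/

/-! ### Expected time and halting probability as functions of the configuration -/

namespace RealRAM

/-- Expectation of an extended nonnegative function. -/
noncomputable def expect {α : Type*} (p : PMF α) (g : α → ℝ≥0∞) : ℝ≥0∞ := ∑' x, p x * g x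

theorem expect_pure {α : Type*} (a : α) (g : α → ℝ≥0∞) : expect (PMF.pure a) g = g a := by
  unfold expect
  rw [tsum_eq_single a]
  · simp
  · intro b hb
    simp [PMF.pure_apply, hb]

theorem expect_bind {α β : Type*} (p : PMF α) (k : α → PMF β) (g : β → ℝ≥0∞) :
    expect (p.bind k) g = expect p fun a => expect (k a) g := by
  unfold expect
  simp only [PMF.bind_apply, ← ENNReal.tsum_mul_right, ← ENNReal.tsum_mul_left]
  rw [ENNReal.tsum_comm]
  simp only [mul_assoc]

theorem expect_mono {α : Type*} (p : PMF α) {g h : α → ℝ≥0∞} (hgh : ∀ a, g a ≤ h a) :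
    expect p g ≤ expect p h :=
  ENNReal.tsum_le_tsum fun a => mul_le_mul_right (hgh a) _

theorem expect_uniform_map {β : Type*} (k : ℕ) (φ : Fin (k + 1) → β) (g : β → ℝ≥0∞) :
    expect ((PMF.uniformOfFintype (Fin (k + 1))).map φ) g =
      ∑ v : Fin (k + 1), ((k + 1 : ℕ) : ℝ≥0∞)⁻¹ * g (φ v) := by
  rw [← PMF.bind_pure_comp, expect_bind]
  simp only [Function.comp, expect_pure]
  unfold expect
  rw [tsum_fintype]
  simp

/-- `run` appends steps at the end; this is the recursion on the first step. -/
theorem run_succ (c : Config) (t : ℕ) : run c (t + 1) = (step c).bind fun c' => run c' t := by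
  induction t with
  | zero => simp [run]
  | succ t ih =>
    rw [run, ih, PMF.bind_bind]
    simp only [run]

/-- Expected total cost of the execution that starts in a configuration. -/
noncomputable def timeFrom (c : Config) : ℝ≥0∞ :=
  ∑' t : ℕ, expect (run c t) fun c' => (c'.cost : ℝ≥0∞)

theorem timeFrom_eq (c : Config) : timeFrom c = c.cost + expect (step c) timeFrom := by
  unfold timeFrom
  rw [tsum_eq_zero_add' ENNReal.summable]
  congr 1
  · simp [run, expect_pure]
  · simp only [run_succ, expect_bind]
    unfold expect
    rw [ENNReal.tsum_comm]
    simp only [ENNReal.tsum_mul_left]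

theorem expectedTime_eq (P : Cmd) (s : State) : expectedTime P s = timeFrom ⟨[P], s⟩ := rfl

open Classical in
/-- Probability of having halted after `t` steps with a memory in `S`. -/
noncomputable def haltWithin (S : Set State) (c : Config) (t : ℕ) : ℝ≥0∞ :=
  expect (run c t) fun c' => if c'.todo = [] ∧ c'.state ∈ S then 1 else 0

/-- Probability of halting eventually with a memory in `S`. -/
noncomputable def haltFrom (S : Set State) (c : Config) : ℝ≥0∞ := ⨆ t, haltWithin S c t

theorem haltProb_eq (P : Cmd) (s : State) (S : Set State) :
    haltProb P s S = haltFrom S ⟨[P], s⟩ := by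
  classical
  unfold haltProb haltFrom haltWithin expect
  congr 1
  funext t
  rw [PMF.toOuterMeasure_apply]
  refine tsum_congr fun c => ?_
  by_cases h : c.todo = [] ∧ c.state ∈ S <;> simp [Set.indicator, h]

theorem haltWithin_mono (S : Set State) (c : Config) : Monotone (haltWithin S c) := by
  classical
  refine monotone_nat_of_le_succ fun t => ?_
  unfold haltWithin
  rw [run, expect_bind]
  refine expect_mono _ fun c' => ?_
  split_ifs with h
  · obtain ⟨K, s⟩ := c'
    obtain ⟨h1, h2⟩ := h
    simp only at h1 h2
    subst h1
    simp [step, expect_pure, h2]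
  · exact bot_le

theorem haltWithin_succ (S : Set State) (c : Config) (t : ℕ) :
    haltWithin S c (t + 1) = expect (step c) fun c' => haltWithin S c' t := by
  unfold haltWithin
  rw [run_succ, expect_bind]

theorem haltFrom_nil (S : Set State) {s : State} (hs : s ∈ S) : 1 ≤ haltFrom S ⟨[], s⟩ := by
  refine le_iSup_of_le 0 ?_
  simp [haltWithin, run, expect_pure, hs]

theorem haltFrom_of_pure (S : Set State) {c c' : Config} (h : step c = PMF.pure c') :
    haltFrom S c' ≤ haltFrom S c := by
  refine iSup_le fun t => le_iSup_of_le (t + 1) ?_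
  rw [haltWithin_succ, h, expect_pure]

theorem timeFrom_of_pure {c c' : Config} (h : step c = PMF.pure c') :
    timeFrom c = c.cost + timeFrom c' := by
  rw [timeFrom_eq, h, expect_pure]

theorem timeFrom_nil (s : State) : timeFrom ⟨[], s⟩ = 0 := by
  unfold timeFrom
  have h : ∀ t, run ⟨[], s⟩ t = PMF.pure ⟨[], s⟩ := by
    intro t
    induction t with
    | zero => rfl
    | succ t ih => rw [run, ih, PMF.pure_bind, step]
  simp [h, expect_pure, Config.cost]

theorem timeFrom_sample (a : ℕ) (i e : NExpr) (K : List Cmd) (s : State) :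
    timeFrom ⟨.sample a i e :: K, s⟩ = ((Cmd.sample a i e).cost : ℝ≥0∞) +
      ∑ v : Fin (e.eval s + 1), ((e.eval s + 1 : ℕ) : ℝ≥0∞)⁻¹ *
        timeFrom ⟨K, s.writeNat a (i.eval s) v⟩ := by
  rw [timeFrom_eq, step, expect_uniform_map]
  rfl

/-- Only this inequality is used; it holds as limits commute with finite sums. -/
theorem haltFrom_sample (S : Set State) (a : ℕ) (i e : NExpr) (K : List Cmd) (s : State) :
    ∑ v : Fin (e.eval s + 1), ((e.eval s + 1 : ℕ) : ℝ≥0∞)⁻¹ *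
        haltFrom S ⟨K, s.writeNat a (i.eval s) v⟩ ≤ haltFrom S ⟨.sample a i e :: K, s⟩ := by
  unfold haltFrom
  simp only [ENNReal.mul_iSup]
  rw [ENNReal.finsetSum_iSup_of_monotone (f := fun (v : Fin (e.eval s + 1)) t =>
      ((e.eval s + 1 : ℕ) : ℝ≥0∞)⁻¹ * haltWithin S ⟨K, s.writeNat a (i.eval s) v⟩ t)
    (fun v t t' h => mul_le_mul_right (haltWithin_mono S _ h) _)]
  refine iSup_le fun t => le_iSup_of_le (t + 1) ?_
  rw [haltWithin_succ, step, expect_uniform_map]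

/-! ### Deterministic executions -/

/-- `Steps c c' k`: the machine moves deterministically from `c` to `c'`, at total cost `k`. -/
inductive Steps : Config → Config → ℕ → Prop
  | refl (c : Config) : Steps c c 0
  | head {c c' c'' : Config} {k : ℕ} (h : step c = PMF.pure c') (h' : Steps c' c'' k) :
      Steps c c'' (c.cost + k)

theorem Steps.trans {c c' c'' : Config} {k l : ℕ} (h : Steps c c' k) (h' : Steps c' c'' l) :
    Steps c c'' (k + l) := by
  induction h with
  | refl c => simpa using h'
  | head h1 _ ih => rw [add_assoc]; exact Steps.head h1 (ih h')

theorem Steps.timeFrom {c c' : Config} {k : ℕ} (h : Steps c c' k) :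
    timeFrom c = k + timeFrom c' := by
  induction h with
  | refl c => simp
  | head h1 _ ih => rw [timeFrom_of_pure h1, ih]; push_cast; ring

theorem Steps.haltFrom (S : Set State) {c c' : Config} {k : ℕ} (h : Steps c c' k) :
    haltFrom S c' ≤ haltFrom S c := by
  induction h with
  | refl c => exact le_rfl
  | head h1 _ ih => exact ih.trans (haltFrom_of_pure S h1)

/-- Total correctness of a deterministic command with a cost bound: started in `s`, the command `P`
ends at cost at most `k` in a memory that satisfies `Q`. -/
def Ends (P : Cmd) (s : State) (k : ℕ) (Q : State → Prop) : Prop :=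
  ∃ s', Q s' ∧ ∃ k' ≤ k, ∀ K, Steps ⟨P :: K, s⟩ ⟨K, s'⟩ k'

theorem Ends.imp {P : Cmd} {s : State} {k l : ℕ} {Q R : State → Prop} (h : Ends P s k Q)
    (hkl : k ≤ l) (hQ : ∀ s', Q s' → R s') : Ends P s l R := by
  obtain ⟨s', h1, k', h2, h3⟩ := h
  exact ⟨s', hQ _ h1, k', h2.trans hkl, h3⟩

theorem Ends.seq {P P' : Cmd} {s : State} {k l : ℕ} {Q R : State → Prop} (h : Ends P s k Q)
    (h' : ∀ s', Q s' → Ends P' s' l R) : Ends (.seq P P') s (k + l + 1) R := by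
  obtain ⟨s', h1, k', h2, h3⟩ := h
  obtain ⟨s'', h1', l', h2', h3'⟩ := h' s' h1
  refine ⟨s'', h1', 1 + (k' + l'), by omega, fun K => ?_⟩
  have h4 : step ⟨.seq P P' :: K, s⟩ = PMF.pure ⟨P :: P' :: K, s⟩ := rfl
  exact Steps.head h4 ((h3 _).trans (h3' _))

/-- A loop with exactly `T` rounds and invariant `I`, where round `t` costs at most `k t`. -/
theorem Ends.loop {b : BExpr} {P : Cmd} (I : ℕ → State → Prop) (T : ℕ) (k : ℕ → ℕ)
    (hstep : ∀ t < T, ∀ s, I t s → b.Holds s ∧ Ends P s (k t) (I (t + 1)))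
    (hend : ∀ s, I T s → ¬ b.Holds s) {s : State} (h0 : I 0 s) :
    Ends (.loop b P) s (∑ t ∈ Finset.range T, (k t + b.cost + 1) + b.cost + 1) (I T) := by
  suffices h : ∀ d t, t + d = T → ∀ s, I t s →
      Ends (.loop b P) s (∑ i ∈ Finset.range d, (k (t + i) + b.cost + 1) + b.cost + 1) (I T) by
    simpa using h T 0 (by simp) s h0
  intro d
  induction d with
  | zero =>
    intro t ht s hs
    have ht' : t = T := by omega
    subst ht'
    refine ⟨s, hs, b.cost + 1, by simp, fun K => ?_⟩
    have h4 : step ⟨.loop b P :: K, s⟩ = PMF.pure ⟨K, s⟩ := by simp [step, hend s hs]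
    exact Steps.head h4 (Steps.refl _)
  | succ d ih =>
    intro t ht s hs
    obtain ⟨hb, s', h1, k', h2, h3⟩ := hstep t (by omega) s hs
    obtain ⟨s'', h1', l', h2', h3'⟩ := ih (t + 1) (by omega) s' h1
    refine ⟨s'', h1', (b.cost + 1) + (k' + l'), ?_, fun K => ?_⟩
    · rw [Finset.sum_range_succ']
      have : ∀ i, t + 1 + i = t + (i + 1) := fun i => by ring
      simp only [this] at h2'
      simp only [add_zero]
      omega
    · have h4 : step ⟨.loop b P :: K, s⟩ = PMF.pure ⟨P :: .loop b P :: K, s⟩ := by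
        simp [step, hb]
      exact Steps.head h4 ((h3 _).trans (h3' _))

theorem Ends.loop_const {b : BExpr} {P : Cmd} (I : ℕ → State → Prop) (T k : ℕ)
    (hstep : ∀ t < T, ∀ s, I t s → b.Holds s ∧ Ends P s k (I (t + 1)))
    (hend : ∀ s, I T s → ¬ b.Holds s) {s : State} (h0 : I 0 s) :
    Ends (.loop b P) s ((T + 1) * (k + b.cost + 1)) (I T) := by
  refine (Ends.loop I T (fun _ => k) hstep hend h0).imp ?_ fun _ h => h
  simp
  ring_nf
  omega

/-- Commands without loops and sampling. -/
def Cmd.Straight : Cmd → Prop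
  | .skip | .setNat _ _ _ | .setReal _ _ _ => True
  | .seq c d | .ite _ c d => c.Straight ∧ d.Straight
  | .sample _ _ _ | .loop _ _ => False

open Classical in
/-- The effect of a command without loops and sampling. -/
noncomputable def Cmd.exec : Cmd → State → State
  | .setNat a i e, s => s.writeNat a (i.eval s) (e.eval s)
  | .setReal a i e, s => s.writeReal a (i.eval s) (e.eval s)
  | .seq c d, s => d.exec (c.exec s)
  | .ite b c d, s => if b.Holds s then c.exec s else d.exec s
  | _, s => s

/-- Bound for the cost of a command without loops and sampling. -/
def Cmd.total : Cmd → ℕ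
  | .seq c d => c.total + d.total + 1
  | .ite b c d => b.cost + 1 + (c.total + d.total)
  | c => c.cost

theorem Cmd.Straight.ends {P : Cmd} (h : P.Straight) (s : State) :
    Ends P s P.total (fun s' => s' = P.exec s) := by
  induction P generalizing s with
  | skip => exact ⟨s, rfl, 1, le_rfl, fun K => Steps.head (c' := ⟨K, s⟩) rfl (Steps.refl _)⟩
  | setNat a i e => exact ⟨_, rfl, _, le_rfl, fun K => Steps.head rfl (Steps.refl _)⟩
  | setReal a i e => exact ⟨_, rfl, _, le_rfl, fun K => Steps.head rfl (Steps.refl _)⟩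
  | sample a i e => exact h.elim
  | loop b c => exact h.elim
  | seq c d hc hd =>
    refine (hc h.1 s).seq fun s' hs' => ?_
    rw [hs']
    exact hd h.2 _
  | ite b c d hc hd =>
    by_cases hb : b.Holds s
    · obtain ⟨s', h1, k', h2, h3⟩ := hc h.1 s
      refine ⟨s', by simpa [Cmd.exec, hb] using h1, b.cost + 1 + k', ?_, fun K => ?_⟩
      · simp only [Cmd.total]; omega
      · have h4 : step ⟨.ite b c d :: K, s⟩ = PMF.pure ⟨c :: K, s⟩ := by simp [step, hb]
        exact Steps.head h4 (h3 K)
    · obtain ⟨s', h1, k', h2, h3⟩ := hd h.2 s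
      refine ⟨s', by simpa [Cmd.exec, hb] using h1, b.cost + 1 + k', ?_, fun K => ?_⟩
      · simp only [Cmd.total]; omega
      · have h4 : step ⟨.ite b c d :: K, s⟩ = PMF.pure ⟨d :: K, s⟩ := by simp [step, hb]
        exact Steps.head h4 (h3 K)

theorem Cmd.Straight.ends' {P : Cmd} (h : P.Straight) {s : State} {Q : State → Prop}
    (hQ : Q (P.exec s)) : Ends P s P.total Q :=
  (h.ends s).imp le_rfl fun s' hs' => by rw [hs']; exact hQ

/-! ### Randomized executions -/

/-- Hoare triple for randomized commands.  Started in a memory with `Pre`, the command `P` takes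
expected time at most `c` and ends in a memory with `Post` in which the expectation of `ψ` is at most
the initial value of `φ`.  Both are expressed through arbitrary continuations: upper bounds for the
remaining expected time, and lower bounds for the halting probability that are affine in `ψ`, are
pulled back along `P`. -/
structure Bounds (P : Cmd) (Pre Post : State → Prop) (c : ℝ≥0∞) (φ ψ : State → ℝ) : Prop where
  time : ∀ (K : List Cmd) (B : ℝ≥0∞), (∀ s', Post s' → timeFrom ⟨K, s'⟩ ≤ B) →
    ∀ s, Pre s → timeFrom ⟨P :: K, s⟩ ≤ c + B
  value : ∀ (S : Set State) (K : List Cmd) (β γ : ℝ), 0 ≤ γ →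
    (∀ s', Post s' → ENNReal.ofReal (β - γ * ψ s') ≤ haltFrom S ⟨K, s'⟩) →
    ∀ s, Pre s → ENNReal.ofReal (β - γ * φ s) ≤ haltFrom S ⟨P :: K, s⟩

/-- A deterministic command along which the value does not increase. -/
theorem Bounds.of_ends {P : Cmd} {Pre Post : State → Prop} {k : ℕ} {φ ψ : State → ℝ}
    (h : ∀ s, Pre s → Ends P s k fun s' => Post s' ∧ ψ s' ≤ φ s) :
    Bounds P Pre Post k φ ψ where
  time K B hK s hs := by
    obtain ⟨s', ⟨h1, -⟩, k', h2, h3⟩ := h s hs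
    rw [(h3 K).timeFrom]
    have h2' : (k' : ℝ≥0∞) ≤ k := by exact_mod_cast h2
    exact add_le_add h2' (hK s' h1)
  value S K β γ hγ hK s hs := by
    obtain ⟨s', ⟨h1, h1'⟩, k', h2, h3⟩ := h s hs
    refine le_trans ?_ ((hK s' h1).trans ((h3 K).haltFrom S))
    apply ENNReal.ofReal_le_ofReal
    have := mul_le_mul_of_nonneg_left h1' hγ
    linarith

theorem Bounds.imp {P : Cmd} {Pre Post Pre' Post' : State → Prop} {c c' : ℝ≥0∞}
    {φ ψ φ' ψ' : State → ℝ} (h : Bounds P Pre Post c φ ψ) (hpre : ∀ s, Pre' s → Pre s)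
    (hpost : ∀ s, Post s → Post' s) (hc : c ≤ c') (hφ : ∀ s, Pre' s → φ s ≤ φ' s)
    (hψ : ∀ s, Post s → ψ' s ≤ ψ s) : Bounds P Pre' Post' c' φ' ψ' where
  time K B hK s hs :=
    (h.time K B (fun s' hs' => hK s' (hpost s' hs')) s (hpre s hs)).trans (add_le_add hc le_rfl)
  value S K β γ hγ hK s hs := by
    refine le_trans ?_ (h.value S K β γ hγ (fun s' hs' => le_trans ?_ (hK s' (hpost s' hs'))) s
      (hpre s hs))
    · apply ENNReal.ofReal_le_ofReal
      have := mul_le_mul_of_nonneg_left (hφ s hs) hγ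
      linarith
    · apply ENNReal.ofReal_le_ofReal
      have := mul_le_mul_of_nonneg_left (hψ s' hs') hγ
      linarith

/-- Linearity of expectation. -/
theorem Bounds.affine {P : Cmd} {Pre Post : State → Prop} {c : ℝ≥0∞} {φ ψ : State → ℝ}
    (h : Bounds P Pre Post c φ ψ) (a b : ℝ) (ha : 0 ≤ a) :
    Bounds P Pre Post c (fun s => b + a * φ s) (fun s => b + a * ψ s) where
  time := h.time
  value S K β γ hγ hK s hs := by
    have h1 := h.value S K (β - γ * b) (γ * a) (mul_nonneg hγ ha) (fun s' hs' => by
      refine le_trans (le_of_eq ?_) (hK s' hs')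
      congr 1
      ring) s hs
    refine le_trans (le_of_eq ?_) h1
    congr 1
    ring

theorem Bounds.seq {P P' : Cmd} {A B C : State → Prop} {c c' : ℝ≥0∞} {φ ψ χ : State → ℝ}
    (h : Bounds P A B c φ ψ) (h' : Bounds P' B C c' ψ χ) :
    Bounds (.seq P P') A C (c + c' + 1) φ χ where
  time K D hK s hs := by
    have h4 : step ⟨.seq P P' :: K, s⟩ = PMF.pure ⟨P :: P' :: K, s⟩ := rfl
    rw [timeFrom_of_pure h4]
    have h5 := h.time (P' :: K) (c' + D) (fun s' hs' => h'.time K D hK s' hs') s hs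
    refine (add_le_add le_rfl h5).trans (le_of_eq ?_)
    simp only [Config.cost, Cmd.cost]
    push_cast
    ring
  value S K β γ hγ hK s hs := by
    have h4 : step ⟨.seq P P' :: K, s⟩ = PMF.pure ⟨P :: P' :: K, s⟩ := rfl
    exact (h.value S (P' :: K) β γ hγ (fun s' hs' => h'.value S K β γ hγ hK s' hs') s hs).trans
      (haltFrom_of_pure S h4)

/-- A loop with exactly `T` rounds, where `φ t` is the value before round `t`. -/
theorem Bounds.loop {b : BExpr} {P : Cmd} (I : ℕ → State → Prop) (φ : ℕ → State → ℝ) (T : ℕ)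
    {c : ℝ≥0∞} (hstep : ∀ t < T, Bounds P (I t) (I (t + 1)) c (φ t) (φ (t + 1)))
    (hb : ∀ t < T, ∀ s, I t s → b.Holds s) (hend : ∀ s, I T s → ¬ b.Holds s) :
    Bounds (.loop b P) (I 0) (I T) ((T + 1) * (c + b.cost + 1)) (φ 0) (φ T) := by
  suffices h : ∀ d t, t + d = T →
      Bounds (.loop b P) (I t) (I T) ((d + 1) * (c + b.cost + 1)) (φ t) (φ T) from
    h T 0 (by simp)
  intro d
  induction d with
  | zero =>
    intro t ht
    have ht' : t = T := by omega
    subst ht'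
    have h := Bounds.of_ends (P := .loop b P) (Pre := I t) (Post := I t) (k := b.cost + 1)
      (φ := φ t) (ψ := φ t) fun s hs => by
        refine ⟨s, ⟨hs, le_rfl⟩, b.cost + 1, le_rfl, fun K => ?_⟩
        have h4 : step ⟨.loop b P :: K, s⟩ = PMF.pure ⟨K, s⟩ := by simp [step, hend s hs]
        exact Steps.head h4 (Steps.refl _)
    refine h.imp (fun _ h => h) (fun _ h => h) ?_ (fun _ _ => le_rfl) (fun _ _ => le_rfl)
    push_cast
    rw [zero_add, one_mul, add_assoc]
    exact le_add_self
  | succ d ih =>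
    intro t ht
    have h1 := hstep t (by omega)
    have h2 := ih (t + 1) (by omega)
    have h4 : ∀ s, I t s → ∀ K,
        step ⟨.loop b P :: K, s⟩ = PMF.pure ⟨P :: .loop b P :: K, s⟩ := fun s hs K => by
      simp [step, hb t (by omega) s hs]
    constructor
    · intro K B hK s hs
      rw [timeFrom_of_pure (h4 s hs K)]
      refine (add_le_add le_rfl (h1.time _ _ (fun s' hs' => h2.time K B hK s' hs') s hs)).trans
        (le_of_eq ?_)
      simp only [Config.cost, Cmd.cost]
      push_cast
      ring
    · intro S K β γ hγ hK s hs
      exact (h1.value S _ β γ hγ (fun s' hs' => h2.value S K β γ hγ hK s' hs') s hs).trans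
        (haltFrom_of_pure S (h4 s hs K))

theorem ofReal_sum_le {α : Type*} (s : Finset α) (f : α → ℝ) :
    ENNReal.ofReal (∑ i ∈ s, f i) ≤ ∑ i ∈ s, ENNReal.ofReal (f i) := by
  classical
  induction s using Finset.induction_on with
  | empty => simp
  | insert a s ha ih =>
    rw [Finset.sum_insert ha, Finset.sum_insert ha]
    exact ENNReal.ofReal_add_le.trans (add_le_add le_rfl ih)

/-- A random choice followed by a deterministic command.  The value may increase for some choices, but
not on average, and only the average cost counts. -/
theorem Bounds.sample {a : ℕ} {i e : NExpr} {P : Cmd} {Pre Post : State → Prop} {n : ℕ}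
    {k : ℕ → ℕ} {c : ℝ≥0∞} {φ ψ : State → ℝ} (hn : 0 < n)
    (hk : ∑ v ∈ Finset.range n, (k v : ℝ≥0∞) ≤ n * c)
    (h : ∀ s, Pre s → e.eval s + 1 = n ∧ ∃ w : ℕ → ℝ, ∑ v ∈ Finset.range n, w v ≤ n * φ s ∧
      ∀ v < n, Ends P (s.writeNat a (i.eval s) v) (k v) fun s' => Post s' ∧ ψ s' ≤ w v) :
    Bounds (.seq (.sample a i e) P) Pre Post (c + (Cmd.sample a i e).cost + 1) φ ψ := by
  have h4 : ∀ s K, step ⟨.seq (.sample a i e) P :: K, s⟩ =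
      PMF.pure ⟨.sample a i e :: P :: K, s⟩ := fun _ _ => rfl
  have hn0 : (n : ℝ≥0∞) ≠ 0 := by exact_mod_cast hn.ne'
  have hninv : (n : ℝ≥0∞)⁻¹ * n = 1 := ENNReal.inv_mul_cancel hn0 (ENNReal.natCast_ne_top n)
  constructor
  · intro K B hK s hs
    obtain ⟨h5, w, -, h7⟩ := h s hs
    have hcast : ((e.eval s + 1 : ℕ) : ℝ≥0∞) = n := by rw [h5]
    rw [timeFrom_of_pure (h4 s K), timeFrom_sample, hcast]
    have h8 : ∀ v : Fin (e.eval s + 1), (n : ℝ≥0∞)⁻¹ *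
        timeFrom ⟨P :: K, s.writeNat a (i.eval s) v⟩ ≤ (n : ℝ≥0∞)⁻¹ * ((k v : ℝ≥0∞) + B) := by
      intro v
      obtain ⟨s', ⟨h1, -⟩, k', h2, h3⟩ := h7 v (h5 ▸ v.2)
      rw [(h3 K).timeFrom]
      have h2' : (k' : ℝ≥0∞) ≤ k v := by exact_mod_cast h2
      exact mul_le_mul_right (add_le_add h2' (hK s' h1)) _
    have h9 : ∑ v : Fin (e.eval s + 1), (n : ℝ≥0∞)⁻¹ *
        timeFrom ⟨P :: K, s.writeNat a (i.eval s) v⟩ ≤ c + B := by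
      refine (Finset.sum_le_sum fun v _ => h8 v).trans ?_
      rw [Fin.sum_univ_eq_sum_range (fun v => (n : ℝ≥0∞)⁻¹ * ((k v : ℝ≥0∞) + B)), h5,
        ← Finset.mul_sum, Finset.sum_add_distrib]
      simp only [Finset.sum_const, Finset.card_range, nsmul_eq_mul]
      refine (mul_le_mul_right (add_le_add hk le_rfl) _).trans (le_of_eq ?_)
      rw [← mul_add, ← mul_assoc, hninv, one_mul]
    refine (add_le_add le_rfl (add_le_add le_rfl h9)).trans (le_of_eq ?_)
    simp only [Config.cost, Cmd.cost]
    push_cast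
    ring
  · intro S K β γ hγ hK s hs
    obtain ⟨h5, w, h6, h7⟩ := h s hs
    refine le_trans ?_ (haltFrom_of_pure S (h4 s K))
    refine le_trans ?_ (haltFrom_sample S a i e (P :: K) s)
    have hcast : ((e.eval s + 1 : ℕ) : ℝ≥0∞) = n := by rw [h5]
    rw [hcast]
    have hnr : (0 : ℝ) < n := by exact_mod_cast hn
    have h8 : ∀ v : Fin (e.eval s + 1), ENNReal.ofReal ((n : ℝ)⁻¹ * (β - γ * w v)) ≤
        (n : ℝ≥0∞)⁻¹ * haltFrom S ⟨P :: K, s.writeNat a (i.eval s) v⟩ := by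
      intro v
      obtain ⟨s', ⟨h1, h1'⟩, k', h2, h3⟩ := h7 v (h5 ▸ v.2)
      rw [ENNReal.ofReal_mul (by positivity), ENNReal.ofReal_inv_of_pos hnr,
        ENNReal.ofReal_natCast]
      refine mul_le_mul_right (le_trans ?_ ((hK s' h1).trans ((h3 K).haltFrom S))) _
      apply ENNReal.ofReal_le_ofReal
      have := mul_le_mul_of_nonneg_left h1' hγ
      linarith
    refine le_trans ?_ (Finset.sum_le_sum fun v _ => h8 v)
    refine le_trans ?_ (ofReal_sum_le _ _)
    apply ENNReal.ofReal_le_ofReal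
    rw [Fin.sum_univ_eq_sum_range (fun v => (n : ℝ)⁻¹ * (β - γ * w v)), h5, ← Finset.mul_sum,
      Finset.sum_sub_distrib, ← Finset.mul_sum]
    simp only [Finset.sum_const, Finset.card_range, nsmul_eq_mul]
    have h9 := mul_le_mul_of_nonneg_left h6 hγ
    rw [inv_mul_eq_div, le_div_iff₀ hnr]
    linarith

end RealRAM

/-! ### One step of accelerated coordinate descent -/

namespace Covering

open Finset

/-- A covering problem with nonnegative matrix `B`, with rows `j < m` and variables `q < Q`, in which
the entries of column `q` are at most `cap q`; `μ` is the smoothing parameter and `v` the weight of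
the penalty.  Vectors are functions on `ℕ` of which only the first entries matter. -/
structure Smoothed where
  Q : ℕ
  m : ℕ
  B : ℕ → ℕ → ℝ
  cap : ℕ → ℝ
  μ : ℝ
  v : ℝ

namespace Smoothed

variable (D : Smoothed)

/-- The conditions under which coordinate descent is analysed. -/
structure Valid : Prop where
  Q_pos : 0 < D.Q
  cap_pos : ∀ q < D.Q, 0 < D.cap q
  B_nonneg : ∀ j < D.m, ∀ q < D.Q, 0 ≤ D.B j q
  B_le : ∀ j < D.m, ∀ q < D.Q, D.B j q ≤ D.cap q
  μ_pos : 0 < D.μ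
  μ_le : D.μ ≤ 1
  v_pos : 0 < D.v

/-- The entry `(B x)_j`. -/
def load (x : ℕ → ℝ) (j : ℕ) : ℝ := ∑ q ∈ range D.Q, D.B j q * x q

/-- The exponential penalty of row `j`. -/
noncomputable def pen (x : ℕ → ℝ) (j : ℕ) : ℝ := Real.exp ((1 - D.load x j) / D.μ)

/-- The smoothed objective: cost plus weighted exponential penalties. -/
noncomputable def obj (x : ℕ → ℝ) : ℝ :=
  ∑ q ∈ range D.Q, x q + D.μ * D.v * ∑ j ∈ range D.m, D.pen x j

/-- The partial derivative of the smoothed objective with respect to variable `q`. -/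
noncomputable def grad (x : ℕ → ℝ) (q : ℕ) : ℝ := 1 - D.v * ∑ j ∈ range D.m, D.B j q * D.pen x j

/-- The upper bound for variable `q`: a step of this size changes `B x` by at most `4`. -/
noncomputable def box (q : ℕ) : ℝ := 4 / D.cap q

/-- Membership in the box `∏ [0, box q]`. -/
def InBox (x : ℕ → ℝ) : Prop := ∀ q < D.Q, 0 ≤ x q ∧ x q ≤ D.box q

/-- The inverse step size of coordinate descent. -/
noncomputable def L : ℝ := 16 / D.μ

/-- The rate at which the weight of the past decays in one step. -/
noncomputable def τ : ℝ := 1 / (2 * D.Q * D.L)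

/-- Squared distance in the norm in which all coordinates have the same smoothness. -/
noncomputable def dist2 (u z : ℕ → ℝ) : ℝ := ∑ q ∈ range D.Q, (z q - u q) ^ 2 / (2 * D.box q)

variable {D}

theorem Valid.L_pos (h : D.Valid) : 0 < D.L := div_pos (by norm_num) h.μ_pos

theorem Valid.L_ge (h : D.Valid) : 16 ≤ D.L := by
  unfold L
  rw [le_div_iff₀ h.μ_pos]
  nlinarith [h.μ_le]

theorem Valid.τ_pos (h : D.Valid) : 0 < D.τ := by
  have := h.L_pos
  have : (0 : ℝ) < D.Q := by exact_mod_cast h.Q_pos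
  unfold τ
  positivity

theorem Valid.τ_le (h : D.Valid) : D.τ ≤ 1 / 32 := by
  have h1 := h.L_ge
  have h2 : (1 : ℝ) ≤ D.Q := by exact_mod_cast h.Q_pos
  unfold τ
  apply one_div_le_one_div_of_le (by norm_num)
  nlinarith

theorem Valid.box_pos (h : D.Valid) {q : ℕ} (hq : q < D.Q) : 0 < D.box q :=
  div_pos (by norm_num) (h.cap_pos q hq)

/-- The penalties are nonnegative. -/
theorem sum_le_obj (h : D.Valid) (x : ℕ → ℝ) :
    ∑ q ∈ range D.Q, x q ≤ D.obj x := by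
  have : 0 ≤ D.μ * D.v * ∑ j ∈ range D.m, D.pen x j :=
    mul_nonneg (mul_nonneg h.μ_pos.le h.v_pos.le) (sum_nonneg fun j _ => (Real.exp_pos _).le)
  unfold obj
  linarith

/-- Convexity of the smoothed objective. -/
theorem Valid.convex (h : D.Valid) (x u : ℕ → ℝ) :
    D.obj x + ∑ q ∈ range D.Q, D.grad x q * (u q - x q) ≤ D.obj u := by
  have h1 : ∑ q ∈ range D.Q, D.grad x q * (u q - x q) =
      ∑ q ∈ range D.Q, u q - ∑ q ∈ range D.Q, x q -
        D.v * ∑ j ∈ range D.m, D.pen x j * (D.load u j - D.load x j) := by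
    have h2 : ∀ j, D.pen x j * (D.load u j - D.load x j) =
        ∑ q ∈ range D.Q, D.B j q * D.pen x j * (u q - x q) := by
      intro j
      unfold load
      rw [← sum_sub_distrib, mul_sum]
      exact sum_congr rfl fun q _ => by ring
    simp only [h2]
    rw [sum_comm, mul_sum, ← sum_sub_distrib, ← sum_sub_distrib]
    refine sum_congr rfl fun q _ => ?_
    unfold grad
    rw [← sum_mul]
    ring
  have h3 : ∀ j ∈ range D.m, D.pen x j * (D.μ + D.load x j - D.load u j) ≤ D.μ * D.pen u j := by
    intro j _
    have h4 : D.pen u j = D.pen x j * Real.exp ((D.load x j - D.load u j) / D.μ) := by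
      unfold pen
      rw [← Real.exp_add]
      congr 1
      ring
    have h5 := Real.add_one_le_exp ((D.load x j - D.load u j) / D.μ)
    have h6 : D.μ + D.load x j - D.load u j = D.μ * ((D.load x j - D.load u j) / D.μ + 1) := by
      have := h.μ_pos.ne'
      field_simp
      ring
    rw [h4, h6]
    have h7 : 0 < D.pen x j := Real.exp_pos _
    have h8 := mul_le_mul_of_nonneg_left h5 (mul_pos h7 h.μ_pos).le
    linarith
  have h4 := mul_le_mul_of_nonneg_left (sum_le_sum h3) h.v_pos.le
  have h5 : ∑ j ∈ range D.m, D.pen x j * (D.μ + D.load x j - D.load u j) =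
      D.μ * ∑ j ∈ range D.m, D.pen x j -
        ∑ j ∈ range D.m, D.pen x j * (D.load u j - D.load x j) := by
    rw [mul_sum, ← sum_sub_distrib]
    exact sum_congr rfl fun j _ => by ring
  rw [h5, ← mul_sum] at h4
  rw [h1]
  unfold obj
  linarith

theorem load_update {x : ℕ → ℝ} {q : ℕ} (hq : q < D.Q) (δ : ℝ) (j : ℕ) :
    D.load (Function.update x q (x q + δ)) j = D.load x j + D.B j q * δ := by
  unfold load
  have h : ∀ r ∈ range D.Q, D.B j r * Function.update x q (x q + δ) r =
      D.B j r * x r + if r = q then D.B j q * δ else 0 := by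
    intro r _
    by_cases hr : r = q
    · subst hr; simp; ring
    · simp [hr]
  rw [sum_congr rfl h, sum_add_distrib, sum_ite_eq']
  simp [hq]

theorem sum_update {x : ℕ → ℝ} {q n : ℕ} (hq : q < n) (δ : ℝ) :
    ∑ r ∈ range n, Function.update x q (x q + δ) r = ∑ r ∈ range n, x r + δ := by
  have h : ∀ r ∈ range n, Function.update x q (x q + δ) r =
      x r + if r = q then δ else 0 := by
    intro r _
    by_cases hr : r = q
    · subst hr; simp
    · simp [hr]
  rw [sum_congr rfl h, sum_add_distrib, sum_ite_eq']
  simp [hq]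

/-- Only the penalties depend negatively on a variable, so derivatives are bounded above. -/
theorem Valid.grad_le (h : D.Valid) (x : ℕ → ℝ) {q : ℕ} (hq : q < D.Q) : D.grad x q ≤ 1 := by
  have : 0 ≤ D.v * ∑ j ∈ range D.m, D.B j q * D.pen x j :=
    mul_nonneg h.v_pos.le (sum_nonneg fun j hj =>
      mul_nonneg (h.B_nonneg j (mem_range.1 hj) q hq) (Real.exp_pos _).le)
  unfold grad
  linarith

/-- Along a coordinate the objective is smooth with a constant proportional to `1 - grad`, as long as
no penalty changes by more than a constant factor. -/
theorem Valid.descent (h : D.Valid) (x : ℕ → ℝ) {q : ℕ} (hq : q < D.Q) {δ : ℝ}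
    (hδ : D.cap q * |δ| ≤ D.μ) :
    D.obj (Function.update x q (x q + δ)) ≤
      D.obj x + D.grad x q * δ + (1 - D.grad x q) * (D.cap q / D.μ) * δ ^ 2 := by
  have hμ := h.μ_pos
  have hc := h.cap_pos q hq
  have key : ∀ j ∈ range D.m, D.μ * D.pen (Function.update x q (x q + δ)) j ≤
      D.μ * D.pen x j - D.B j q * D.pen x j * δ +
        D.B j q * D.pen x j * ((D.cap q / D.μ) * δ ^ 2) := by
    intro j hj
    have hB0 := h.B_nonneg j (mem_range.1 hj) q hq
    have hB1 := h.B_le j (mem_range.1 hj) q hq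
    have h4 : D.pen (Function.update x q (x q + δ)) j =
        D.pen x j * Real.exp (-(D.B j q * δ / D.μ)) := by
      unfold pen
      rw [← Real.exp_add, load_update hq]
      congr 1
      ring
    have h5 : |-(D.B j q * δ / D.μ)| ≤ 1 := by
      rw [abs_neg, abs_div, abs_mul, abs_of_nonneg hB0, abs_of_pos hμ, div_le_one hμ]
      exact (mul_le_mul_of_nonneg_right hB1 (abs_nonneg _)).trans hδ
    have h6 := (abs_le.1 (Real.abs_exp_sub_one_sub_id_le h5)).2
    have h7 : 0 < D.pen x j := Real.exp_pos _
    have h8 : D.B j q * (D.B j q * δ ^ 2) ≤ D.B j q * (D.cap q * δ ^ 2) := by gcongr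
    have h9 : D.μ * (D.B j q * δ / D.μ) ^ 2 ≤ D.B j q * ((D.cap q / D.μ) * δ ^ 2) := by
      have e1 : D.μ * (D.B j q * δ / D.μ) ^ 2 = D.B j q * (D.B j q * δ ^ 2) / D.μ := by
        field_simp
      have e2 : D.B j q * ((D.cap q / D.μ) * δ ^ 2) = D.B j q * (D.cap q * δ ^ 2) / D.μ := by
        field_simp
      rw [e1, e2]
      gcongr
    have h10 : D.μ * Real.exp (-(D.B j q * δ / D.μ)) ≤
        D.μ - D.B j q * δ + D.B j q * ((D.cap q / D.μ) * δ ^ 2) := by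
      have e3 : D.μ * (D.B j q * δ / D.μ) = D.B j q * δ := by field_simp
      have := mul_le_mul_of_nonneg_left h6 hμ.le
      nlinarith
    rw [h4]
    have := mul_le_mul_of_nonneg_left h10 h7.le
    linarith
  have h1 := mul_le_mul_of_nonneg_left (sum_le_sum key) h.v_pos.le
  rw [sum_add_distrib, sum_sub_distrib, ← mul_sum, ← mul_sum, ← sum_mul, ← sum_mul] at h1
  unfold obj
  rw [sum_update hq]
  have h2 : 1 - D.grad x q = D.v * ∑ j ∈ range D.m, D.B j q * D.pen x j := by
    unfold grad; ring
  have h3 : D.grad x q * δ = δ - D.v * (∑ j ∈ range D.m, D.B j q * D.pen x j) * δ := by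
    unfold grad; ring
  rw [h2, h3]
  linarith

/-- The mirror step in one coordinate: a step of length `g / (L s)` along the truncated derivative,
relative to the size `b` of the box, followed by projection to the box. -/
noncomputable def mirror (L s b g z : ℝ) : ℝ := min b (max 0 (z - max g (-1) / (L * s) * b))

theorem mirror_nonneg {L s b g z : ℝ} (hb : 0 ≤ b) : 0 ≤ mirror L s b g z :=
  le_min hb (le_max_left _ _)

theorem mirror_le {L s b g z : ℝ} : mirror L s b g z ≤ b := min_le_left _ _

/-- The variational inequality that characterizes the projection to an interval. -/
theorem proj_inequality {b w u : ℝ} (hb : 0 ≤ b) (hu0 : 0 ≤ u) (hub : u ≤ b) :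
    0 ≤ (min b (max 0 w) - w) * (u - min b (max 0 w)) := by
  rcases le_total w 0 with h0 | h0
  · rw [max_eq_left h0, min_eq_right hb]
    nlinarith
  · rw [max_eq_right h0]
    rcases le_total w b with h1 | h1
    · rw [min_eq_right h1]; simp
    · rw [min_eq_left h1]; nlinarith

/-- The progress in one coordinate.  The first-order term `g (z - u)` is paid for by the decrease
`d` of the objective and the decrease of the squared distance to `u`.  If `g < -1`, the part of `g`
that the truncation cuts off is also paid for by the decrease of the objective, as `u - z` is at most
the size of the box. -/
theorem mirror_progress {L s b g z u d μ : ℝ} (hμ : 0 < μ) (hL : L = 16 / μ) (hs : 0 < s)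
    (hsL : 1 ≤ L * s) (hb : 0 < b) (hz0 : 0 ≤ z) (hzb : z ≤ b) (hu0 : 0 ≤ u)
    (hub : u ≤ b)
    (hd : -(g * (s * (mirror L s b g z - z)) +
      (1 - g) * (4 / b / μ) * (s * (mirror L s b g z - z)) ^ 2) ≤ d) :
    1 / (L * s) * (g * (z - u)) ≤
      2 / s * d + (z - u) ^ 2 / (2 * b) - (mirror L s b g z - u) ^ 2 / (2 * b) := by
  have hLpos : 0 < L := by rw [hL]; positivity
  have hc : 4 / b / μ = L / (4 * b) := by rw [hL]; field_simp; norm_num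
  set a := 1 / (L * s) with ha
  have ha0 : 0 < a := by positivity
  have ha1 : a ≤ 1 := by rw [ha, div_le_one (by positivity)]; exact hsL
  have has : a * (L * s) = 1 := by rw [ha]; field_simp
  set ξ := max g (-1) with hξ
  set w := z - ξ / (L * s) * b with hw
  have hw' : w = z - a * ξ * b := by rw [hw, ha]; ring
  have hmdef : mirror L s b g z = min b (max 0 w) := rfl
  have hp := proj_inequality (w := w) hb.le hu0 hub
  have hp' := proj_inequality (w := w) hb.le hz0 hzb
  rw [hc] at hd
  rw [← hmdef] at hp hp'
  generalize hz' : mirror L s b g z = z' at *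
  -- it suffices to prove the inequality multiplied by `2 b`
  have e1 : 2 / s * d + (z - u) ^ 2 / (2 * b) - (z' - u) ^ 2 / (2 * b) - a * (g * (z - u)) =
      (1 / (2 * b)) * (4 * b / s * d + (z - u) ^ 2 - (z' - u) ^ 2 - 2 * b * (a * (g * (z - u)))) := by
    field_simp
    ring
  suffices hmain : 0 ≤ 4 * b / s * d + (z - u) ^ 2 - (z' - u) ^ 2 - 2 * b * (a * (g * (z - u))) by
    have := mul_nonneg (by positivity : 0 ≤ 1 / (2 * b)) hmain
    linarith
  rw [hw'] at hp hp'
  have hd2 : 4 * b / s * (-(g * (s * (z' - z)) + (1 - g) * (L / (4 * b)) * (s * (z' - z)) ^ 2)) ≤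
      4 * b / s * d := mul_le_mul_of_nonneg_left hd (by positivity)
  have e2 : 4 * b / s * (-(g * (s * (z' - z)) + (1 - g) * (L / (4 * b)) * (s * (z' - z)) ^ 2)) =
      -(4 * b * g * (z' - z)) - (1 - g) * (L * s) * (z' - z) ^ 2 := by
    field_simp
    ring
  rw [e2] at hd2
  have hLs : L * s = 1 / a := by rw [ha]; field_simp
  rw [hLs] at hd2
  generalize 4 * b / s * d = D' at *
  have hΔ : (z' - z) ^ 2 ≤ -(a * ξ * b * (z' - z)) := by linarith
  clear e1 e2 hd hz' has hLs hc hL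
  clear_value w a ξ
  rcases le_or_gt (-1) g with hg1 | hg1
  · have hξg : ξ = g := hξ.trans (max_eq_left hg1)
    rw [hξg] at hp hp' hΔ
    -- `D' ≥ 2 (-(2 b g Δ) - Δ² / a) ≥ 0`
    obtain ⟨Δ, hΔdef⟩ : ∃ Δ, Δ = z' - z := ⟨_, rfl⟩
    simp only [← hΔdef] at hd2 hΔ
    have h3 : (1 - g) * (1 / a) * Δ ^ 2 ≤ 2 * (1 / a * Δ ^ 2) := by
      have h0 : 0 ≤ 1 / a * Δ ^ 2 := by positivity
      have := mul_le_mul_of_nonneg_right (by linarith : 1 - g ≤ 2) h0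
      linarith
    have h4 : 1 / a * Δ ^ 2 ≤ -(g * b * Δ) := by
      have e3 : -(g * b * Δ) = 1 / a * (-(a * g * b * Δ)) := by field_simp
      rw [e3]
      exact mul_le_mul_of_nonneg_left hΔ (by positivity)
    have h5 : -(4 * b * g * Δ) - 2 * (1 / a * Δ ^ 2) ≤ D' := by linarith
    have h6 : 0 ≤ 1 / a * Δ ^ 2 := by positivity
    -- compare with `a` times the lower bound for `D'`
    have h7 : a * (-(4 * b * g * Δ) - 2 * (1 / a * Δ ^ 2)) ≤ D' := by
      have h8 : 0 ≤ -(4 * b * g * Δ) - 2 * (1 / a * Δ ^ 2) := by linarith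
      exact (mul_le_of_le_one_left h8 ha1).trans h5
    have e4 : a * (-(4 * b * g * Δ) - 2 * (1 / a * Δ ^ 2)) = -(4 * a * b * g * Δ) - 2 * Δ ^ 2 := by
      field_simp
    rw [e4] at h7
    have e5 : z' = z + Δ := by rw [hΔdef]; ring
    rw [e5] at hp ⊢
    linarith [sq_nonneg Δ]
  · have hξg : ξ = -1 := hξ.trans (max_eq_right hg1.le)
    rw [hξg] at hp hp' hΔ
    have hmin : z' = min b (z + a * b) := by
      rw [hmdef, hw', hξg, max_eq_right]
      · congr 1; ring
      · nlinarith
    have hΔ0 : 0 ≤ z' - z := by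
      rw [hmin]
      have : z ≤ min b (z + a * b) := le_min hzb (by nlinarith)
      linarith
    have hΔ1 : z' - z ≤ a * b := by
      rw [hmin]
      have := min_le_right b (z + a * b)
      linarith
    have hcut : a * (u - z) ≤ z' - z := by
      rcases min_cases b (z + a * b) with ⟨h1, h2⟩ | ⟨h1, h2⟩
      · rw [hmin, h1]
        rcases le_total u z with h3 | h3
        · nlinarith
        · nlinarith
      · rw [hmin, h1]; nlinarith
    obtain ⟨Δ, hΔdef⟩ : ∃ Δ, Δ = z' - z := ⟨_, rfl⟩
    simp only [← hΔdef] at hd2 hΔ hΔ0 hΔ1 hcut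
    have e5 : z' = z + Δ := by rw [hΔdef]; ring
    rw [e5] at hp ⊢
    -- the second-order term is at most half of the first-order term
    have h3 : (1 - g) * (1 / a) * Δ ^ 2 ≤ -(2 * g * b * Δ) := by
      have h4 : 1 / a * Δ ^ 2 ≤ b * Δ := by
        have e3 : b * Δ = 1 / a * (a * b * Δ) := by field_simp
        rw [e3]
        refine mul_le_mul_of_nonneg_left ?_ (by positivity)
        rw [sq]
        exact mul_le_mul_of_nonneg_right hΔ1 hΔ0
      have h5 : 0 ≤ 1 / a * Δ ^ 2 := by positivity
      have h6 : (1 - g) * (1 / a * Δ ^ 2) ≤ (-(2 * g)) * (b * Δ) := by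
        apply mul_le_mul (by linarith) h4 h5 (by linarith)
      linarith
    have h4 : -(2 * b * g * Δ) ≤ D' := by linarith
    have h5 : 0 ≤ (-g - 1) * (Δ - a * (u - z)) := mul_nonneg (by linarith) (by linarith)
    have h5' := mul_nonneg hb.le h5
    have h6 : a * b * Δ ≤ b * Δ := by
      rw [mul_assoc]
      exact mul_le_of_le_one_left (mul_nonneg hb.le hΔ0) ha1
    linarith [sq_nonneg Δ]

end Smoothed

end Covering

namespace Covering
open Finset
namespace Smoothed

variable (D : Smoothed)

/-- The averaged iterate `y`, respectively the extrapolated point `x`, in terms of the mirror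
iterate `z`, the accumulated correction `R` and the current weight `s`. -/
def point (z R : ℕ → ℝ) (s : ℝ) (q : ℕ) : ℝ := z q - s * R q

/-- The new value of coordinate `q` of the mirror iterate. -/
noncomputable def newZ (z R : ℕ → ℝ) (s : ℝ) (q : ℕ) : ℝ :=
  mirror D.L s (D.box q) (D.grad (point z R s) q) (z q)

/-- The mirror iterate after a step in coordinate `q`. -/
noncomputable def nextZ (z R : ℕ → ℝ) (s : ℝ) (q : ℕ) : ℕ → ℝ :=
  Function.update z q (z q + (D.newZ z R s q - z q))

/-- The accumulated correction after a step in coordinate `q`. -/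
noncomputable def nextR (z R : ℕ → ℝ) (s : ℝ) (q : ℕ) : ℕ → ℝ :=
  Function.update R q (R q + (1 / s - 1) * (D.newZ z R s q - z q))

/-- The quantity that does not increase in expectation. -/
noncomputable def potential (u z R : ℕ → ℝ) (s : ℝ) : ℝ :=
  2 / s * (D.obj (point z R s) - D.obj u) + D.dist2 u z

/-- The invariant of a run: `z` is in the box, and so is, up to the factor `1 - s`, the weighted
average of the past iterates. -/
def RunInv (z R : ℕ → ℝ) (s : ℝ) : Prop :=
  D.InBox z ∧ ∀ q < D.Q, 0 ≤ (1 - s) * z q - s * R q ∧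
    (1 - s) * z q - s * R q ≤ (1 - s) * D.box q

variable {D}

theorem RunInv.point_inBox {z R : ℕ → ℝ} {s : ℝ} (hs : 0 ≤ s) (h : D.RunInv z R s) :
    D.InBox (point z R s) := by
  intro q hq
  obtain ⟨h1, h2⟩ := h.1 q hq
  obtain ⟨h3, h4⟩ := h.2 q hq
  unfold point
  constructor <;> nlinarith

theorem InBox.runInv {z : ℕ → ℝ} (h : D.InBox z) : D.RunInv z (fun _ => 0) 1 :=
  ⟨h, fun q _ => by simp⟩

/-- The average of the past iterates and the current one stays in the box; a step in the new iterate is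
exactly compensated by the correction. -/
theorem RunInv.next (hD : D.Valid) {z R : ℕ → ℝ} {s : ℝ} (hs : 0 < s)
    (h : D.RunInv z R s) (q : ℕ) :
    D.RunInv (D.nextZ z R (s * (1 - D.τ)) q) (D.nextR z R (s * (1 - D.τ)) q)
      (s * (1 - D.τ)) := by
  have hτ0 := hD.τ_pos
  have hτ1 := hD.τ_le
  set s' := s * (1 - D.τ) with hs'
  have hs'0 : 0 < s' := mul_pos hs (by linarith)
  have old : ∀ r < D.Q, 0 ≤ (1 - s') * z r - s' * R r ∧
      (1 - s') * z r - s' * R r ≤ (1 - s') * D.box r := by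
    intro r hr
    obtain ⟨h1, h2⟩ := h.1 r hr
    obtain ⟨h3, h4⟩ := h.2 r hr
    have e1 : (1 - s') * z r - s' * R r =
        (1 - D.τ) * ((1 - s) * z r - s * R r) + D.τ * z r := by rw [hs']; ring
    have e2 : (1 - s') * D.box r =
        (1 - D.τ) * ((1 - s) * D.box r) + D.τ * D.box r := by rw [hs']; ring
    rw [e1, e2]
    have h5 : 0 ≤ 1 - D.τ := by linarith
    exact ⟨add_nonneg (mul_nonneg h5 h3) (mul_nonneg hτ0.le h1),
      add_le_add (mul_le_mul_of_nonneg_left h4 h5) (mul_le_mul_of_nonneg_left h2 hτ0.le)⟩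
  constructor
  · intro r hr
    by_cases hrq : r = q
    · subst hrq
      simp only [nextZ, Function.update_self, add_sub_cancel]
      exact ⟨mirror_nonneg (hD.box_pos hr).le, mirror_le⟩
    · simp only [nextZ, Function.update_of_ne hrq]
      exact h.1 r hr
  · intro r hr
    by_cases hrq : r = q
    · subst hrq
      simp only [nextZ, nextR, Function.update_self]
      have e1 : (1 - s') * (z r + (D.newZ z R s' r - z r)) -
          s' * (R r + (1 / s' - 1) * (D.newZ z R s' r - z r)) = (1 - s') * z r - s' * R r := by
        field_simp
        ring
      rw [e1]
      exact old r hr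
    · simp only [nextZ, nextR, Function.update_of_ne hrq]
      exact old r hr

/-- Moving the mirror iterate by `Δ` moves the averaged point by `s * Δ`. -/
theorem point_next {z R : ℕ → ℝ} {s : ℝ} (hs : s ≠ 0) (q : ℕ) :
    point (D.nextZ z R s q) (D.nextR z R s q) s =
      Function.update (point z R s) q (point z R s q + s * (D.newZ z R s q - z q)) := by
  funext r
  by_cases hrq : r = q
  · subst hrq
    simp only [point, nextZ, nextR, Function.update_self]
    field_simp
    ring
  · simp only [point, nextZ, nextR, Function.update_of_ne hrq]

theorem dist2_nextZ {u z R : ℕ → ℝ} {s : ℝ} {q : ℕ} (hq : q < D.Q) :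
    D.dist2 u (D.nextZ z R s q) = D.dist2 u z +
      (D.newZ z R s q - u q) ^ 2 / (2 * D.box q) - (z q - u q) ^ 2 / (2 * D.box q) := by
  have h : D.dist2 u (D.nextZ z R s q) - D.dist2 u z =
      (D.newZ z R s q - u q) ^ 2 / (2 * D.box q) - (z q - u q) ^ 2 / (2 * D.box q) := by
    unfold dist2
    rw [← sum_sub_distrib, sum_eq_single_of_mem q (mem_range.2 hq)]
    · simp [nextZ]
    · intro r _ hr
      simp [nextZ, Function.update_of_ne hr]
  linarith

/-- The step is small, as the truncated derivative lies in `[-1, 1]` and projection does not expand. -/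
theorem abs_mirror_sub_le {L s b g z : ℝ} (hL : 0 < L) (hs : 0 < s) (hb : 0 ≤ b) (hg : g ≤ 1)
    (hz0 : 0 ≤ z) (hzb : z ≤ b) : |mirror L s b g z - z| ≤ b / (L * s) := by
  have h0 : 0 ≤ b / (L * s) := by positivity
  have h1 : max g (-1) / (L * s) * b = max g (-1) * (b / (L * s)) := by ring
  have h2 : max g (-1) * (b / (L * s)) ≤ b / (L * s) :=
    mul_le_of_le_one_left h0 (max_le hg (by norm_num))
  have h3 : -(b / (L * s)) ≤ max g (-1) * (b / (L * s)) := by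
    have := mul_le_mul_of_nonneg_right (le_max_right g (-1)) h0
    linarith
  unfold mirror
  rw [h1, abs_le]
  generalize max g (-1) * (b / (L * s)) = c at *
  constructor
  · have : z - b / (L * s) ≤ min b (max 0 (z - c)) :=
      le_min (by linarith) (le_max_of_le_right (by linarith))
    linarith
  · have : min b (max 0 (z - c)) ≤ z + b / (L * s) :=
      min_le_of_right_le (max_le (by linarith) (by linarith))
    linarith

/-- Progress of one coordinate step, relative to the first-order gap in that coordinate. -/
theorem Valid.coordinate_progress (hD : D.Valid) {u z R : ℕ → ℝ} {s : ℝ} (hs : 0 < s)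
    (hsL : 1 ≤ D.L * s) (hz : D.InBox z) (hu : D.InBox u) {q : ℕ} (hq : q < D.Q) :
    1 / (D.L * s) * (D.grad (point z R s) q * (z q - u q)) ≤
      2 / s * (D.obj (point z R s) - D.obj (point (D.nextZ z R s q) (D.nextR z R s q) s)) +
        D.dist2 u z - D.dist2 u (D.nextZ z R s q) := by
  have hb := hD.box_pos hq
  have hL := hD.L_pos
  have hc := hD.cap_pos q hq
  have hcap : D.cap q = 4 / D.box q := by unfold box; field_simp
  rw [dist2_nextZ hq, point_next hs.ne']
  set x := point z R s with hx
  set Δ := D.newZ z R s q - z q with hΔ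
  have hsmall : D.cap q * |s * Δ| ≤ D.μ := by
    have h1 := abs_mirror_sub_le hL hs hb.le (hD.grad_le x hq) (hz q hq).1 (hz q hq).2
    have h2 : mirror D.L s (D.box q) (D.grad x q) (z q) - z q = Δ := rfl
    rw [h2] at h1
    rw [abs_mul, abs_of_pos hs]
    have h3 : D.cap q * (s * (D.box q / (D.L * s))) = D.μ / 4 := by
      have := hD.μ_pos
      rw [hcap]
      unfold L
      field_simp
      norm_num
    have h4 : D.cap q * (s * |Δ|) ≤ D.cap q * (s * (D.box q / (D.L * s))) := by gcongr
    linarith [hD.μ_pos]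
  have hd := hD.descent x hq hsmall
  have h := mirror_progress (L := D.L) (g := D.grad x q)
    (d := D.obj x - D.obj (Function.update x q (x q + s * Δ))) hD.μ_pos rfl hs hsL hb
    (hz q hq).1 (hz q hq).2 (hu q hq).1 (hu q hq).2 (by
      have : mirror D.L s (D.box q) (D.grad x q) (z q) - z q = Δ := rfl
      rw [this, ← hcap]
      linarith)
  have : mirror D.L s (D.box q) (D.grad x q) (z q) = D.newZ z R s q := rfl
  rw [this] at h
  linarith

/-- In expectation over a uniformly random coordinate, the potential does not increase. -/
theorem Valid.potential_step (hD : D.Valid) {u z R : ℕ → ℝ} {s : ℝ} (hs : 0 < s)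
    (hsL : 1 ≤ D.L * (s * (1 - D.τ))) (hz : D.InBox z) (hu : D.InBox u) :
    ∑ q ∈ range D.Q, D.potential u (D.nextZ z R (s * (1 - D.τ)) q)
        (D.nextR z R (s * (1 - D.τ)) q) (s * (1 - D.τ)) ≤ D.Q * D.potential u z R s := by
  have hτ0 := hD.τ_pos
  have hτ1 := hD.τ_le
  have hL := hD.L_pos
  have hQ : (0 : ℝ) < D.Q := by exact_mod_cast hD.Q_pos
  have h1τ : 0 < 1 - D.τ := by linarith
  obtain ⟨s', hs'⟩ : ∃ s', s' = s * (1 - D.τ) := ⟨_, rfl⟩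
  rw [← hs'] at hsL ⊢
  have hs'0 : 0 < s' := hs' ▸ mul_pos hs h1τ
  have h1 := sum_le_sum fun q hq =>
    hD.coordinate_progress (R := R) hs'0 hsL hz hu (mem_range.1 hq)
  rw [← mul_sum, sum_sub_distrib, sum_add_distrib, ← mul_sum, sum_sub_distrib] at h1
  simp only [sum_const, card_range, nsmul_eq_mul] at h1
  unfold potential
  rw [sum_add_distrib, ← mul_sum, sum_sub_distrib]
  simp only [sum_const, card_range, nsmul_eq_mul]
  set x := point z R s' with hx
  set y := point z R s with hy
  have hcu := hD.convex x u
  have hcy := hD.convex x y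
  -- `x` is a convex combination of `y` and `z`, with weights `1 - τ` and `τ`
  have hdir : D.τ * ∑ q ∈ range D.Q, D.grad x q * (z q - x q) =
      -((1 - D.τ) * ∑ q ∈ range D.Q, D.grad x q * (y q - x q)) := by
    rw [mul_sum, mul_sum, ← sum_neg_distrib]
    refine sum_congr rfl fun q _ => ?_
    simp only [hx, hy, point, hs']
    ring
  have hsplit : ∑ q ∈ range D.Q, D.grad x q * (z q - u q) =
      ∑ q ∈ range D.Q, D.grad x q * (z q - x q) - ∑ q ∈ range D.Q, D.grad x q * (u q - x q) := by
    rw [← sum_sub_distrib]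
    exact sum_congr rfl fun q _ => by ring
  rw [hsplit] at h1
  have ha : 1 / (D.L * s') = D.Q * (2 / s') * D.τ := by
    unfold τ
    field_simp
  have hs2 : 2 / s = (1 - D.τ) * (2 / s') := by rw [hs']; field_simp
  rw [ha] at h1
  rw [hs2]
  have hk : 0 < D.Q * (2 / s') := by positivity
  set k := D.Q * (2 / s') with hkdef
  set G1 := ∑ q ∈ range D.Q, D.grad x q * (z q - x q)
  set G2 := ∑ q ∈ range D.Q, D.grad x q * (u q - x q)
  set G3 := ∑ q ∈ range D.Q, D.grad x q * (y q - x q)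
  have h3 : k * (D.τ * G1) ≥ k * ((1 - D.τ) * (D.obj x - D.obj y)) := by
    rw [hdir]
    apply mul_le_mul_of_nonneg_left _ hk.le
    nlinarith
  have h4 : k * (D.τ * (D.obj x - D.obj u)) ≤ k * (D.τ * (-G2)) := by
    apply mul_le_mul_of_nonneg_left _ hk.le
    apply mul_le_mul_of_nonneg_left _ hτ0.le
    linarith
  have e5 : 2 / s' * (D.Q * D.obj x) = k * D.obj x := by rw [hkdef]; ring
  have e6 : 2 / s' * (D.Q * D.obj u) = k * D.obj u := by rw [hkdef]; ring
  rw [mul_sub (2 / s'), e6]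
  rw [mul_sub (2 / s'), e5] at h1
  have e7 : (D.Q : ℝ) * ((1 - D.τ) * (2 / s') * (D.obj y - D.obj u) + D.dist2 u z) =
      (1 - D.τ) * k * (D.obj y - D.obj u) + D.Q * D.dist2 u z := by rw [hkdef]; ring
  rw [e7]
  linarith

/-- In the box, the distance that is scaled by the box is controlled by the linear part of the objective. -/
theorem Valid.dist2_le (hD : D.Valid) {u z : ℕ → ℝ} (hz : D.InBox z) (hu : D.InBox u) :
    D.dist2 u z ≤ (D.obj z + D.obj u) / 2 := by
  have h1 := sum_le_obj hD z
  have h2 := sum_le_obj hD u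
  have h3 : D.dist2 u z ≤ (∑ q ∈ range D.Q, z q + ∑ q ∈ range D.Q, u q) / 2 := by
    unfold dist2
    rw [← sum_add_distrib, sum_div]
    refine sum_le_sum fun q hq => ?_
    have hq := mem_range.1 hq
    obtain ⟨a0, a1⟩ := hz q hq
    obtain ⟨b0, b1⟩ := hu q hq
    have hb := hD.box_pos hq
    rw [div_le_div_iff₀ (by positivity) (by norm_num)]
    nlinarith
  linarith

/-- At the beginning of a run, the potential is controlled by the objective. -/
theorem Valid.potential_start (hD : D.Valid) {u z : ℕ → ℝ} (hz : D.InBox z) (hu : D.InBox u)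
    {σ : ℝ} (hσ : 0 ≤ σ) (hobj : 0 ≤ D.obj u) :
    D.obj u + σ / 2 * D.potential u z (fun _ => 0) 1 ≤ D.obj u + 5 / 4 * σ * D.obj z := by
  have h := hD.dist2_le hz hu
  have h1 : point z (fun _ => 0) 1 = z := by funext q; simp [point]
  unfold potential
  rw [h1]
  nlinarith

/-- At the end of a run, the potential controls the objective. -/
theorem Valid.obj_le_potential (hD : D.Valid) {u z R : ℕ → ℝ} {s : ℝ} (hs : 0 < s) :
    D.obj (point z R s) ≤ D.obj u + s / 2 * D.potential u z R s := by
  have h : 0 ≤ D.dist2 u z := by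
    unfold dist2
    refine sum_nonneg fun q hq => ?_
    have := hD.box_pos (mem_range.1 hq)
    positivity
  unfold potential
  have e : s / 2 * (2 / s * (D.obj (point z R s) - D.obj u) + D.dist2 u z) =
      D.obj (point z R s) - D.obj u + s / 2 * D.dist2 u z := by field_simp
  rw [e]
  have : 0 ≤ s / 2 * D.dist2 u z := by positivity
  linarith

end Smoothed
end Covering

/-! ### The capped covering problem -/

namespace Covering

open Finset

theorem sum_range_mul_divMod {M : Type*} [AddCommMonoid M] (a b : ℕ) (F : ℕ → ℕ → M) :
    ∑ q ∈ range (a * b), F (q / b) (q % b) = ∑ l ∈ range a, ∑ i ∈ range b, F l i := by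
  induction a with
  | zero => simp
  | succ a ih =>
    rw [add_mul, one_mul, sum_range_add, ih, sum_range_succ]
    congr 1
    refine sum_congr rfl fun i hi => ?_
    have hi := mem_range.1 hi
    have hb : 0 < b := by omega
    rw [mul_comm, Nat.mul_add_div hb, Nat.mul_add_mod, Nat.div_eq_of_lt hi, Nat.mod_eq_of_lt hi,
      add_zero]

/-- Powers of two are convenient lower bounds for the exponentials in the penalties. -/
theorem two_pow_le_exp (c n : ℕ) : (2 : ℝ) ^ (c * n) ≤ Real.exp (c * n) := by
  have h1 : (2 : ℝ) ≤ Real.exp 1 := by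
    have := Real.add_one_le_exp (1 : ℝ); linarith
  have h2 : Real.exp (c * n) = Real.exp 1 ^ (c * n) := by
    rw [← Real.exp_nat_mul]; push_cast; ring_nf
  rw [h2]
  exact pow_le_pow_left₀ (by norm_num) h1 _

/-- A covering problem in sparse form, together with the data that the algorithm derives from it: the
list `cols` of the `nc` nonempty columns, the number `lam` of capping levels, and an upper bound `v`
for the optimal value. -/
structure Inst where
  m : ℕ
  n : ℕ
  N : ℕ
  nc : ℕ
  lam : ℕ
  row : ℕ → ℕ
  col : ℕ → ℕ
  cols : ℕ → ℕ
  val : ℕ → ℝ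
  ε : ℝ
  v : ℝ

namespace Inst

variable (I : Inst)

/-- The number of variables of the capped problem: one for each level and nonempty column. -/
def Q : ℕ := I.lam * I.nc

/-- The column to which a variable of the capped problem belongs. -/
def own (q : ℕ) : ℕ := I.cols (q % I.nc)

/-- The bound at which the entries of variable `q` are capped; it doubles from level to level. -/
noncomputable def cap (q : ℕ) : ℝ := 2 ^ (q / I.nc) / I.v

/-- The capped value of entry `k`. -/
noncomputable def coef (k q : ℕ) : ℝ := min (I.val k) (I.cap q)

/-- The matrix of the capped problem. -/
noncomputable def B (j q : ℕ) : ℝ :=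
  ∑ k ∈ range I.N, if I.row k = j ∧ I.col k = I.own q then I.coef k q else 0

/-- The capped problem with the smoothing used by the algorithm. -/
noncomputable def smoothed : Smoothed where
  Q := I.Q
  m := I.m
  B := I.B
  cap := I.cap
  μ := I.ε / (32 * I.lam)
  v := I.v

/-- The left-hand side of row `j` of the original problem. -/
noncomputable def cover (X : ℕ → ℝ) (j : ℕ) : ℝ :=
  ∑ k ∈ range I.N, if I.row k = j then I.val k * X (I.col k) else 0

/-- Feasibility for the original problem. -/
def Feas (X : ℕ → ℝ) : Prop := (∀ i < I.n, 0 ≤ X i) ∧ ∀ j < I.m, 1 ≤ I.cover X j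

/-- `o` is the optimal value of the original problem. -/
def IsOpt (o : ℝ) : Prop :=
  (∀ X, I.Feas X → o ≤ ∑ i ∈ range I.n, X i) ∧
    ∀ δ > 0, ∃ X, I.Feas X ∧ ∑ i ∈ range I.n, X i ≤ o + δ

/-- The properties of the input and of the derived data. -/
structure OK : Prop where
  m_pos : 0 < I.m
  row_lt : ∀ k < I.N, I.row k < I.m
  col_lt : ∀ k < I.N, I.col k < I.n
  val_pos : ∀ k < I.N, 0 < I.val k
  inj : ∀ k < I.N, ∀ k' < I.N, I.row k = I.row k' → I.col k = I.col k' → k = k'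
  surj : ∀ j < I.m, ∃ k < I.N, I.row k = j
  cols_mem : ∀ i < I.nc, ∃ k < I.N, I.col k = I.cols i
  cols_surj : ∀ k < I.N, ∃ i < I.nc, I.cols i = I.col k
  cols_inj : ∀ i < I.nc, ∀ i' < I.nc, I.cols i = I.cols i' → i = i'
  ε_pos : 0 < I.ε
  ε_le : I.ε ≤ 1
  v_max : ∀ j < I.m, ∃ k < I.N, I.row k = j ∧ I.m ≤ I.v * I.val k
  v_row : ∃ j < I.m, ∀ k < I.N, I.row k = j → I.v * I.val k ≤ I.m
  lam_pos : 0 < I.lam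
  lam_large : 2 * (I.N : ℝ) ^ 2 < 2 ^ I.lam * I.ε
  lam_small : 2 ^ (I.lam - 1) * I.ε ≤ 2 * (I.N : ℝ) ^ 2

variable {I}

namespace OK

variable (h : I.OK)
include h

theorem N_pos : 0 < I.N := by
  obtain ⟨k, hk, -⟩ := h.surj 0 h.m_pos
  omega

theorem nc_pos : 0 < I.nc := by
  obtain ⟨i, hi, -⟩ := h.cols_surj 0 h.N_pos
  omega

theorem m_le : I.m ≤ I.N := by
  choose! f hf hf' using h.surj
  have := card_le_card_of_injOn (s := range I.m) (t := range I.N) f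
    (fun j hj => by simpa using hf j (by simpa using hj)) (fun a ha b hb hab => by
      rw [← hf' a (by simpa using ha), ← hf' b (by simpa using hb), hab])
  simpa using this

theorem nc_le : I.nc ≤ I.N := by
  choose! f hf hf' using h.cols_mem
  have := card_le_card_of_injOn (s := range I.nc) (t := range I.N) f
    (fun j hj => by simpa using hf j (by simpa using hj)) (fun a ha b hb hab => by
      have ha := mem_range.1 (mem_coe.1 ha)
      have hb := mem_range.1 (mem_coe.1 hb)
      refine h.cols_inj a ha b hb ?_
      rw [← hf' a ha, ← hf' b hb, hab])
  simpa using this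

theorem v_pos : 0 < I.v := by
  obtain ⟨k, hk, -, h1⟩ := h.v_max 0 h.m_pos
  have h2 := h.val_pos k hk
  have h3 : (0 : ℝ) < I.m := by exact_mod_cast h.m_pos
  by_contra h4
  nlinarith

theorem own_lt {q : ℕ} : I.own q < I.n := by
  obtain ⟨k, hk, h1⟩ := h.cols_mem (q % I.nc) (Nat.mod_lt _ h.nc_pos)
  rw [own, ← h1]
  exact h.col_lt k hk

theorem cap_pos (q : ℕ) : 0 < I.cap q := div_pos (by positivity) h.v_pos

theorem Q_pos : 0 < I.Q := Nat.mul_pos h.lam_pos h.nc_pos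

/-- As every position occurs at most once in the input, an entry of the capped matrix is one capped
value. -/
theorem B_eq_or {j q : ℕ} : I.B j q = 0 ∨
    ∃ k < I.N, I.row k = j ∧ I.col k = I.own q ∧ I.B j q = I.coef k q := by
  by_cases hk : ∃ k < I.N, I.row k = j ∧ I.col k = I.own q
  · obtain ⟨k, hk, h1, h2⟩ := hk
    right
    refine ⟨k, hk, h1, h2, ?_⟩
    unfold B
    rw [sum_eq_single_of_mem k (mem_range.2 hk)]
    · simp [h1, h2]
    · intro k' hk' hne
      rw [if_neg]
      rintro ⟨h3, h4⟩
      exact hne (h.inj k' (mem_range.1 hk') k hk (by rw [h3, h1]) (by rw [h4, h2]))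
  · left
    refine sum_eq_zero fun k hk' => if_neg fun h1 => hk ⟨k, mem_range.1 hk', h1⟩

theorem coef_pos {k : ℕ} (hk : k < I.N) (q : ℕ) : 0 < I.coef k q :=
  lt_min (h.val_pos k hk) (h.cap_pos q)

theorem valid : I.smoothed.Valid where
  Q_pos := h.Q_pos
  cap_pos q _ := h.cap_pos q
  B_nonneg j _ q _ := by
    refine sum_nonneg (s := range I.N) fun k hk => ?_
    split_ifs
    · exact (h.coef_pos (mem_range.1 hk) q).le
    · exact le_rfl
  B_le j _ q _ := by
    change I.B j q ≤ I.cap q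
    rcases h.B_eq_or (j := j) (q := q) with h1 | ⟨k, -, -, -, h1⟩
    · rw [h1]; exact (h.cap_pos q).le
    · rw [h1]; exact min_le_right _ _
  μ_pos := by
    have : (0 : ℝ) < I.lam := by exact_mod_cast h.lam_pos
    have := h.ε_pos
    simp only [smoothed]
    positivity
  μ_le := by
    have h1 : (1 : ℝ) ≤ I.lam := by exact_mod_cast h.lam_pos
    have := h.ε_le
    simp only [smoothed]
    rw [div_le_one (by positivity)]
    linarith
  v_pos := h.v_pos

omit h in
theorem load_eq (x : ℕ → ℝ) (j : ℕ) : I.smoothed.load x j =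
    ∑ k ∈ range I.N, if I.row k = j then
      ∑ q ∈ range I.Q, if I.col k = I.own q then I.coef k q * x q else 0 else 0 := by
  change ∑ q ∈ range I.Q, I.B j q * x q = _
  unfold B
  simp only [sum_mul]
  rw [sum_comm]
  refine sum_congr rfl fun k _ => ?_
  by_cases h1 : I.row k = j
  · simp [h1, ite_mul]
  · simp [h1]

theorem sum_row_le {X : ℕ → ℝ} (hX : ∀ i < I.n, 0 ≤ X i) (j : ℕ) :
    ∑ k ∈ range I.N, (if I.row k = j then X (I.col k) else 0) ≤ ∑ i ∈ range I.n, X i := by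
  rw [← sum_filter]
  have hinj : Set.InjOn I.col ((range I.N).filter fun k => I.row k = j) := by
    intro a ha b hb hab
    simp only [coe_filter, mem_range, Set.mem_ofPred_eq] at ha hb
    exact h.inj a ha.1 b hb.1 (ha.2.trans hb.2.symm) hab
  rw [← sum_image (f := X) hinj]
  refine sum_le_sum_of_subset_of_nonneg ?_ fun i hi _ => hX i (mem_range.1 hi)
  intro i hi
  obtain ⟨k, hk, rfl⟩ := mem_image.1 hi
  exact mem_range.2 (h.col_lt k (mem_range.1 (mem_filter.1 hk).1))

/-- A row in which all entries are at most `m / v` forces every solution to cost at least `v / m`. -/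
theorem v_le_of_feas {X : ℕ → ℝ} (hX : I.Feas X) : I.v ≤ I.m * ∑ i ∈ range I.n, X i := by
  obtain ⟨j, hj, hrow⟩ := h.v_row
  have h1 := mul_le_mul_of_nonneg_left (hX.2 j hj) h.v_pos.le
  have h2 : I.v * I.cover X j ≤
      I.m * ∑ k ∈ range I.N, if I.row k = j then X (I.col k) else 0 := by
    unfold cover
    rw [mul_sum, mul_sum]
    refine sum_le_sum fun k hk => ?_
    have hk := mem_range.1 hk
    split_ifs with hr
    · rw [← mul_assoc]
      exact mul_le_mul_of_nonneg_right (hrow k hk hr) (hX.1 _ (h.col_lt k hk))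
    · simp
  have h3 := mul_le_mul_of_nonneg_left (h.sum_row_le hX.1 j) (Nat.cast_nonneg (α := ℝ) I.m)
  linarith

theorem v_le {o : ℝ} (ho : I.IsOpt o) : I.v ≤ I.m * o := by
  have hm : (0 : ℝ) < I.m := by exact_mod_cast h.m_pos
  refine le_of_forall_pos_le_add fun δ hδ => ?_
  obtain ⟨X, hX, hs⟩ := ho.2 (δ / I.m) (by positivity)
  have h1 := h.v_le_of_feas hX
  have h2 := mul_le_mul_of_nonneg_left hs hm.le
  have h3 : I.m * (o + δ / I.m) = I.m * o + δ := by field_simp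
  linarith

theorem opt_pos {o : ℝ} (ho : I.IsOpt o) : 0 < o := by
  have h1 := h.v_le ho
  have h2 := h.v_pos
  have hm : (0 : ℝ) < I.m := by exact_mod_cast h.m_pos
  by_contra h3
  nlinarith

/-- Covering every row separately with its largest entry costs at most `v`. -/
theorem opt_le {o : ℝ} (ho : I.IsOpt o) : o ≤ I.v := by
  have hm : (0 : ℝ) < I.m := by exact_mod_cast h.m_pos
  have hv := h.v_pos
  choose! f hf hf' hf'' using h.v_max
  set X : ℕ → ℝ := fun i => ∑ j ∈ range I.m, if I.col (f j) = i then I.v / I.m else 0 with hX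
  have hX0 : ∀ i, 0 ≤ X i := fun i => sum_nonneg fun j _ => by split_ifs <;> positivity
  have hfeas : I.Feas X := by
    refine ⟨fun i _ => hX0 i, fun j hj => ?_⟩
    have h1 : I.v / I.m ≤ X (I.col (f j)) := by
      refine le_trans ?_ (single_le_sum (f := fun j' => if I.col (f j') = I.col (f j) then
        I.v / I.m else 0) (fun j' _ => ?_) (mem_range.2 hj))
      · simp
      · split_ifs <;> positivity
    have h2 : I.val (f j) * X (I.col (f j)) ≤ I.cover X j := by
      refine le_trans ?_ (single_le_sum (f := fun k => if I.row k = j then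
        I.val k * X (I.col k) else 0) (fun k hk => ?_) (mem_range.2 (hf j hj)))
      · simp [hf' j hj]
      · split_ifs
        · exact mul_nonneg (h.val_pos k (mem_range.1 hk)).le (hX0 _)
        · exact le_rfl
    have h3 : 1 ≤ I.val (f j) * (I.v / I.m) := by
      rw [← mul_div_assoc, le_div_iff₀ hm]
      linarith [hf'' j hj]
    have h4 := mul_le_mul_of_nonneg_left h1 (h.val_pos _ (hf j hj)).le
    linarith
  refine (ho.1 X hfeas).trans (le_of_eq ?_)
  rw [hX, sum_comm]
  have h5 : ∀ j ∈ range I.m, ∑ i ∈ range I.n, (if I.col (f j) = i then I.v / I.m else 0) =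
      I.v / I.m := by
    intro j hj
    rw [sum_ite_eq]
    simp [h.col_lt _ (hf j (mem_range.1 hj))]
  rw [sum_congr rfl h5]
  simp
  field_simp

end OK

/-- The vector of the original problem that belongs to a vector `y` of the capped problem with
smallest row value `w`. -/
noncomputable def out (I : Inst) (y : ℕ → ℝ) (w : ℝ) (i : ℕ) : ℝ :=
  ∑ q ∈ range I.Q, if I.own q = i then y q / w else 0

namespace OK

variable (h : I.OK)
include h

theorem sum_out (y : ℕ → ℝ) (w : ℝ) :
    ∑ i ∈ range I.n, I.out y w i = (∑ q ∈ range I.Q, y q) / w := by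
  unfold out
  rw [sum_comm, sum_div]
  refine sum_congr rfl fun q _ => ?_
  rw [sum_ite_eq]
  simp [h.own_lt]

omit h in
/-- Capping only shrinks the matrix. -/
theorem out_feas {y : ℕ → ℝ} {w : ℝ} (hy : ∀ q < I.Q, 0 ≤ y q) (hw : 0 < w)
    (hmin : ∀ j < I.m, w ≤ I.smoothed.load y j) : I.Feas (I.out y w) := by
  refine ⟨fun i _ => sum_nonneg fun q hq => ?_, fun j hj => ?_⟩
  · have := hy q (mem_range.1 hq)
    split_ifs <;> positivity
  · have h1 : I.smoothed.load y j / w ≤ I.cover (I.out y w) j := by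
      rw [load_eq, sum_div]
      unfold cover out
      refine sum_le_sum fun k hk => ?_
      split_ifs with hr
      · rw [sum_div, mul_sum]
        refine sum_le_sum fun q hq => ?_
        have hyq := hy q (mem_range.1 hq)
        by_cases hc : I.col k = I.own q
        · rw [if_pos hc, if_pos hc.symm, ← mul_div_assoc]
          have : I.coef k q ≤ I.val k := min_le_left _ _
          gcongr
        · rw [if_neg hc, if_neg (fun h' => hc h'.symm)]
          simp
      · simp
    refine le_trans ?_ h1
    rw [le_div_iff₀ hw, one_mul]
    exact hmin j hj

/-- The smoothed objective is at least `w · OPT` plus the penalty of the worst row. -/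
theorem obj_ge {o : ℝ} (ho : I.IsOpt o) {y : ℕ → ℝ} {w : ℝ} (hy : ∀ q < I.Q, 0 ≤ y q)
    (hmin : ∀ j < I.m, w ≤ I.smoothed.load y j) (hex : ∃ j < I.m, w = I.smoothed.load y j) :
    w * o + I.smoothed.μ * I.v * Real.exp ((1 - w) / I.smoothed.μ) ≤ I.smoothed.obj y := by
  have hV := h.valid
  obtain ⟨j, hj, hw⟩ := hex
  have h1 : Real.exp ((1 - w) / I.smoothed.μ) ≤
      ∑ j ∈ range I.smoothed.m, I.smoothed.pen y j := by
    rw [hw]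
    exact single_le_sum (f := fun j => I.smoothed.pen y j) (fun j _ => (Real.exp_pos _).le)
      (mem_range.2 hj)
  have h2 : w * o ≤ ∑ q ∈ range I.Q, y q := by
    rcases le_or_gt w 0 with h3 | h3
    · have h4 : 0 ≤ ∑ q ∈ range I.Q, y q := sum_nonneg fun q hq => hy q (mem_range.1 hq)
      nlinarith [h.opt_pos ho]
    · have h4 := ho.1 _ (out_feas hy h3 hmin)
      rw [h.sum_out, le_div_iff₀ h3] at h4
      linarith
  have h5 := mul_le_mul_of_nonneg_left h1 (mul_pos hV.μ_pos hV.v_pos).le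
  exact add_le_add h2 h5

theorem exists_min (y : ℕ → ℝ) : ∃ w, (∀ j < I.m, w ≤ I.smoothed.load y j) ∧
    ∃ j < I.m, w = I.smoothed.load y j := by
  obtain ⟨j, hj, hmin⟩ := exists_min_image (range I.m) (I.smoothed.load y)
    ⟨0, mem_range.2 h.m_pos⟩
  exact ⟨_, fun j' hj' => hmin j' (mem_range.2 hj'), j, mem_range.1 hj, rfl⟩

/-- The smoothed objective is at least the optimal value: missing a row by a fraction costs at least
the same fraction of `v`. -/
theorem opt_le_obj {o : ℝ} (ho : I.IsOpt o) {y : ℕ → ℝ} (hy : ∀ q < I.Q, 0 ≤ y q) :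
    o ≤ I.smoothed.obj y := by
  obtain ⟨w, h1, h2⟩ := h.exists_min y
  have h3 := h.obj_ge ho hy h1 h2
  have hμ := h.valid.μ_pos
  have hv := h.v_pos
  have h4 := Real.add_one_le_exp ((1 - w) / I.smoothed.μ)
  have h5 := mul_le_mul_of_nonneg_left h4 (mul_pos hμ hv).le
  have h6 : I.smoothed.μ * I.v * ((1 - w) / I.smoothed.μ + 1) =
      I.v * (1 - w) + I.smoothed.μ * I.v := by field_simp
  have h7 := h.opt_le ho
  have h8 := h.opt_pos ho
  have h9 := mul_pos hμ hv
  rcases le_total w 1 with h10 | h10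
  · have : o * (1 - w) ≤ I.v * (1 - w) := mul_le_mul_of_nonneg_right h7 (by linarith)
    linarith
  · have h11 : 0 < I.smoothed.μ * I.v * Real.exp ((1 - w) / I.smoothed.μ) := by positivity
    nlinarith

theorem one_le_N_sq : (1 : ℝ) ≤ (I.N : ℝ) ^ 2 := by
  have : (1 : ℝ) ≤ I.N := by exact_mod_cast h.N_pos
  nlinarith

/-- A near-optimal value of the smoothed objective forces all rows to be nearly covered. -/
theorem min_ge {o : ℝ} (ho : I.IsOpt o) {y : ℕ → ℝ} {w : ℝ} (hy : ∀ q < I.Q, 0 ≤ y q)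
    (hmin : ∀ j < I.m, w ≤ I.smoothed.load y j) (hex : ∃ j < I.m, w = I.smoothed.load y j)
    (hobj : I.smoothed.obj y ≤ (1 + 110 * I.ε) * o) : 1 - I.ε / 2 ≤ w := by
  have h1 := h.obj_ge ho hy hmin hex
  have ho0 := h.opt_pos ho
  have hov := h.opt_le ho
  have hv := h.v_pos
  have hε := h.ε_pos
  have hε1 := h.ε_le
  have hw0 : 0 ≤ w := by
    obtain ⟨j, hj, hw⟩ := hex
    rw [hw]
    exact sum_nonneg fun q hq => mul_nonneg (h.valid.B_nonneg j hj q (mem_range.1 hq))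
      (hy q (mem_range.1 hq))
  by_contra hlt
  push Not at hlt
  have hlam : (0 : ℝ) < I.lam := by exact_mod_cast h.lam_pos
  have hμ : I.smoothed.μ = I.ε / (32 * I.lam) := rfl
  -- the exponent is at least `16 lam`
  have h2 : (16 : ℕ) * (I.lam : ℝ) ≤ (1 - w) / I.smoothed.μ := by
    rw [hμ, le_div_iff₀ (by positivity)]
    have : ((16 : ℕ) : ℝ) * (I.lam : ℝ) * (I.ε / (32 * I.lam)) = I.ε / 2 := by
      field_simp; norm_num
    rw [this]
    linarith
  have h3 := (two_pow_le_exp 16 I.lam).trans (Real.exp_le_exp.2 h2)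
  have hμ0 := h.valid.μ_pos
  have h4 : I.smoothed.μ * I.v * 2 ^ (16 * I.lam) ≤ 111 * I.v := by
    have h5 := mul_le_mul_of_nonneg_left h3 (mul_pos hμ0 hv).le
    have h6 : (1 + 110 * I.ε - w) * o ≤ 111 * I.v := by
      apply mul_le_mul (by linarith) hov ho0.le (by norm_num)
    linarith
  have h5 : I.smoothed.μ * 2 ^ (16 * I.lam) ≤ 111 := by
    have : I.v * (I.smoothed.μ * 2 ^ (16 * I.lam)) ≤ I.v * 111 := by linarith
    exact le_of_mul_le_mul_left this hv
  rw [hμ, div_mul_eq_mul_div, div_le_iff₀ (by positivity)] at h5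
  have h6 : (I.lam : ℝ) < 2 ^ I.lam := by exact_mod_cast Nat.lt_two_pow_self
  have h7 : (1 : ℝ) < 2 ^ I.lam * I.ε := by linarith [h.lam_large, h.one_le_N_sq]
  have h8 : (2 : ℝ) ^ (16 * I.lam) = 2 ^ I.lam * 2 ^ I.lam * (2 ^ I.lam) ^ 14 := by
    rw [mul_comm 16, pow_mul]; ring
  have h9 : (2 : ℝ) ^ 14 ≤ (2 ^ I.lam) ^ 14 := by
    apply pow_le_pow_left₀ (by norm_num)
    have := Nat.one_lt_two_pow h.lam_pos.ne'
    exact_mod_cast this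
  rw [h8] at h5
  have h10 : (2 : ℝ) ^ I.lam * 2 ^ 14 ≤ I.ε * (2 ^ I.lam * 2 ^ I.lam * (2 ^ I.lam) ^ 14) := by
    have e : I.ε * (2 ^ I.lam * 2 ^ I.lam * (2 ^ I.lam) ^ 14) =
      (2 ^ I.lam * I.ε) * (2 ^ I.lam * (2 ^ I.lam) ^ 14) := by ring
    rw [e]
    refine le_trans ?_ (le_mul_of_one_le_left (by positivity) h7.le)
    gcongr
  norm_num at h10
  nlinarith

/-- The starting point has polynomially bounded objective. -/
theorem obj_box_le : I.smoothed.obj I.smoothed.box ≤ 9 * I.N * I.v := by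
  have hv := h.v_pos
  have hμ0 := h.valid.μ_pos
  have hμ1 := h.valid.μ_le
  have hm : (I.m : ℝ) ≤ I.N := by exact_mod_cast h.m_le
  have hnc : (I.nc : ℝ) ≤ I.N := by exact_mod_cast h.nc_le
  have h1 : ∑ q ∈ range I.Q, I.smoothed.box q ≤ 8 * I.N * I.v := by
    have e : ∀ q ∈ range I.Q, I.smoothed.box q =
        (fun l _ => 4 * I.v * (1 / 2) ^ l) (q / I.nc) (q % I.nc) := by
      intro q _
      change 4 / I.cap q = _
      unfold cap
      field_simp
      rw [div_pow, one_pow]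
      field_simp
    rw [sum_congr rfl e, Q, sum_range_mul_divMod I.lam I.nc fun l _ => 4 * I.v * (1 / 2) ^ l]
    simp only [sum_const, card_range, nsmul_eq_mul, ← mul_sum]
    have h2 := sum_geometric_two_le I.lam
    have h3 : 4 * I.v * ∑ i ∈ range I.lam, ((1 : ℝ) / 2) ^ i ≤ 8 * I.v := by nlinarith
    calc (I.nc : ℝ) * (4 * I.v * ∑ i ∈ range I.lam, ((1 : ℝ) / 2) ^ i)
        ≤ I.nc * (8 * I.v) := by gcongr
      _ ≤ I.N * (8 * I.v) := by gcongr
      _ = 8 * I.N * I.v := by ring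
  have h2 : ∀ j ∈ range I.m, I.smoothed.pen I.smoothed.box j ≤ 1 := by
    intro j hj
    obtain ⟨k, hk, hkj, hkv⟩ := h.v_max j (mem_range.1 hj)
    obtain ⟨i, hi, hic⟩ := h.cols_surj k hk
    have hiQ : i < I.Q := by
      have := Nat.le_mul_of_pos_left I.nc h.lam_pos
      unfold Q; omega
    have hown : I.own i = I.col k := by rw [own, Nat.mod_eq_of_lt hi, hic]
    have hcap : I.cap i = 1 / I.v := by rw [cap, Nat.div_eq_of_lt hi, pow_zero]
    have hm1 : (1 : ℝ) ≤ I.m := by exact_mod_cast h.m_pos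
    have hB : I.B j i = 1 / I.v := by
      have h0 : I.coef k i = 1 / I.v := by
        rw [coef, hcap, min_eq_right]
        rw [div_le_iff₀ hv]
        linarith
      rcases h.B_eq_or (j := j) (q := i) with h3 | ⟨k', hk', h4, h5, h6⟩
      · exfalso
        have h4 : I.coef k i ≤ I.B j i := by
          unfold B
          refine le_trans ?_ (single_le_sum (f := fun k => if I.row k = j ∧ I.col k = I.own i then
            I.coef k i else 0) (fun k' hk' => ?_) (mem_range.2 hk))
          · simp [hkj, hown]
          · split_ifs
            · exact (h.coef_pos (mem_range.1 hk') i).le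
            · exact le_rfl
        have := h.coef_pos hk i
        linarith
      · rw [h6, ← h0, h.inj k' hk' k hk (by rw [h4, hkj]) (by rw [h5, hown])]
    have hload : 1 ≤ I.smoothed.load I.smoothed.box j := by
      refine le_trans ?_ (single_le_sum (f := fun q => I.smoothed.B j q * I.smoothed.box q)
        (fun q hq => mul_nonneg (h.valid.B_nonneg j (mem_range.1 hj) q (mem_range.1 hq))
          (h.valid.box_pos (mem_range.1 hq)).le) (mem_range.2 hiQ))
      change 1 ≤ I.B j i * (4 / I.cap i)
      rw [hB, hcap]
      field_simp
      norm_num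
    unfold Smoothed.pen
    rw [Real.exp_le_one_iff]
    exact div_nonpos_of_nonpos_of_nonneg (by linarith) hμ0.le
  have h3 : ∑ j ∈ range I.m, I.smoothed.pen I.smoothed.box j ≤ I.m := by
    refine (sum_le_sum h2).trans ?_
    simp
  have h4 : I.smoothed.μ * I.v * ∑ j ∈ range I.m, I.smoothed.pen I.smoothed.box j ≤
      1 * I.v * I.N := by
    have h5 : 0 ≤ ∑ j ∈ range I.m, I.smoothed.pen I.smoothed.box j :=
      sum_nonneg fun _ _ => (Real.exp_pos _).le
    gcongr
    linarith
  change ∑ q ∈ range I.Q, I.smoothed.box q +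
    I.smoothed.μ * I.v * ∑ j ∈ range I.m, I.smoothed.pen I.smoothed.box j ≤ _
  linarith

end OK
end Inst
end Covering

namespace Covering
open Finset
namespace Inst
variable {I : Inst}

/-- A value between `v / 2 ^ (lam - 1)` and `2 v` is brought to `[v, 2 v]` by one of the levels. -/
theorem exists_level {lam : ℕ} {v t : ℝ} (hlam : 0 < lam)
    (ht : v ≤ 2 ^ (lam - 1) * t) (ht' : t ≤ 2 * v) :
    ∃ l < lam, v ≤ 2 ^ l * t ∧ 2 ^ l * t ≤ 2 * v := by
  classical
  have hex : ∃ l, v ≤ 2 ^ l * t := ⟨_, ht⟩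
  refine ⟨Nat.find hex, ?_, Nat.find_spec hex, ?_⟩
  · have := Nat.find_min' hex ht
    omega
  · rcases Nat.eq_zero_or_pos (Nat.find hex) with h0 | h0
    · rw [h0]; simpa using ht'
    · have h1 := Nat.find_min hex (Nat.sub_lt h0 one_pos)
      push Not at h1
      obtain ⟨l, hl⟩ := Nat.exists_eq_succ_of_ne_zero h0.ne'
      rw [hl] at h1 ⊢
      simp only [Nat.succ_eq_add_one, Nat.add_sub_cancel] at h1
      rw [Nat.succ_eq_add_one, pow_succ]
      linarith

namespace OK

variable (h : I.OK)
include h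

theorem sum_cols_le {X : ℕ → ℝ} (hX : ∀ i < I.n, 0 ≤ X i) :
    ∑ i ∈ range I.nc, X (I.cols i) ≤ ∑ i ∈ range I.n, X i := by
  have hinj : Set.InjOn I.cols (range I.nc) := fun a ha b hb hab =>
    h.cols_inj a (mem_range.1 (mem_coe.1 ha)) b (mem_range.1 (mem_coe.1 hb)) hab
  rw [← sum_image (f := X) hinj]
  refine sum_le_sum_of_subset_of_nonneg ?_ fun i hi _ => hX i (mem_range.1 hi)
  intro i hi
  obtain ⟨q, hq, rfl⟩ := mem_image.1 hi
  obtain ⟨k, hk, hkc⟩ := h.cols_mem q (mem_range.1 hq)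
  rw [← hkc]
  exact mem_range.2 (h.col_lt k hk)

/-- The vector of the capped problem that puts a multiple of the value `t i` of column `i` on level
`lev i`. -/
noncomputable def spread (I : Inst) (t : ℕ → ℝ) (lev : ℕ → ℕ) (q : ℕ) : ℝ :=
  if q / I.nc = lev (I.own q) then (1 + I.ε) * t (I.own q) else 0

theorem sum_spread {t : ℕ → ℝ} {lev : ℕ → ℕ} (hlev : ∀ i < I.n, lev i < I.lam) :
    ∑ q ∈ range I.Q, spread I t lev q = ∑ i ∈ range I.nc, (1 + I.ε) * t (I.cols i) := by
  have e := sum_range_mul_divMod I.lam I.nc fun l i =>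
    if l = lev (I.cols i) then (1 + I.ε) * t (I.cols i) else 0
  refine e.trans ?_
  rw [sum_comm]
  refine sum_congr rfl fun i hi => ?_
  have hi := mem_range.1 hi
  obtain ⟨k, hk, hkc⟩ := h.cols_mem i hi
  have := hlev (I.cols i) (hkc ▸ h.col_lt k hk)
  rw [sum_ite_eq']
  simp [this]

/-- If every value is brought to at least `v` by its level, then nothing is lost by capping. -/
theorem load_spread {t : ℕ → ℝ} {lev : ℕ → ℕ} (hlev : ∀ i < I.n, lev i < I.lam)
    (ht0 : ∀ i < I.n, 0 ≤ t i) (ht : ∀ i < I.n, I.v ≤ 2 ^ lev i * t i) {j : ℕ}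
    (hcov : 1 ≤ I.cover t j) : 1 + I.ε ≤ I.smoothed.load (spread I t lev) j := by
  have hε := h.ε_pos
  have hv := h.v_pos
  have hterm : ∀ k ∈ range I.N, (if I.row k = j then
      (1 + I.ε) * (min (I.val k) (2 ^ lev (I.col k) / I.v) * t (I.col k)) else 0) ≤
      if I.row k = j then ∑ q ∈ range I.Q,
        if I.col k = I.own q then I.coef k q * spread I t lev q else 0 else 0 := by
    intro k hk
    have hk := mem_range.1 hk
    split_ifs with hr
    · obtain ⟨i, hi, hic⟩ := h.cols_surj k hk
      have hl := hlev _ (h.col_lt k hk)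
      have hmod : (I.nc * lev (I.col k) + i) % I.nc = i := by
        rw [Nat.mul_add_mod, Nat.mod_eq_of_lt hi]
      have hdiv : (I.nc * lev (I.col k) + i) / I.nc = lev (I.col k) := by
        rw [Nat.mul_add_div h.nc_pos, Nat.div_eq_of_lt hi, add_zero]
      have hown : I.own (I.nc * lev (I.col k) + i) = I.col k := by rw [own, hmod, hic]
      have hq : I.nc * lev (I.col k) + i < I.Q := by
        unfold Q
        calc I.nc * lev (I.col k) + i < I.nc * lev (I.col k) + I.nc := by omega
          _ = (lev (I.col k) + 1) * I.nc := by ring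
          _ ≤ I.lam * I.nc := Nat.mul_le_mul_right _ hl
      refine le_trans (le_of_eq ?_) (single_le_sum (f := fun q => if I.col k = I.own q then
        I.coef k q * spread I t lev q else 0) (fun q hq' => ?_) (mem_range.2 hq))
      · rw [if_pos hown.symm]
        unfold spread coef cap
        rw [hown, hdiv, if_pos rfl]
        ring
      · split_ifs with hc
        · refine mul_nonneg (h.coef_pos hk q).le ?_
          unfold spread
          split_ifs
          · exact mul_nonneg (by linarith) (ht0 _ h.own_lt)
          · exact le_rfl
        · exact le_rfl
    · exact le_rfl
  rw [load_eq]
  refine le_trans ?_ (sum_le_sum hterm)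
  have hnn : ∀ k ∈ range I.N, 0 ≤ if I.row k = j then
      (1 + I.ε) * (min (I.val k) (2 ^ lev (I.col k) / I.v) * t (I.col k)) else 0 := by
    intro k hk
    have h1 := (h.val_pos k (mem_range.1 hk)).le
    have h2 := ht0 _ (h.col_lt k (mem_range.1 hk))
    have h3 : 0 ≤ min (I.val k) (2 ^ lev (I.col k) / I.v) := le_min h1 (by positivity)
    split_ifs <;> positivity
  by_cases hbig : ∃ k < I.N, I.row k = j ∧ 2 ^ lev (I.col k) / I.v ≤ I.val k
  · obtain ⟨k, hk, hr, hc⟩ := hbig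
    refine le_trans ?_ (single_le_sum hnn (mem_range.2 hk))
    rw [if_pos hr, min_eq_right hc]
    have h1 : 1 ≤ 2 ^ lev (I.col k) / I.v * t (I.col k) := by
      rw [div_mul_eq_mul_div, le_div_iff₀ hv, one_mul]
      exact ht _ (h.col_lt k hk)
    nlinarith
  · push Not at hbig
    have e : ∑ k ∈ range I.N, (if I.row k = j then
        (1 + I.ε) * (min (I.val k) (2 ^ lev (I.col k) / I.v) * t (I.col k)) else 0) =
        (1 + I.ε) * I.cover t j := by
      unfold cover
      rw [mul_sum]
      refine sum_congr rfl fun k hk => ?_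
      split_ifs with hr
      · rw [min_eq_left (hbig k (mem_range.1 hk) hr).le]
      · simp
    rw [e]
    nlinarith

/-- The capped problem has a near-optimal solution in the box. -/
theorem exists_comparison {o : ℝ} (ho : I.IsOpt o) :
    ∃ u, I.smoothed.InBox u ∧ I.smoothed.obj u ≤ (1 + 6 * I.ε) * o := by
  have hε := h.ε_pos
  have hε1 := h.ε_le
  have hv := h.v_pos
  have ho0 := h.opt_pos ho
  have hov := h.opt_le ho
  have hvo := h.v_le ho
  have hN : (1 : ℝ) ≤ I.N := by exact_mod_cast h.N_pos
  have hm : (I.m : ℝ) ≤ I.N := by exact_mod_cast h.m_le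
  have hnc : (I.nc : ℝ) ≤ I.N := by exact_mod_cast h.nc_le
  have hlarge := h.lam_large
  obtain ⟨X, hX, hS⟩ := ho.2 (I.ε * o) (by positivity)
  set r : ℝ := I.v / 2 ^ (I.lam - 1) with hr
  have hr0 : 0 < r := by positivity
  have hp : (2 : ℝ) ^ I.lam = 2 ^ (I.lam - 1) * 2 := by
    rw [← pow_succ, Nat.sub_add_cancel h.lam_pos]
  have hr1 : I.N * r ≤ I.ε * o := by
    rw [hr, ← mul_div_assoc, div_le_iff₀ (by positivity)]
    have h1 : I.N * I.v ≤ I.N * (I.N * o) := by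
      have : I.m * o ≤ I.N * o := by gcongr
      gcongr
      linarith
    have h2 : (I.N : ℝ) ^ 2 * o ≤ 2 ^ (I.lam - 1) * I.ε * o := by
      have : (I.N : ℝ) ^ 2 ≤ 2 ^ (I.lam - 1) * I.ε := by rw [hp] at hlarge; linarith
      gcongr
    linarith
  set t : ℕ → ℝ := fun i => max (X i) r with ht
  have ht0 : ∀ i, 0 < t i := fun i => lt_max_of_lt_right hr0
  have ht1 : ∀ i < I.n, t i ≤ 2 * I.v := by
    intro i hi
    refine max_le ?_ ?_
    · have h1 := single_le_sum (f := X) (fun i hi => hX.1 i (mem_range.1 hi)) (mem_range.2 hi)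
      have h2 : I.ε * o ≤ o := mul_le_of_le_one_left ho0.le hε1
      linarith
    · have h1 : r ≤ I.N * r := le_mul_of_one_le_left hr0.le hN
      have h2 : I.ε * o ≤ o := mul_le_of_le_one_left ho0.le hε1
      linarith
  have ht2 : ∀ i < I.n, I.v ≤ 2 ^ (I.lam - 1) * t i := by
    intro i _
    have h1 : r ≤ t i := le_max_right _ _
    have h2 : I.v = 2 ^ (I.lam - 1) * r := by rw [hr]; field_simp
    rw [h2]
    gcongr
  have hlev : ∀ i < I.n, ∃ l < I.lam, I.v ≤ 2 ^ l * t i ∧ 2 ^ l * t i ≤ 2 * I.v :=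
    fun i hi => exists_level h.lam_pos (ht2 i hi) (ht1 i hi)
  choose! lev hlev1 hlev2 hlev3 using hlev
  refine ⟨spread I t lev, fun q _ => ?_, ?_⟩
  · change 0 ≤ spread I t lev q ∧ spread I t lev q ≤ 4 / I.cap q
    have hc := h.cap_pos q
    unfold spread
    split_ifs with hq
    · have h1 := ht0 (I.own q)
      refine ⟨by positivity, ?_⟩
      rw [le_div_iff₀ hc, cap, hq, ← mul_div_assoc, div_le_iff₀ hv]
      have h2 := hlev3 _ (h.own_lt (q := q))
      have h3 : (1 + I.ε) * (2 ^ lev (I.own q) * t (I.own q)) ≤ 2 * (2 * I.v) := by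
        apply mul_le_mul (by linarith) h2 (by positivity) (by norm_num)
      linarith
    · exact ⟨le_rfl, by positivity⟩
  · have hsum : ∑ q ∈ range I.Q, spread I t lev q ≤ (1 + 5 * I.ε) * o := by
      rw [h.sum_spread hlev1, ← mul_sum]
      have h1 : ∑ i ∈ range I.nc, t (I.cols i) ≤ ∑ i ∈ range I.nc, (X (I.cols i) + r) := by
        refine sum_le_sum fun i hi => ?_
        obtain ⟨k, hk, hkc⟩ := h.cols_mem i (mem_range.1 hi)
        have := hX.1 (I.cols i) (hkc ▸ h.col_lt k hk)
        exact max_le (by linarith) (by linarith)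
      rw [sum_add_distrib] at h1
      simp only [sum_const, card_range, nsmul_eq_mul] at h1
      have h2 := h.sum_cols_le hX.1
      have h3 : I.nc * r ≤ I.N * r := by gcongr
      have h4 : (1 + I.ε) * ∑ i ∈ range I.nc, t (I.cols i) ≤ (1 + I.ε) * (o + 2 * (I.ε * o)) := by
        gcongr
        linarith
      have h5 : I.ε * I.ε * o ≤ 1 * I.ε * o := by gcongr
      linarith
    have hpen : ∀ j ∈ range I.m, I.smoothed.pen (spread I t lev) j ≤ Real.exp (-(32 * I.lam)) := by
      intro j hj
      have hcov : 1 ≤ I.cover t j := by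
        refine (hX.2 j (mem_range.1 hj)).trans (sum_le_sum fun k hk => ?_)
        split_ifs
        · exact mul_le_mul_of_nonneg_left (le_max_left _ _) (h.val_pos k (mem_range.1 hk)).le
        · exact le_rfl
      have h1 := h.load_spread hlev1 (fun i _ => (ht0 i).le) hlev2 hcov
      apply Real.exp_le_exp.2
      have hlam : (0 : ℝ) < I.lam := by exact_mod_cast h.lam_pos
      have hμ : I.smoothed.μ = I.ε / (32 * I.lam) := rfl
      rw [hμ, div_le_iff₀ (by positivity)]
      have : -(32 * (I.lam : ℝ)) * (I.ε / (32 * I.lam)) = -I.ε := by field_simp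
      linarith
    have hpens := sum_le_sum hpen
    simp only [sum_const, card_range, nsmul_eq_mul] at hpens
    have hexp : Real.exp (-(32 * I.lam)) * (2 * (I.N : ℝ) ^ 2) ≤ I.ε := by
      have h1 := two_pow_le_exp 32 I.lam
      have h2 : (2 : ℝ) ^ I.lam ≤ 2 ^ (32 * I.lam) :=
        pow_le_pow_right₀ (by norm_num) (by omega)
      rw [Real.exp_neg, inv_mul_le_iff₀ (Real.exp_pos _)]
      push_cast at h1
      have h3 : 2 ^ I.lam * I.ε ≤ Real.exp (32 * I.lam) * I.ε := by
        gcongr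
        linarith
      linarith
    have hμ0 := h.valid.μ_pos
    have hμ1 := h.valid.μ_le
    have h1 : I.smoothed.μ * I.v * ∑ j ∈ range I.m, I.smoothed.pen (spread I t lev) j ≤
        1 * (I.N * o) * (I.N * Real.exp (-(32 * I.lam))) := by
      have h2 : I.v ≤ I.N * o := hvo.trans (by gcongr)
      have h3 : ∑ j ∈ range I.m, I.smoothed.pen (spread I t lev) j ≤
          I.N * Real.exp (-(32 * I.lam)) := hpens.trans (by gcongr)
      have h4 : 0 ≤ ∑ j ∈ range I.m, I.smoothed.pen (spread I t lev) j :=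
        sum_nonneg fun _ _ => (Real.exp_pos _).le
      gcongr
    have h2 : 1 * (I.N * o) * (I.N * Real.exp (-(32 * I.lam))) ≤ I.ε * o := by
      have := mul_le_mul_of_nonneg_right hexp ho0.le
      have h3 : 0 ≤ o * (I.N : ℝ) ^ 2 * Real.exp (-(32 * I.lam)) := by positivity
      linarith
    change ∑ q ∈ range I.Q, spread I t lev q + I.smoothed.μ * I.v * _ ≤ _
    change I.smoothed.μ * I.v * ∑ j ∈ range I.m, I.smoothed.pen (spread I t lev) j ≤ _ at h1
    have h3 : ∑ q ∈ range I.Q, spread I t lev q + I.smoothed.μ * I.v *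
        ∑ j ∈ range I.m, I.smoothed.pen (spread I t lev) j ≤ (1 + 6 * I.ε) * o := by linarith
    exact h3

/-- Rounding a near-optimal point of the smoothed problem to a feasible solution. -/
theorem out_approx {o : ℝ} (ho : I.IsOpt o) {y : ℕ → ℝ} {w : ℝ} (hy : ∀ q < I.Q, 0 ≤ y q)
    (hmin : ∀ j < I.m, w ≤ I.smoothed.load y j) (hex : ∃ j < I.m, w = I.smoothed.load y j)
    (hobj : I.smoothed.obj y ≤ (1 + 110 * I.ε) * o) :
    I.Feas (I.out y w) ∧ ∑ i ∈ range I.n, I.out y w i ≤ (1 + 221 * I.ε) * o := by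
  have hw := h.min_ge ho hy hmin hex hobj
  have hε := h.ε_pos
  have hε1 := h.ε_le
  have ho0 := h.opt_pos ho
  have hw0 : 0 < w := by linarith
  refine ⟨out_feas hy hw0 hmin, ?_⟩
  rw [h.sum_out, div_le_iff₀ hw0]
  have h1 := Smoothed.sum_le_obj h.valid y
  have h2 : (1 + 221 * I.ε) * o * (1 - I.ε / 2) ≤ (1 + 221 * I.ε) * o * w := by gcongr
  have h3 : I.ε * I.ε * o ≤ 1 * I.ε * o := by gcongr
  change ∑ q ∈ range I.Q, y q ≤ _ at h1
  have h4 : 0 < I.ε * o := by positivity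
  linarith

end OK
end Inst
end Covering

/-! ### The program -/

namespace RealRAM

/-- Sequential composition of a list of commands. -/
def Cmd.block : List Cmd → Cmd
  | [] => .skip
  | c :: l => .seq c (Cmd.block l)

/-- Assignment of one of two values, depending on a test. -/
def Cmd.condReal (b : BExpr) (a : ℕ) (i : NExpr) (e f : RExpr) : Cmd :=
  .ite b (.setReal a i e) (.setReal a i f)

/-- Assignment of one of two integer values, depending on a test. -/
def Cmd.condNat (b : BExpr) (a : ℕ) (i e f : NExpr) : Cmd :=
  .ite b (.setNat a i e) (.setNat a i f)

/-- An integer variable: entry `0` of an integer array. -/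
def nvar (a : ℕ) : NExpr := .get a (.const 0)

/-- A real variable: entry `0` of a real array. -/
def rvar (a : ℕ) : RExpr := .get a (.const 0)

/-- Increment of an integer variable. -/
def incr (a : ℕ) : Cmd := .setNat a (.const 0) (.add (nvar a) (.const 1))

section exec

variable (s : State)

@[simp] theorem nat_writeNat_self (a i v : ℕ) :
    (s.writeNat a i v).nat a = Function.update (s.nat a) i v := by
  simp [State.writeNat]

@[simp] theorem nat_writeNat_ne {a b : ℕ} (i v : ℕ) (h : b ≠ a) :
    (s.writeNat a i v).nat b = s.nat b := by
  simp [State.writeNat, h]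

@[simp] theorem real_writeNat (a i v : ℕ) : (s.writeNat a i v).real = s.real := rfl

@[simp] theorem real_writeReal_self (a i : ℕ) (v : ℝ) :
    (s.writeReal a i v).real a = Function.update (s.real a) i v := by
  simp [State.writeReal]

@[simp] theorem real_writeReal_ne {a b : ℕ} (i : ℕ) (v : ℝ) (h : b ≠ a) :
    (s.writeReal a i v).real b = s.real b := by
  simp [State.writeReal, h]

@[simp] theorem nat_writeReal (a i : ℕ) (v : ℝ) : (s.writeReal a i v).nat = s.nat := rfl

@[simp] theorem eval_nvar (a : ℕ) : (nvar a).eval s = s.nat a 0 := rfl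

@[simp] theorem eval_rvar (a : ℕ) : (rvar a).eval s = s.real a 0 := rfl

open Classical in
theorem exec_condReal (b : BExpr) (a : ℕ) (i : NExpr) (e f : RExpr) :
    (Cmd.condReal b a i e f).exec s =
      s.writeReal a (i.eval s) (if b.Holds s then e.eval s else f.eval s) := by
  simp only [Cmd.condReal, Cmd.exec]
  split_ifs <;> rfl

open Classical in
theorem exec_condNat (b : BExpr) (a : ℕ) (i e f : NExpr) :
    (Cmd.condNat b a i e f).exec s =
      s.writeNat a (i.eval s) (if b.Holds s then e.eval s else f.eval s) := by
  simp only [Cmd.condNat, Cmd.exec]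
  split_ifs <;> rfl

theorem exec_block_nil : (Cmd.block []).exec s = s := rfl

theorem exec_block_cons (c : Cmd) (l : List Cmd) :
    (Cmd.block (c :: l)).exec s = (Cmd.block l).exec (c.exec s) := rfl

theorem exec_setNat (a : ℕ) (i e : NExpr) :
    (Cmd.setNat a i e).exec s = s.writeNat a (i.eval s) (e.eval s) := rfl

theorem exec_setReal (a : ℕ) (i : NExpr) (e : RExpr) :
    (Cmd.setReal a i e).exec s = s.writeReal a (i.eval s) (e.eval s) := rfl

theorem exec_incr (a : ℕ) : (incr a).exec s = s.writeNat a 0 (s.nat a 0 + 1) := rfl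

end exec

end RealRAM

namespace Covering

open RealRAM

/-! The memory layout.  Integer variables: `3` current entry, `7` number of nonempty columns, `8`
current row, `9` current column, `11` number of variables, `12` number of levels, `13` current
variable, `14` pointer into a column, `15` current run.  Integer arrays: `4` and `5` hold, for every
column, the linked list of its entries in decreasing order (`4` the heads, `5` the links; the entry
`k` is represented by `k + 1`, and `0` ends a list), `6` the list of nonempty columns, `10` the column
of every variable.  Real variables: `4` the largest inverse of a row maximum, `5` the current power of
two, `11`, `12`, `13` the parameters `μ`, `L`, `τ`, `14` the weight `s`, `15` the derivative, `16` and
`17` the increments, `18` an entry and later the smallest row value, `19` the bound `v`.  Real arrays: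
`3` the row maxima, `6` and `7` the vectors `z` and `R`, `8` and `9` their images under the matrix,
`10` the caps. -/

/-- Processing of one entry: update the maximum of its row and insert it into the list of its column. -/
def readEntry : Cmd := .block
  [.condReal (.realLt (.get 3 (.get 1 (nvar 3))) (.get 0 (nvar 3))) 3 (.get 1 (nvar 3))
      (.get 0 (nvar 3)) (.get 3 (.get 1 (nvar 3))),
    .setNat 6 (nvar 7) (.get 2 (nvar 3)),
    .condNat (.natEq (.get 4 (.get 2 (nvar 3))) (.const 0)) 7 (.const 0)
      (.add (nvar 7) (.const 1)) (nvar 7),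
    .setNat 5 (nvar 3) (.get 4 (.get 2 (nvar 3))),
    .setNat 4 (.get 2 (nvar 3)) (.add (nvar 3) (.const 1)),
    incr 3]

/-- Maximum of the inverses of the row maxima. -/
def boundRow : Cmd := .block
  [.condReal (.realLt (rvar 4) (.div (.const 1) (.get 3 (nvar 8)))) 4 (.const 0)
      (.div (.const 1) (.get 3 (nvar 8))) (rvar 4),
    incr 8]

/-- Creation of the variable for the current level and column. -/
def makeVar : Cmd := .block
  [.setNat 10 (nvar 11) (.get 6 (nvar 9)),
    .setReal 10 (nvar 11) (.div (rvar 5) (rvar 19)),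
    .setReal 6 (nvar 11) (.div (.const 4) (.div (rvar 5) (rvar 19))),
    incr 11,
    incr 9]

/-- Creation of the variables of one level. -/
def makeLevel : Cmd :=
  .seq (.setNat 9 (.const 0) (.const 0))
    (.seq (.loop (.natLt (nvar 9) (nvar 7)) makeVar)
      (.block [.setReal 5 (.const 0) (.add (rvar 5) (rvar 5)), incr 12]))

/-- Loads the capped value of the entry at the pointer, for the current variable. -/
def loadEntry : Cmd :=
  .condReal (.realLt (.get 0 (nvar 14)) (.get 10 (nvar 13))) 18 (.const 0)
    (.get 0 (nvar 14)) (.get 10 (nvar 13))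

/-- Traversal of the column of the current variable. -/
def traverse (body : List Cmd) : Cmd :=
  .seq (.setNat 14 (.const 0) (.get 4 (.get 10 (nvar 13))))
    (.loop (.natLt (.const 0) (nvar 14))
      (.block (.setNat 14 (.const 0) (.sub (nvar 14) (.const 1)) :: loadEntry ::
        (body ++ [.setNat 14 (.const 0) (.get 5 (nvar 14))]))))

/-- Adds multiples of the current column to the images of `z` and `R`. -/
def addColumn : Cmd := traverse
  [.setReal 8 (.get 1 (nvar 14))
      (.add (.get 8 (.get 1 (nvar 14))) (.mul (rvar 18) (rvar 16))),
    .setReal 9 (.get 1 (nvar 14))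
      (.add (.get 9 (.get 1 (nvar 14))) (.mul (rvar 18) (rvar 17)))]

/-- Subtracts the contributions of the current column from the derivative. -/
def gradColumn : Cmd := traverse
  [.setReal 15 (.const 0) (.sub (rvar 15) (.mul (rvar 19) (.mul (rvar 18)
      (.exp (.div (.sub (.const 1) (.sub (.get 8 (.get 1 (nvar 14)))
        (.mul (rvar 14) (.get 9 (.get 1 (nvar 14)))))) (rvar 11))))))]

/-- Computation of the image of the starting point, one variable at a time. -/
def initVar : Cmd :=
  .seq (.setReal 16 (.const 0) (.get 6 (nvar 13)))
    (.seq (.setReal 17 (.const 0) (.const 0)) (.seq addColumn (incr 13)))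

/-- The box size of the current variable. -/
def boxExpr : RExpr := .div (.const 4) (.get 10 (nvar 13))

/-- The arithmetic part of the coordinate step. -/
def stepArith : Cmd := .block
  [.condReal (.realLt (rvar 15) (.const (-1))) 15 (.const 0) (.const (-1)) (rvar 15),
    .setReal 16 (.const 0) (.sub (.get 6 (nvar 13))
      (.mul (.div (rvar 15) (.mul (rvar 12) (rvar 14))) boxExpr)),
    .condReal (.realLt (rvar 16) (.const 0)) 16 (.const 0) (.const 0) (rvar 16),
    .condReal (.realLt boxExpr (rvar 16)) 16 (.const 0) boxExpr (rvar 16),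
    .setReal 16 (.const 0) (.sub (rvar 16) (.get 6 (nvar 13))),
    .setReal 17 (.const 0) (.mul (.sub (.div (.const 1) (rvar 14)) (.const 1)) (rvar 16)),
    .setReal 6 (nvar 13) (.add (.get 6 (nvar 13)) (rvar 16)),
    .setReal 7 (nvar 13) (.add (.get 7 (nvar 13)) (rvar 17))]

/-- The coordinate step for the variable that has been chosen. -/
def coordStep : Cmd :=
  .seq (.block [.setReal 14 (.const 0) (.mul (rvar 14) (.sub (.const 1) (rvar 13))),
      .setReal 15 (.const 0) (.const 1)])
    (.seq gradColumn
      (.seq stepArith addColumn))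

/-- A coordinate step for a uniformly random variable. -/
def randomStep : Cmd := .seq (.sample 13 (.const 0) (.sub (nvar 11) (.const 1))) coordStep

/-- Replaces `z` by the average `z - s R`, and resets `R`. -/
def restart : Cmd :=
  .seq (.setNat 13 (.const 0) (.const 0))
    (.seq (.loop (.natLt (nvar 13) (nvar 11)) (.block
      [.setReal 6 (nvar 13) (.sub (.get 6 (nvar 13)) (.mul (rvar 14) (.get 7 (nvar 13)))),
        .setReal 7 (nvar 13) (.const 0),
        incr 13]))
    (.seq (.setNat 8 (.const 0) (.const 0))
    (.seq (.loop (.natLt (nvar 8) (.get 0 (.const 0))) (.block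
      [.setReal 8 (nvar 8) (.sub (.get 8 (nvar 8)) (.mul (rvar 14) (.get 9 (nvar 8)))),
        .setReal 9 (nvar 8) (.const 0),
        incr 8]))
    (incr 15))))

/-- One run of accelerated coordinate descent. -/
def descentRun : Cmd :=
  .seq (.setReal 14 (.const 0) (.const 1))
    (.seq (.loop (.not (.realLt (.mul (rvar 12) (.mul (rvar 14) (.sub (.const 1) (rvar 13))))
      (.const 1))) randomStep)
    restart)

/-- The preparation: linked lists, bounds, variables, parameters, starting point. -/
def prepare : Cmd :=
  .seq (.loop (.natLt (nvar 3) (.get 0 (.const 2))) readEntry)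
  (.seq (.loop (.natLt (nvar 8) (.get 0 (.const 0))) boundRow)
  (.seq (.block [.setReal 19 (.const 0) (.mul (.ofNat (.get 0 (.const 0))) (rvar 4)),
    .setReal 5 (.const 0) (.const 1)])
  (.seq (.loop (.not (.realLt (.mul (.const 2) (.mul (.ofNat (.get 0 (.const 2)))
      (.ofNat (.get 0 (.const 2))))) (.mul (rvar 5) (rvar 1)))) makeLevel)
  (.seq (.block
    [.setReal 11 (.const 0) (.div (rvar 1) (.mul (.const 32) (.ofNat (nvar 12)))),
      .setReal 12 (.const 0) (.div (.const 16) (rvar 11)),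
      .setReal 13 (.const 0) (.div (.const 1) (.mul (.mul (.const 2) (.ofNat (nvar 11)))
        (rvar 12)))])
  (.loop (.natLt (nvar 13) (nvar 11)) initVar)))))

/-- The output: the solution is scaled by its smallest row value, and the levels are added up. -/
def finish : Cmd :=
  .seq (.block [.setReal 18 (.const 0) (.get 8 (.const 0)), .setNat 8 (.const 0) (.const 0)])
  (.seq (.loop (.natLt (nvar 8) (.get 0 (.const 0))) (.block
    [.condReal (.realLt (.get 8 (nvar 8)) (rvar 18)) 18 (.const 0) (.get 8 (nvar 8)) (rvar 18),
      incr 8]))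
  (.seq (.setNat 13 (.const 0) (.const 0))
  (.loop (.natLt (nvar 13) (nvar 11)) (.block
    [.setReal 2 (.get 10 (nvar 13)) (.add (.get 2 (.get 10 (nvar 13)))
        (.div (.get 6 (nvar 13)) (rvar 18))),
      incr 13]))))

/-- The covering algorithm. -/
def solver : Cmd :=
  .seq prepare (.seq (.loop (.natLt (nvar 15) (nvar 12)) descentRun) finish)

/-! ### Linked lists -/

/-- The pointer to the last entry before `K` in column `i`. -/
def last (col : ℕ → ℕ) : ℕ → ℕ → ℕ
  | 0, _ => 0
  | K + 1, i => if col K = i then K + 1 else last col K i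

/-- Sum over the entries before `K` in column `i`. -/
def sumCol {M : Type*} [AddCommMonoid M] (col : ℕ → ℕ) (φ : ℕ → M) (K i : ℕ) : M :=
  ∑ k ∈ Finset.range K, if col k = i then φ k else 0

theorem last_le (col : ℕ → ℕ) (K i : ℕ) : last col K i ≤ K := by
  induction K with
  | zero => simp [last]
  | succ K ih => simp only [last]; split_ifs <;> omega

theorem col_of_last {col : ℕ → ℕ} {K i p : ℕ} (h : last col K i = p + 1) : col p = i := by
  induction K with
  | zero => simp [last] at h
  | succ K ih =>
    simp only [last] at h
    split_ifs at h with h1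
    · have : K = p := by omega
      rw [← this, h1]
    · exact ih h

theorem last_eq_zero_iff {col : ℕ → ℕ} {K i : ℕ} : last col K i = 0 ↔ ∀ k < K, col k ≠ i := by
  induction K with
  | zero => simp [last]
  | succ K ih =>
    simp only [last]
    split_ifs with h1
    · simp only [false_iff]
      exact fun h => h K (by omega) h1
    · rw [ih]
      refine ⟨fun h k hk => ?_, fun h k hk => h k (by omega)⟩
      rcases Nat.lt_succ_iff_lt_or_eq.1 hk with h2 | h2
      · exact h k h2
      · rw [h2]; exact h1

theorem sumCol_of_last_zero {M : Type*} [AddCommMonoid M] {col : ℕ → ℕ} {φ : ℕ → M} {K i : ℕ}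
    (h : last col K i = 0) : sumCol col φ K i = 0 :=
  Finset.sum_eq_zero fun k hk => if_neg (last_eq_zero_iff.1 h k (Finset.mem_range.1 hk))

theorem sumCol_of_last {M : Type*} [AddCommMonoid M] {col : ℕ → ℕ} {φ : ℕ → M} {K i p : ℕ}
    (h : last col K i = p + 1) : sumCol col φ K i = sumCol col φ p i + φ p := by
  induction K with
  | zero => simp [last] at h
  | succ K ih =>
    unfold sumCol at ih ⊢
    rw [Finset.sum_range_succ]
    simp only [last] at h
    split_ifs at h with h1
    · have : K = p := by omega
      rw [if_pos h1, this]
    · rw [if_neg h1, add_zero, ih h]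

end Covering

/-! ### Correctness of the coordinate step -/

namespace RealRAM

theorem straight_block {l : List Cmd} (h : ∀ c ∈ l, c.Straight) : (Cmd.block l).Straight := by
  induction l with
  | nil => exact trivial
  | cons c l ih => exact ⟨h c (by simp), ih fun c' hc' => h c' (by simp [hc'])⟩

theorem exec_block_append (s : State) (l l' : List Cmd) :
    (Cmd.block (l ++ l')).exec s = (Cmd.block l').exec ((Cmd.block l).exec s) := by
  induction l generalizing s with
  | nil => rfl
  | cons c l ih => simp only [List.cons_append, exec_block_cons, ih]

/-- The integer arrays outside the list `l` agree. -/
def NatEq (l : List ℕ) (s s' : State) : Prop := ∀ a ∉ l, s'.nat a = s.nat a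

/-- The real arrays outside the list `l` agree. -/
def RealEq (l : List ℕ) (s s' : State) : Prop := ∀ a ∉ l, s'.real a = s.real a

theorem NatEq.trans {l l' : List ℕ} {s s' s'' : State} (h : NatEq l s s') (h' : NatEq l' s' s'') :
    NatEq (l ++ l') s s'' := fun a ha => by
  rw [List.mem_append, not_or] at ha
  rw [h' a ha.2, h a ha.1]

theorem RealEq.trans {l l' : List ℕ} {s s' s'' : State} (h : RealEq l s s')
    (h' : RealEq l' s' s'') : RealEq (l ++ l') s s'' := fun a ha => by
  rw [List.mem_append, not_or] at ha
  rw [h' a ha.2, h a ha.1]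

theorem NatEq.mono {l l' : List ℕ} {s s' : State} (h : NatEq l s s') (hl : l ⊆ l') :
    NatEq l' s s' := fun a ha => h a fun h' => ha (hl h')

theorem RealEq.mono {l l' : List ℕ} {s s' : State} (h : RealEq l s s') (hl : l ⊆ l') :
    RealEq l' s s' := fun a ha => h a fun h' => ha (hl h')

end RealRAM

namespace Covering

open RealRAM Finset

/-- The part of the memory that does not change after the preparation. -/
structure Setup (I : Inst) (s : State) : Prop where
  m : s.nat 0 0 = I.m
  row : s.nat 1 = I.row
  head : ∀ i, s.nat 4 i = last I.col I.N i
  link : ∀ k < I.N, s.nat 5 k = last I.col k (I.col k)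
  own : ∀ q < I.Q, s.nat 10 q = I.own q
  Q : s.nat 11 0 = I.Q
  lam : s.nat 12 0 = I.lam
  val : s.real 0 = I.val
  cap : ∀ q < I.Q, s.real 10 q = I.cap q
  μ : s.real 11 0 = I.smoothed.μ
  L : s.real 12 0 = I.smoothed.L
  τ : s.real 13 0 = I.smoothed.τ
  v : s.real 19 0 = I.v

theorem Setup.congr {I : Inst} {s s' : State} (h : Setup I s) {l l' : List ℕ} (hn : NatEq l s s')
    (hr : RealEq l' s s') (hl : ∀ a ∈ [0, 1, 4, 5, 10, 11, 12], a ∉ l := by decide)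
    (hl' : ∀ a ∈ [0, 10, 11, 12, 13, 19], a ∉ l' := by decide) : Setup I s' where
  m := by rw [hn 0 (hl 0 (by decide)), h.m]
  row := by rw [hn 1 (hl 1 (by decide)), h.row]
  head := by rw [hn 4 (hl 4 (by decide))]; exact h.head
  link := by rw [hn 5 (hl 5 (by decide))]; exact h.link
  own := by rw [hn 10 (hl 10 (by decide))]; exact h.own
  Q := by rw [hn 11 (hl 11 (by decide)), h.Q]
  lam := by rw [hn 12 (hl 12 (by decide)), h.lam]
  val := by rw [hr 0 (hl' 0 (by decide)), h.val]
  cap := by rw [hr 10 (hl' 10 (by decide))]; exact h.cap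
  μ := by rw [hr 11 (hl' 11 (by decide)), h.μ]
  L := by rw [hr 12 (hl' 12 (by decide)), h.L]
  τ := by rw [hr 13 (hl' 13 (by decide)), h.τ]
  v := by rw [hr 19 (hl' 19 (by decide)), h.v]

/-- The number of entries in column `i`. -/
def deg (I : Inst) (i : ℕ) : ℕ := sumCol I.col (fun _ => 1) I.N i

/-- Cost of the processing of one entry in the traversal of a column. -/
def entryCost (body : List Cmd) : ℕ := (Cmd.block (.setNat 14 (.const 0)
  (.sub (nvar 14) (.const 1)) :: loadEntry ::
    (body ++ [.setNat 14 (.const 0) (.get 5 (nvar 14))]))).total + 5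

/-- The traversal of a column.  The property `J K` of the real memory holds as long as the entries
before `K` remain to be visited. -/
theorem ends_traverse {I : Inst} {s : State} {q : ℕ} (hS : Setup I s) (hq : q < I.Q)
    (hsq : s.nat 13 0 = q) {body : List Cmd} (hst : ∀ c ∈ body, c.Straight)
    (J : ℕ → (ℕ → ℕ → ℝ) → Prop) (h0 : J I.N s.real)
    (hval : ∀ K t, J K t → t 0 = s.real 0 ∧ t 10 = s.real 10)
    (hload : ∀ K (t : State) w, J K t.real → J K (t.writeReal 18 0 w).real)
    (hbody : ∀ K p t, p < I.N → last I.col K (I.own q) = p + 1 → NatEq [14] s t →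
      t.nat 14 0 = p → t.real 18 0 = I.coef p q → J K t.real →
      ((Cmd.block body).exec t).nat = t.nat ∧ J p ((Cmd.block body).exec t).real) :
    Ends (traverse body) s (deg I (I.own q) * entryCost body + (entryCost body + 7)) fun s' =>
      NatEq [14] s s' ∧ ∃ K, last I.col K (I.own q) = 0 ∧ J K s'.real := by
  set i := I.own q with hi
  -- `t` entries have been visited, those before `K` remain
  let V : ℕ → State → Prop := fun t s' => NatEq [14] s s' ∧ ∃ K ≤ I.N,
    sumCol I.col (fun _ => 1) K i + t = deg I i ∧ s'.nat 14 0 = last I.col K i ∧ J K s'.real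
  have hfirst : Ends (.setNat 14 (.const 0) (.get 4 (.get 10 (nvar 13)))) s 6 (V 0) := by
    refine (Cmd.Straight.ends' (P := .setNat 14 (.const 0) (.get 4 (.get 10 (nvar 13)))) trivial
      (Q := V 0) ?_).imp (by decide) fun _ h => h
    refine ⟨fun a ha => ?_, I.N, le_rfl, rfl, ?_, h0⟩
    · simp only [List.mem_singleton] at ha
      simp [Cmd.exec, ha]
    · simp only [Cmd.exec, NExpr.eval, eval_nvar, hsq, hS.own q hq, hS.head,
        nat_writeNat_self, Function.update_self]
      rfl
  refine (hfirst.seq (l := (deg I i + 1) * entryCost body) (fun s1 hs1 => ?_)).imp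
    (by ring_nf; omega) fun _ h => h
  refine (Ends.loop_const V (deg I i) (entryCost body - 5) (fun t ht s2 hs2 => ?_)
    (fun s2 hs2 => ?_) hs1).imp ?_ ?_
  · obtain ⟨hn, K, hK, hcount, hptr, hJ⟩ := hs2
    obtain ⟨p, hp⟩ : ∃ p, last I.col K i = p + 1 := by
      refine Nat.exists_eq_succ_of_ne_zero fun h1 => ?_
      rw [sumCol_of_last_zero h1] at hcount
      omega
    have hpK : p < K := by have := last_le I.col K i; omega
    have hcol := col_of_last hp
    constructor
    · change 0 < s2.nat 14 0
      rw [hptr, hp]; omega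
    · refine (Cmd.Straight.ends' ?_ ?_).imp (le_of_eq ?_) fun _ h => h
      · refine straight_block fun c hc => ?_
        simp only [List.mem_cons, List.mem_append, List.not_mem_nil, or_false] at hc
        rcases hc with rfl | rfl | hc | rfl
        · exact trivial
        · exact ⟨trivial, trivial⟩
        · exact hst c hc
        · exact trivial
      · obtain ⟨hv0, hv10⟩ := hval K _ hJ
        rw [exec_block_cons, exec_block_cons, exec_block_append]
        set t1 := Cmd.exec (.setNat 14 (.const 0) (.sub (nvar 14) (.const 1))) s2 with ht1
        have ht1p : t1.nat 14 0 = p := by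
          simp [ht1, Cmd.exec, NExpr.eval, hptr, hp]
        have ht1n : NatEq [14] s t1 := fun a ha => by
          have ha' := ha
          simp only [List.mem_singleton] at ha
          simp [ht1, Cmd.exec, NExpr.eval, ha, hn a ha']
        have ht1r : t1.real = s2.real := rfl
        set t2 := loadEntry.exec t1 with ht2
        have ht2' : t2 = t1.writeReal 18 0 (I.coef p q) := by
          rw [ht2, loadEntry, exec_condReal]
          congr 1
          simp only [BExpr.Holds, RExpr.eval, eval_nvar, ht1p, ht1r, hv0, hv10,
            hS.val, ht1n 13 (by decide), hsq, hS.cap q hq, Inst.coef]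
          split_ifs with h1
          · rw [min_eq_left h1.le]
          · rw [min_eq_right (not_lt.1 h1)]
        have hJ2 : J K t2.real := by rw [ht2']; exact hload K t1 _ (by rw [ht1r]; exact hJ)
        obtain ⟨hb1, hb2⟩ := hbody K p t2 (by omega) hp (by rw [ht2']; exact ht1n)
          (by rw [ht2']; exact ht1p) (by rw [ht2']; simp) hJ2
        set t3 := (Cmd.block body).exec t2
        have ht3n : t3.nat = t1.nat := by rw [hb1, ht2']; rfl
        rw [exec_block_cons, exec_block_nil, exec_setNat]
        refine ⟨fun a ha => ?_, p, by omega, ?_, ?_, hb2⟩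
        · have ha' := ha
          simp only [List.mem_singleton] at ha
          simp [ha, ht3n, ht1n a ha']
        · rw [sumCol_of_last hp] at hcount
          omega
        · simp only [NExpr.eval, eval_nvar, nat_writeNat_self, Function.update_self, ht3n,
            ht1n 5 (by decide), ht1p]
          rw [hS.link p (by omega), hcol]
      · unfold entryCost
        omega
  · obtain ⟨-, K, -, hcount, hptr, -⟩ := hs2
    have h1 : last I.col K i = 0 := by
      by_contra h2
      obtain ⟨p, hp⟩ := Nat.exists_eq_succ_of_ne_zero h2
      rw [sumCol_of_last hp] at hcount
      omega
    change ¬ 0 < s2.nat 14 0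
    rw [hptr, h1]
    omega
  · have h1 : entryCost body - 5 + (BExpr.natLt (.const 0) (nvar 14)).cost + 1 =
        entryCost body := by
      have : (BExpr.natLt (.const 0) (nvar 14)).cost = 4 := rfl
      unfold entryCost
      omega
    rw [h1]
  · rintro s' ⟨hn, K, -, hcount, -, hJ⟩
    refine ⟨hn, K, ?_, hJ⟩
    by_contra h2
    obtain ⟨p, hp⟩ := Nat.exists_eq_succ_of_ne_zero h2
    rw [sumCol_of_last hp] at hcount
    omega

/-- The contribution of column `q` to row `j`, entry by entry. -/
theorem sumCol_row (I : Inst) (q j : ℕ) (c : ℝ) :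
    sumCol I.col (fun k => if I.row k = j then I.coef k q * c else 0) I.N (I.own q) =
      I.B j q * c := by
  unfold sumCol Inst.B
  rw [sum_mul]
  refine sum_congr rfl fun k _ => ?_
  by_cases h1 : I.col k = I.own q <;> by_cases h2 : I.row k = j <;> simp [h1, h2]

/-- The images of `z` and `R` are updated along one column. -/
theorem ends_addColumn {I : Inst} {s : State} {q : ℕ} (hS : Setup I s) (hq : q < I.Q)
    (hsq : s.nat 13 0 = q) :
    Ends addColumn s (deg I (I.own q) * 100 + 107) fun s' => NatEq [14] s s' ∧
      RealEq [8, 9, 18] s s' ∧ (∀ j, s'.real 8 j = s.real 8 j + I.B j q * s.real 16 0) ∧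
      ∀ j, s'.real 9 j = s.real 9 j + I.B j q * s.real 17 0 := by
  let φ : ℝ → ℕ → ℕ → ℝ := fun c j k => if I.row k = j then I.coef k q * c else 0
  have hcost : entryCost [.setReal 8 (.get 1 (nvar 14))
      (.add (.get 8 (.get 1 (nvar 14))) (.mul (rvar 18) (rvar 16))),
    .setReal 9 (.get 1 (nvar 14))
      (.add (.get 9 (.get 1 (nvar 14))) (.mul (rvar 18) (rvar 17)))] ≤ 100 := by decide
  refine (ends_traverse hS hq hsq ?_ (fun K t => (∀ a ∉ [8, 9, 18], t a = s.real a) ∧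
    (∀ j, t 8 j + sumCol I.col (φ (s.real 16 0) j) K (I.own q) =
      s.real 8 j + I.B j q * s.real 16 0) ∧
    ∀ j, t 9 j + sumCol I.col (φ (s.real 17 0) j) K (I.own q) =
      s.real 9 j + I.B j q * s.real 17 0) ?_ ?_ ?_ ?_).imp (by gcongr; omega) ?_
  · intro c hc
    simp only [List.mem_cons, List.not_mem_nil, or_false] at hc
    rcases hc with rfl | rfl <;> exact trivial
  · exact ⟨fun _ _ => rfl, fun j => by rw [sumCol_row], fun j => by rw [sumCol_row]⟩
  · intro K t ht
    exact ⟨ht.1 0 (by decide), ht.1 10 (by decide)⟩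
  · rintro K t w ⟨h1, h2, h3⟩
    refine ⟨fun a ha => ?_, by simpa using h2, by simpa using h3⟩
    rw [← h1 a ha]
    simp only [List.mem_cons, not_or] at ha
    simp [ha]
  · rintro K p t hp hlast hn hptr hent ⟨h1, h2, h3⟩
    have hrow : t.nat 1 p = I.row p := by rw [hn 1 (by decide), hS.row]
    refine ⟨rfl, fun a ha => ?_, fun j => ?_, fun j => ?_⟩
    · rw [← h1 a ha]
      simp only [List.mem_cons, not_or] at ha
      simp [exec_block_cons, exec_block_nil, exec_setReal, ha]
    · have h4 := h2 j
      rw [sumCol_of_last hlast] at h4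
      rw [← h4]
      simp only [exec_block_cons, exec_block_nil, exec_setReal, NExpr.eval, RExpr.eval, eval_nvar,
        eval_rvar, nat_writeReal, hptr, hrow, hent, ne_eq, Nat.reduceEqDiff, not_false_eq_true, real_writeReal_ne, real_writeReal_self,
        h1 16 (by decide)]
      by_cases hj : I.row p = j
      · subst hj; simp [φ]; ring
      · simp [φ, hj, Function.update_of_ne (Ne.symm hj)]
    · have h4 := h3 j
      rw [sumCol_of_last hlast] at h4
      rw [← h4]
      simp only [exec_block_cons, exec_block_nil, exec_setReal, NExpr.eval, RExpr.eval, eval_nvar,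
        eval_rvar, nat_writeReal, hptr, hrow, hent, ne_eq, Nat.reduceEqDiff, not_false_eq_true, real_writeReal_ne, real_writeReal_self,
        h1 17 (by decide)]
      by_cases hj : I.row p = j
      · subst hj; simp [φ]; ring
      · simp [φ, hj, Function.update_of_ne (Ne.symm hj)]
  · rintro s' ⟨hn, K, hK, h1, h2, h3⟩
    refine ⟨hn, h1, fun j => ?_, fun j => ?_⟩
    · rw [← h2 j, sumCol_of_last_zero hK, add_zero]
    · rw [← h3 j, sumCol_of_last_zero hK, add_zero]

end Covering

namespace Covering

open RealRAM Finset

theorem sumCol_grad {I : Inst} (hI : I.OK) (q : ℕ) (p : ℕ → ℝ) :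
    sumCol I.col (fun k => I.v * (I.coef k q * p (I.row k))) I.N (I.own q) =
      I.v * ∑ j ∈ range I.m, I.B j q * p j := by
  unfold sumCol Inst.B
  simp only [sum_mul]
  rw [sum_comm, mul_sum]
  refine sum_congr rfl fun k hk => ?_
  have hrow := hI.row_lt k (mem_range.1 hk)
  by_cases h1 : I.col k = I.own q
  · simp [h1, ite_mul, hrow]
  · simp [h1]

/-- One column suffices to compute a partial derivative, if the image of the current point is known. -/
theorem ends_gradColumn {I : Inst} (hI : I.OK) {s : State} {q : ℕ} (hS : Setup I s) (hq : q < I.Q)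
    (hsq : s.nat 13 0 = q) (x : ℕ → ℝ)
    (hx : ∀ j < I.m, s.real 8 j - s.real 14 0 * s.real 9 j = I.smoothed.load x j)
    (hg : s.real 15 0 = 1) :
    Ends gradColumn s (deg I (I.own q) * 100 + 107) fun s' => NatEq [14] s s' ∧
      RealEq [15, 18] s s' ∧ s'.real 15 0 = I.smoothed.grad x q := by
  have hcost : entryCost [.setReal 15 (.const 0) (.sub (rvar 15) (.mul (rvar 19) (.mul (rvar 18)
      (.exp (.div (.sub (.const 1) (.sub (.get 8 (.get 1 (nvar 14)))
        (.mul (rvar 14) (.get 9 (.get 1 (nvar 14)))))) (rvar 11))))))] ≤ 100 := by decide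
  let φ : ℕ → ℝ := fun k => I.v * (I.coef k q * I.smoothed.pen x (I.row k))
  refine (ends_traverse hS hq hsq ?_ (fun K t => (∀ a ∉ [15, 18], t a = s.real a) ∧
    t 15 0 - sumCol I.col φ K (I.own q) = 1 - sumCol I.col φ I.N (I.own q)) ?_ ?_ ?_ ?_).imp
    (by gcongr; omega) ?_
  · intro c hc
    simp only [List.mem_cons, List.not_mem_nil, or_false] at hc
    rw [hc]
    exact trivial
  · exact ⟨fun _ _ => rfl, by rw [hg]⟩
  · intro K t ht
    exact ⟨ht.1 0 (by decide), ht.1 10 (by decide)⟩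
  · rintro K t w ⟨h1, h2⟩
    refine ⟨fun a ha => ?_, by simpa using h2⟩
    rw [← h1 a ha]
    simp only [List.mem_cons, not_or] at ha
    simp [ha]
  · rintro K p t hp hlast hn hptr hent ⟨h1, h2⟩
    have hrow : t.nat 1 p = I.row p := by rw [hn 1 (by decide), hS.row]
    refine ⟨rfl, fun a ha => ?_, ?_⟩
    · rw [← h1 a ha]
      simp only [List.mem_cons, not_or] at ha
      simp [exec_block_cons, exec_block_nil, exec_setReal, ha]
    · rw [sumCol_of_last hlast] at h2
      rw [← h2]
      simp only [exec_block_cons, exec_block_nil, exec_setReal, NExpr.eval, RExpr.eval, eval_nvar,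
        eval_rvar, hptr, hrow, hent, real_writeReal_self, Function.update_self,
        h1 8 (by decide), h1 9 (by decide), h1 14 (by decide), h1 11 (by decide),
        h1 19 (by decide), hx _ (hI.row_lt p hp), hS.v, hS.μ]
      simp only [φ, Smoothed.pen]
      push_cast
      ring
  · rintro s' ⟨hn, K, hK, h1, h2⟩
    refine ⟨hn, h1, ?_⟩
    rw [sumCol_of_last_zero hK, sub_zero, sumCol_grad hI] at h2
    exact h2

/-- The memory during a run with current weight `σ`, in round `r`. -/
structure RunState (I : Inst) (r : ℕ) (σ : ℝ) (s : State) : Prop where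
  setup : Setup I s
  weight : s.real 14 0 = σ
  round : s.nat 15 0 = r
  blank : ∀ i, s.real 2 i = 0
  tail : ∀ q, I.Q ≤ q → s.real 7 q = 0
  loadZ : ∀ j < I.m, s.real 8 j = I.smoothed.load (s.real 6) j
  loadR : ∀ j < I.m, s.real 9 j = I.smoothed.load (s.real 7) j
  inv : I.smoothed.RunInv (s.real 6) (s.real 7) σ

theorem load_point (D : Smoothed) (z R : ℕ → ℝ) (σ : ℝ) (j : ℕ) :
    D.load (Smoothed.point z R σ) j = D.load z j - σ * D.load R j := by
  unfold Smoothed.load Smoothed.point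
  rw [mul_sum, ← sum_sub_distrib]
  exact sum_congr rfl fun q _ => by ring

open Classical in
theorem ite_lt_neg_one (g : ℝ) : (if g < -1 then -1 else g) = max g (-1) := by
  split_ifs with h
  · rw [max_eq_right h.le]
  · rw [max_eq_left (not_lt.1 h)]

open Classical in
theorem ite_clip (b w : ℝ) : (if b < (if w < 0 then 0 else w) then b else if w < 0 then 0 else w) =
    min b (max 0 w) := by
  have h1 : (if w < 0 then 0 else w) = max 0 w := by
    split_ifs with h
    · rw [max_eq_left h.le]
    · rw [max_eq_right (not_lt.1 h)]
  rw [h1]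
  split_ifs with h
  · rw [min_eq_left h.le]
  · rw [min_eq_right (not_lt.1 h)]

/-- The arithmetic part of the coordinate step computes the mirror step. -/
theorem ends_stepArith {I : Inst} {s : State} {q : ℕ} {σ g : ℝ} (hS : Setup I s) (hq : q < I.Q)
    (hsq : s.nat 13 0 = q) (hσ : s.real 14 0 = σ) (hg : s.real 15 0 = g) :
    Ends stepArith s 200 fun s' => s'.nat = s.nat ∧ RealEq [6, 7, 15, 16, 17] s s' ∧
      s'.real 16 0 =
        Smoothed.mirror I.smoothed.L σ (I.smoothed.box q) g (s.real 6 q) - s.real 6 q ∧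
      s'.real 17 0 = (1 / σ - 1) * s'.real 16 0 ∧
      s'.real 6 = Function.update (s.real 6) q (s.real 6 q + s'.real 16 0) ∧
      s'.real 7 = Function.update (s.real 7) q (s.real 7 q + s'.real 17 0) := by
  classical
  refine (Cmd.Straight.ends' (P := stepArith) ?_ ?_).imp (by decide) fun _ h => h
  · simp [stepArith, Cmd.block, Cmd.Straight, Cmd.condReal]
  · have hbox : 4 / s.real 10 q = I.smoothed.box q := by rw [hS.cap q hq]; rfl
    simp only [stepArith, exec_block_cons, exec_block_nil, exec_condReal, exec_setReal,
      BExpr.Holds, RExpr.eval, NExpr.eval, eval_nvar, eval_rvar, boxExpr, nat_writeReal, hsq, hσ, hg,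
      real_writeReal_self, real_writeReal_ne, Function.update_self, ne_eq, Nat.reduceEqDiff,
      not_false_eq_true, Rat.cast_ofNat, Rat.cast_neg, Rat.cast_one, Rat.cast_zero, hbox, hS.L,
      ite_lt_neg_one, ite_clip]
    refine ⟨trivial, fun a ha => ?_, ?_⟩
    · simp only [List.mem_cons, not_or] at ha
      simp [ha]
    exact ⟨rfl, trivial, trivial, trivial⟩

theorem load_nextZ {I : Inst} {z R : ℕ → ℝ} {σ : ℝ} {q : ℕ} (hq : q < I.Q) (j : ℕ) :
    I.smoothed.load (I.smoothed.nextZ z R σ q) j =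
      I.smoothed.load z j + I.B j q * (I.smoothed.newZ z R σ q - z q) :=
  Smoothed.load_update (D := I.smoothed) hq _ j

theorem load_nextR {I : Inst} {z R : ℕ → ℝ} {σ : ℝ} {q : ℕ} (hq : q < I.Q) (j : ℕ) :
    I.smoothed.load (I.smoothed.nextR z R σ q) j =
      I.smoothed.load R j + I.B j q * ((1 / σ - 1) * (I.smoothed.newZ z R σ q - z q)) :=
  Smoothed.load_update (D := I.smoothed) hq _ j

/-- The coordinate step of the program is the coordinate step of the analysis. -/
theorem ends_coordStep {I : Inst} (hI : I.OK) {r : ℕ} {σ : ℝ} {s : State} (hσ : 0 < σ)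
    (hs : RunState I r σ s) {q : ℕ} (hq : q < I.Q) :
    Ends coordStep (s.writeNat 13 0 q) (deg I (I.own q) * 200 + 500) fun s' =>
      RunState I r (σ * (1 - I.smoothed.τ)) s' ∧
      s'.real 6 = I.smoothed.nextZ (s.real 6) (s.real 7) (σ * (1 - I.smoothed.τ)) q ∧
      s'.real 7 = I.smoothed.nextR (s.real 6) (s.real 7) (σ * (1 - I.smoothed.τ)) q := by
  set σ' := σ * (1 - I.smoothed.τ) with hσ'
  set x := Smoothed.point (s.real 6) (s.real 7) σ' with hx
  have hfirst : Ends (.block [.setReal 14 (.const 0) (.mul (rvar 14) (.sub (.const 1) (rvar 13))),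
      .setReal 15 (.const 0) (.const 1)]) (s.writeNat 13 0 q) 20 fun s' =>
      NatEq [13] s s' ∧ s'.nat 13 0 = q ∧ RealEq [14, 15] s s' ∧ s'.real 14 0 = σ' ∧
        s'.real 15 0 = 1 := by
    refine (Cmd.Straight.ends' ?_ ?_).imp (by decide) fun _ h => h
    · simp [Cmd.block, Cmd.Straight]
    · refine ⟨fun a ha => ?_, ?_, fun a ha => ?_, ?_, ?_⟩
      · simp only [List.mem_cons, List.not_mem_nil, or_false] at ha
        simp [exec_block_cons, exec_block_nil, exec_setReal, ha]
      · simp [exec_block_cons, exec_block_nil, exec_setReal]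
      · simp only [List.mem_cons, List.not_mem_nil, or_false, not_or] at ha
        simp [exec_block_cons, exec_block_nil, exec_setReal, ha]
      · simp [exec_block_cons, exec_block_nil, exec_setReal, RExpr.eval, NExpr.eval, hs.weight,
          hs.setup.τ, hσ']
      · simp [exec_block_cons, exec_block_nil, exec_setReal, RExpr.eval, NExpr.eval]
  refine (hfirst.seq (l := deg I (I.own q) * 200 + 450) fun s1 hs1 => ?_).imp (by omega)
    fun _ h => h
  obtain ⟨n1, q1, r1, w1, g1⟩ := hs1
  have S1 : Setup I s1 := hs.setup.congr n1 r1
  have hload : ∀ j < I.m, s1.real 8 j - s1.real 14 0 * s1.real 9 j = I.smoothed.load x j := by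
    intro j hj
    rw [r1 8 (by decide), r1 9 (by decide), w1, hs.loadZ j hj, hs.loadR j hj, hx, load_point]
  refine ((ends_gradColumn hI S1 hq q1 x hload g1).seq (l := deg I (I.own q) * 100 + 330)
    fun s2 hs2 => ?_).imp (by omega) fun _ h => h
  obtain ⟨n2, r2, g2⟩ := hs2
  have S2 : Setup I s2 := S1.congr n2 r2
  have q2 : s2.nat 13 0 = q := by rw [n2 13 (by decide), q1]
  have w2 : s2.real 14 0 = σ' := by rw [r2 14 (by decide), w1]
  refine ((ends_stepArith S2 hq q2 w2 g2).seq (l := deg I (I.own q) * 100 + 107)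
    fun s3 hs3 => ?_).imp (by omega) fun _ h => h
  obtain ⟨n3, r3, d3, e3, z3, R3⟩ := hs3
  have n3' : NatEq [] s2 s3 := fun a _ => by rw [n3]
  have S3 : Setup I s3 := S2.congr n3' r3
  have q3 : s3.nat 13 0 = q := by rw [n3, q2]
  refine (ends_addColumn S3 hq q3).imp le_rfl fun s4 hs4 => ?_
  obtain ⟨n4, r4, l4, m4⟩ := hs4
  have zz : s2.real 6 = s.real 6 := by rw [r2 6 (by decide), r1 6 (by decide)]
  have RR : s2.real 7 = s.real 7 := by rw [r2 7 (by decide), r1 7 (by decide)]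
  rw [zz] at d3 z3
  rw [RR] at R3
  have hΔ : s3.real 16 0 = I.smoothed.newZ (s.real 6) (s.real 7) σ' q - s.real 6 q := d3
  rw [hΔ] at e3 z3 l4
  rw [e3] at R3 m4
  have z4 : s4.real 6 = I.smoothed.nextZ (s.real 6) (s.real 7) σ' q := by
    rw [r4 6 (by decide), z3]; rfl
  have R4 : s4.real 7 = I.smoothed.nextR (s.real 6) (s.real 7) σ' q := by
    rw [r4 7 (by decide), R3]; rfl
  have nn : NatEq [13, 14] s s4 := ((n1.trans n2).trans (n3'.trans n4)).mono (by decide)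
  have rr : RealEq [6, 7, 8, 9, 14, 15, 16, 17, 18] s s4 :=
    ((r1.trans r2).trans (r3.trans r4)).mono (by decide)
  refine ⟨⟨hs.setup.congr nn rr, ?_, ?_, fun i => ?_, fun i hi => ?_, fun j hj => ?_,
    fun j hj => ?_, ?_⟩, z4, R4⟩
  · rw [r4 14 (by decide), r3 14 (by decide), w2]
  · rw [nn 15 (by decide), hs.round]
  · rw [rr 2 (by decide), hs.blank]
  · have hne : i ≠ q := by omega
    rw [R4, Smoothed.nextR, Function.update_of_ne hne, hs.tail i hi]
  · rw [l4, z4, load_nextZ hq, r3 8 (by decide), r2 8 (by decide), r1 8 (by decide),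
      hs.loadZ j hj]
  · rw [m4, R4, load_nextR hq, r3 9 (by decide), r2 9 (by decide), r1 9 (by decide),
      hs.loadR j hj]
  · rw [z4, R4]
    exact hs.inv.next hI.valid hσ q

end Covering

/-! ### Correctness of a run -/

namespace Covering

open RealRAM Finset

/-- Every entry is visited once for every level. -/
theorem sum_deg_le {I : Inst} (hI : I.OK) : ∑ q ∈ range I.Q, deg I (I.own q) ≤ I.lam * I.N := by
  have e := sum_range_mul_divMod I.lam I.nc fun _ i => deg I (I.cols i)
  have e' : ∑ q ∈ range I.Q, deg I (I.own q) =
      ∑ _l ∈ range I.lam, ∑ i ∈ range I.nc, deg I (I.cols i) := e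
  rw [e', sum_const, card_range, smul_eq_mul]
  refine Nat.mul_le_mul_left _ ?_
  unfold deg sumCol
  rw [sum_comm]
  have h : ∀ k ∈ range I.N, ∑ i ∈ range I.nc, (if I.col k = I.cols i then 1 else 0) ≤ 1 := by
    intro k hk
    obtain ⟨i, hi, hic⟩ := hI.cols_surj k (mem_range.1 hk)
    rw [sum_eq_single_of_mem i (mem_range.2 hi)]
    · split_ifs <;> omega
    · intro i' hi' hne
      rw [if_neg]
      intro h'
      exact hne (hI.cols_inj i' (mem_range.1 hi') i hi (by rw [hic, h']))
  refine (sum_le_sum h).trans ?_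
  simp

/-- The number of steps of a run: the weight `(1 - τ) ^ k` decreases until the next step would make it
smaller than `1 / L`. -/
theorem exists_steps {D : Smoothed} (hD : D.Valid) : ∃ T : ℕ,
    (∀ k < T, 1 ≤ D.L * (1 - D.τ) ^ (k + 1)) ∧ D.L * (1 - D.τ) ^ (T + 1) < 1 ∧
      (T : ℝ) ≤ 2 * D.Q * D.L * Real.log D.L := by
  classical
  have hτ0 := hD.τ_pos
  have hτ1 := hD.τ_le
  have hL := hD.L_ge
  have hL0 := hD.L_pos
  have hex : ∃ T : ℕ, D.L * (1 - D.τ) ^ (T + 1) < 1 := by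
    obtain ⟨n, hn⟩ := exists_pow_lt_of_lt_one (by positivity : 0 < 1 / D.L)
      (by linarith : 1 - D.τ < 1)
    refine ⟨n, ?_⟩
    have h1 : (1 - D.τ) ^ (n + 1) ≤ (1 - D.τ) ^ n :=
      pow_le_pow_of_le_one (by linarith) (by linarith) (by omega)
    have h2 : (1 - D.τ) ^ (n + 1) < 1 / D.L := lt_of_le_of_lt h1 hn
    rw [lt_div_iff₀ hL0] at h2
    linarith
  have h1 : ∀ k < Nat.find hex, 1 ≤ D.L * (1 - D.τ) ^ (k + 1) := fun k hk =>
    not_lt.1 (Nat.find_min hex hk)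
  have h2 : 1 ≤ D.L * (1 - D.τ) ^ Nat.find hex := by
    rcases Nat.eq_zero_or_pos (Nat.find hex) with h | h
    · rw [h]; simp; linarith
    · have := h1 (Nat.find hex - 1) (by omega)
      rwa [Nat.sub_add_cancel h] at this
  refine ⟨Nat.find hex, h1, Nat.find_spec hex, ?_⟩
  set T := Nat.find hex
  have h3 : (1 - D.τ) ^ T ≤ Real.exp (-(T * D.τ)) := by
    have h4 := Real.add_one_le_exp (-D.τ)
    have h5 : Real.exp (-(T * D.τ)) = Real.exp (-D.τ) ^ T := by
      rw [← Real.exp_nat_mul]; ring_nf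
    rw [h5]
    exact pow_le_pow_left₀ (by linarith) (by linarith) _
  have h4 : Real.exp (T * D.τ) ≤ D.L := by
    have h5 : 1 ≤ D.L * Real.exp (-(T * D.τ)) := h2.trans (by gcongr)
    rw [Real.exp_neg, ← div_eq_mul_inv, le_div_iff₀ (Real.exp_pos _)] at h5
    linarith
  have h5 : T * D.τ ≤ Real.log D.L := (Real.le_log_iff_exp_le hL0).2 h4
  have hQ : (0 : ℝ) < D.Q := by exact_mod_cast hD.Q_pos
  have h6 : (T : ℝ) = 2 * D.Q * D.L * (T * D.τ) := by
    unfold Smoothed.τ; field_simp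
  rw [h6]
  gcongr

/-- Bound for the expected cost of a coordinate step: the average length of a column matters. -/
noncomputable def stepCost (I : Inst) : ℝ≥0∞ := 600 + 200 * ((I.N : ℝ≥0∞) / I.nc)

/-- The cost of a coordinate step, averaged over the variables. -/
theorem sum_cost_le {I : Inst} (hI : I.OK) :
    ∑ q ∈ range I.Q, ((deg I (I.own q) * 200 + 500 : ℕ) : ℝ≥0∞) ≤
      I.Q * (500 + 200 * ((I.N : ℝ≥0∞) / I.nc)) := by
  have h1 : ∑ q ∈ range I.Q, (deg I (I.own q) * 200 + 500) ≤ 500 * I.Q + 200 * (I.lam * I.N) := by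
    rw [sum_add_distrib, ← sum_mul]
    have := sum_deg_le hI
    simp only [sum_const, card_range, smul_eq_mul]
    omega
  have hnc : (I.nc : ℝ≥0∞) ≠ 0 := by exact_mod_cast hI.nc_pos.ne'
  have h2 : (I.nc : ℝ≥0∞) * ((I.N : ℝ≥0∞) / I.nc) = I.N :=
    ENNReal.mul_div_cancel hnc (ENNReal.natCast_ne_top _)
  calc ∑ q ∈ range I.Q, ((deg I (I.own q) * 200 + 500 : ℕ) : ℝ≥0∞)
      ≤ ((500 * I.Q + 200 * (I.lam * I.N) : ℕ) : ℝ≥0∞) := by exact_mod_cast h1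
    _ = I.Q * 500 + 200 * (I.lam * (I.nc * ((I.N : ℝ≥0∞) / I.nc))) := by
        rw [h2]; push_cast; ring
    _ = _ := by unfold Inst.Q; push_cast; ring

/-- The loop of coordinate steps. -/
theorem bounds_steps {I : Inst} (hI : I.OK) (r : ℕ) {u : ℕ → ℝ} (hu : I.smoothed.InBox u) {T : ℕ}
    (hT : ∀ k < T, 1 ≤ I.smoothed.L * (1 - I.smoothed.τ) ^ (k + 1))
    (hT' : I.smoothed.L * (1 - I.smoothed.τ) ^ (T + 1) < 1) :
    Bounds (.loop (.not (.realLt (.mul (rvar 12) (.mul (rvar 14) (.sub (.const 1) (rvar 13))))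
      (.const 1))) randomStep) (RunState I r 1) (RunState I r ((1 - I.smoothed.τ) ^ T))
      ((T + 1) * (stepCost I)) (fun s => I.smoothed.potential u (s.real 6) (s.real 7) 1)
      (fun s => I.smoothed.potential u (s.real 6) (s.real 7) ((1 - I.smoothed.τ) ^ T)) := by
  have hD := hI.valid
  have hτ0 := hD.τ_pos
  have hτ1 := hD.τ_le
  have h1τ : 0 < 1 - I.smoothed.τ := by linarith
  have hguard : ∀ (k : ℕ) (s : State), RunState I r ((1 - I.smoothed.τ) ^ k) s →
      ((BExpr.not (.realLt (.mul (rvar 12) (.mul (rvar 14) (.sub (.const 1) (rvar 13))))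
      (.const 1))).Holds s ↔ 1 ≤ I.smoothed.L * (1 - I.smoothed.τ) ^ (k + 1)) := by
    intro k s hs
    simp only [BExpr.Holds, RExpr.eval, eval_rvar, hs.setup.L, hs.setup.τ, hs.weight, not_lt,
      Rat.cast_one, pow_succ]
  have h := Bounds.loop (b := .not (.realLt (.mul (rvar 12) (.mul (rvar 14)
      (.sub (.const 1) (rvar 13)))) (.const 1))) (P := randomStep)
    (fun k => RunState I r ((1 - I.smoothed.τ) ^ k))
    (fun k s => I.smoothed.potential u (s.real 6) (s.real 7) ((1 - I.smoothed.τ) ^ k)) T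
    (c := 500 + 200 * ((I.N : ℝ≥0∞) / I.nc) +
      (Cmd.sample 13 (.const 0) (.sub (nvar 11) (.const 1))).cost + 1) ?_
    (fun k hk s hs => (hguard k s hs).2 (hT k hk))
    (fun s hs h' => absurd ((hguard T s hs).1 h') (not_le.2 hT'))
  · refine h.imp (fun s hs => by simpa using hs) (fun _ h => h) ?_ (fun s _ => by simp)
      (fun _ _ => le_rfl)
    unfold stepCost
    refine mul_le_mul' le_rfl ?_
    have h1 : (Cmd.sample 13 (.const 0) (.sub (nvar 11) (.const 1))).cost = 6 := rfl
    have h2 : (BExpr.not (.realLt (.mul (rvar 12) (.mul (rvar 14)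
      (.sub (.const 1) (rvar 13)))) (.const 1))).cost = 13 := rfl
    rw [h1, h2]
    have h3 : (500 : ℝ≥0∞) + ((6 : ℕ) : ℝ≥0∞) + 1 + ((13 : ℕ) : ℝ≥0∞) + 1 ≤ 600 := by norm_num
    calc (500 : ℝ≥0∞) + 200 * ((I.N : ℝ≥0∞) / I.nc) + ((6 : ℕ) : ℝ≥0∞) + 1 + ((13 : ℕ) : ℝ≥0∞) + 1
        = (500 + ((6 : ℕ) : ℝ≥0∞) + 1 + ((13 : ℕ) : ℝ≥0∞) + 1) +
          200 * ((I.N : ℝ≥0∞) / I.nc) := by ring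
      _ ≤ _ := by gcongr
  · intro k hk
    refine Bounds.sample (n := I.Q) (k := fun q => deg I (I.own q) * 200 + 500) hI.Q_pos
      (sum_cost_le hI) fun s hs => ⟨?_, fun q => I.smoothed.potential u
        (I.smoothed.nextZ (s.real 6) (s.real 7) ((1 - I.smoothed.τ) ^ (k + 1)) q)
        (I.smoothed.nextR (s.real 6) (s.real 7) ((1 - I.smoothed.τ) ^ (k + 1)) q)
        ((1 - I.smoothed.τ) ^ (k + 1)), ?_, fun q hq => ?_⟩
    · have := hI.Q_pos
      simp only [NExpr.eval, eval_nvar, hs.setup.Q]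
      omega
    · have hk' := hT k hk
      rw [pow_succ] at hk' ⊢
      exact hD.potential_step (by positivity) hk' hs.inv.1 hu
    · have h1 := ends_coordStep hI (by positivity : 0 < (1 - I.smoothed.τ) ^ k) hs hq
      simp only [← pow_succ] at h1
      exact h1.imp le_rfl fun s' ⟨h2, h3, h4⟩ => ⟨h2, by rw [h3, h4]⟩

/-- The memory between two runs, before round `r`. -/
structure RoundState (I : Inst) (r : ℕ) (s : State) : Prop where
  setup : Setup I s
  round : s.nat 15 0 = r
  blank : ∀ i, s.real 2 i = 0
  zeroR : ∀ q, s.real 7 q = 0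
  loadZ : ∀ j < I.m, s.real 8 j = I.smoothed.load (s.real 6) j
  loadR : ∀ j < I.m, s.real 9 j = 0
  inBox : I.smoothed.InBox (s.real 6)

theorem load_zero (D : Smoothed) (j : ℕ) : D.load (fun _ => 0) j = 0 := by
  simp [Smoothed.load]

theorem ends_startRun {I : Inst} {r : ℕ} {s : State} (hs : RoundState I r s) :
    Ends (.setReal 14 (.const 0) (.const 1)) s 3 fun s' => RunState I r 1 s' ∧
      s'.real 6 = s.real 6 ∧ s'.real 7 = fun _ => 0 := by
  refine (Cmd.Straight.ends' (P := .setReal 14 (.const 0) (.const 1)) trivial ?_).imp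
    (by decide) fun _ h => h
  have hn : NatEq [] s ((Cmd.setReal 14 (.const 0) (.const 1)).exec s) := fun a _ => rfl
  have hr : RealEq [14] s ((Cmd.setReal 14 (.const 0) (.const 1)).exec s) := fun a ha => by
    simp only [List.mem_singleton] at ha
    simp [exec_setReal, ha]
  have hR : s.real 7 = fun _ => 0 := funext hs.zeroR
  refine ⟨⟨hs.setup.congr hn hr, ?_, hs.round, fun i => ?_, fun q _ => ?_, fun j hj => ?_,
    fun j hj => ?_, ?_⟩, hr 6 (by decide), ?_⟩
  · simp [exec_setReal, NExpr.eval, RExpr.eval]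
  · rw [hr 2 (by decide), hs.blank]
  · rw [hr 7 (by decide), hs.zeroR]
  · rw [hr 8 (by decide), hr 6 (by decide), hs.loadZ j hj]
  · rw [hr 9 (by decide), hr 7 (by decide), hs.loadR j hj, hR, load_zero]
  · rw [hr 6 (by decide), hr 7 (by decide), hR]
    exact hs.inBox.runInv
  · rw [hr 7 (by decide), hR]

/-- The new starting point is the averaged iterate `z - s R`. -/
theorem ends_restart {I : Inst} {r : ℕ} {σ : ℝ} {s : State} (hσ : 0 < σ)
    (hs : RunState I r σ s) :
    Ends restart s ((I.Q + 1) * 50 + (I.m + 1) * 50 + 50) fun s' => RoundState I (r + 1) s' ∧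
      s'.real 6 = Smoothed.point (s.real 6) (s.real 7) σ := by
  -- the loop over the variables
  have h1 : Ends (.setNat 13 (.const 0) (.const 0)) s 3 fun s' =>
      NatEq [13] s s' ∧ RealEq [6, 7] s s' ∧ s'.nat 13 0 = 0 ∧
      (∀ q, s'.real 6 q = if q < 0 then Smoothed.point (s.real 6) (s.real 7) σ q else s.real 6 q) ∧
      ∀ q, s'.real 7 q = if q < 0 then 0 else s.real 7 q := by
    refine (Cmd.Straight.ends' (P := .setNat 13 (.const 0) (.const 0)) trivial ?_).imp
      (by decide) fun _ h => h
    refine ⟨fun a ha => ?_, fun a _ => rfl, ?_, ?_, ?_⟩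
    · simp only [List.mem_singleton] at ha
      simp [exec_setNat, ha]
    · simp [exec_setNat, NExpr.eval]
    · simp [exec_setNat]
    · simp [exec_setNat]
  refine (h1.seq (l := (I.Q + 1) * 50 + (I.m + 1) * 50 + 45) fun s1 hs1 => ?_).imp (by omega)
    fun _ h => h
  refine ((Ends.loop_const (fun t s' => NatEq [13] s s' ∧ RealEq [6, 7] s s' ∧ s'.nat 13 0 = t ∧
      (∀ q, s'.real 6 q = if q < t then Smoothed.point (s.real 6) (s.real 7) σ q else s.real 6 q) ∧
      ∀ q, s'.real 7 q = if q < t then 0 else s.real 7 q) I.Q 40 ?_ ?_ hs1).seq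
      (l := (I.m + 1) * 50 + 44) fun s2 hs2 => ?_).imp ?_ fun _ h => h
  · rintro t ht s2 ⟨a1, a2, a3, a4, a5⟩
    have w2 : s2.real 14 0 = σ := by rw [a2 14 (by decide), hs.weight]
    constructor
    · change s2.nat 13 0 < s2.nat 11 0
      rw [a3, a1 11 (by decide), hs.setup.Q]
      exact ht
    · refine (Cmd.Straight.ends' ?_ ?_).imp (by decide) fun _ h => h
      · simp [Cmd.block, Cmd.Straight, incr]
      · refine ⟨fun a ha => ?_, fun a ha => ?_, ?_, fun q => ?_, fun q => ?_⟩
        · have ha' := ha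
          simp only [List.mem_singleton] at ha
          simp [exec_block_cons, exec_block_nil, exec_setReal, exec_incr, ha, a1 a ha']
        · have ha' := ha
          simp only [List.mem_cons, not_or] at ha
          simp [exec_block_cons, exec_block_nil, exec_setReal, exec_incr, ha, a2 a ha']
        · simp [exec_block_cons, exec_block_nil, exec_setReal, exec_incr, a3]
        · simp only [exec_block_cons, exec_block_nil, exec_setReal, exec_incr,
            RExpr.eval, eval_nvar, eval_rvar, a3, w2, real_writeNat, real_writeReal_self, ne_eq,
            Nat.reduceEqDiff, not_false_eq_true, real_writeReal_ne, Function.update_apply, a4, a5,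
            lt_irrefl, if_false]
          rcases lt_trichotomy q t with h | h | h
          · simp [h, h.ne, h.trans (Nat.lt_succ_self t)]
          · simp [h, Smoothed.point]
          · have h' : ¬ q < t + 1 := by omega
            simp [h.ne', h', h.not_gt]
        · simp only [exec_block_cons, exec_block_nil, exec_setReal, exec_incr,
            RExpr.eval, eval_nvar, a3, real_writeNat, real_writeReal_self, ne_eq, nat_writeReal,
            Nat.reduceEqDiff, not_false_eq_true, real_writeReal_ne, Function.update_apply, a5]
          rcases lt_trichotomy q t with h | h | h
          · simp [h, h.ne, h.trans (Nat.lt_succ_self t)]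
          · simp [h]
          · have h' : ¬ q < t + 1 := by omega
            simp [h.ne', h', h.not_gt]
  · rintro s2 ⟨a1, a2, a3, a4, a5⟩
    change ¬ s2.nat 13 0 < s2.nat 11 0
    rw [a3, a1 11 (by decide), hs.setup.Q]
    omega
  -- the loop over the rows
  · obtain ⟨a1, a2, -, a4, a5⟩ := hs2
    have w2 : s2.real 14 0 = σ := by rw [a2 14 (by decide), hs.weight]
    have h3 : Ends (.setNat 8 (.const 0) (.const 0)) s2 3 fun s' =>
        NatEq [8] s2 s' ∧ RealEq [8, 9] s2 s' ∧ s'.nat 8 0 = 0 ∧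
        (∀ j, s'.real 8 j = if j < 0 then s.real 8 j - σ * s.real 9 j else s.real 8 j) ∧
        ∀ j, s'.real 9 j = if j < 0 then 0 else s.real 9 j := by
      refine (Cmd.Straight.ends' (P := .setNat 8 (.const 0) (.const 0)) trivial ?_).imp
        (by decide) fun _ h => h
      refine ⟨fun a ha => ?_, fun a _ => rfl, ?_, ?_, ?_⟩
      · simp only [List.mem_singleton] at ha
        simp [exec_setNat, ha]
      · simp [exec_setNat, NExpr.eval]
      · simp [exec_setNat, a2 8 (by decide)]
      · simp [exec_setNat, a2 9 (by decide)]
    refine (h3.seq (l := (I.m + 1) * 50 + 40) fun s3 hs3 => ?_).imp (by omega) fun _ h => h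
    refine ((Ends.loop_const (fun t s' => NatEq [8] s2 s' ∧ RealEq [8, 9] s2 s' ∧ s'.nat 8 0 = t ∧
        (∀ j, s'.real 8 j = if j < t then s.real 8 j - σ * s.real 9 j else s.real 8 j) ∧
        ∀ j, s'.real 9 j = if j < t then 0 else s.real 9 j) I.m 40 ?_ ?_ hs3).seq
        (l := 10) fun s4 hs4 => ?_).imp ?_ fun _ h => h
    · rintro t ht s3 ⟨b1, b2, b3, b4, b5⟩
      have w3 : s3.real 14 0 = σ := by rw [b2 14 (by decide), w2]
      constructor
      · change s3.nat 8 0 < s3.nat 0 0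
        rw [b3, b1 0 (by decide), a1 0 (by decide), hs.setup.m]
        exact ht
      · refine (Cmd.Straight.ends' ?_ ?_).imp (by decide) fun _ h => h
        · simp [Cmd.block, Cmd.Straight, incr]
        · refine ⟨fun a ha => ?_, fun a ha => ?_, ?_, fun q => ?_, fun q => ?_⟩
          · have ha' := ha
            simp only [List.mem_singleton] at ha
            simp [exec_block_cons, exec_block_nil, exec_setReal, exec_incr, ha, b1 a ha']
          · have ha' := ha
            simp only [List.mem_cons, not_or] at ha
            simp [exec_block_cons, exec_block_nil, exec_setReal, exec_incr, ha, b2 a ha']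
          · simp [exec_block_cons, exec_block_nil, exec_setReal, exec_incr, b3]
          · simp only [exec_block_cons, exec_block_nil, exec_setReal, exec_incr,
              RExpr.eval, eval_nvar, eval_rvar, b3, w3, real_writeNat, real_writeReal_self, ne_eq,
              Nat.reduceEqDiff, not_false_eq_true, real_writeReal_ne, Function.update_apply, b4,
              b5, lt_irrefl, if_false]
            rcases lt_trichotomy q t with h | h | h
            · simp [h, h.ne, h.trans (Nat.lt_succ_self t)]
            · simp [h]
            · have h' : ¬ q < t + 1 := by omega
              simp [h.ne', h', h.not_gt]
          · simp only [exec_block_cons, exec_block_nil, exec_setReal, exec_incr,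
              RExpr.eval, eval_nvar, b3, real_writeNat, real_writeReal_self, ne_eq, nat_writeReal,
              Nat.reduceEqDiff, not_false_eq_true, real_writeReal_ne, Function.update_apply, b5]
            rcases lt_trichotomy q t with h | h | h
            · simp [h, h.ne, h.trans (Nat.lt_succ_self t)]
            · simp [h]
            · have h' : ¬ q < t + 1 := by omega
              simp [h.ne', h', h.not_gt]
    · rintro s3 ⟨b1, b2, b3, b4, b5⟩
      change ¬ s3.nat 8 0 < s3.nat 0 0
      rw [b3, b1 0 (by decide), a1 0 (by decide), hs.setup.m]
      omega
    · obtain ⟨b1, b2, -, b4, b5⟩ := hs4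
      refine (Cmd.Straight.ends' (P := incr 15) trivial ?_).imp (by decide) fun _ h => h
      have c1 : NatEq [15] s4 ((incr 15).exec s4) := fun a ha => by
        simp only [List.mem_singleton] at ha
        simp [exec_incr, ha]
      have c2 : RealEq [] s4 ((incr 15).exec s4) := fun a _ => rfl
      have nn : NatEq [13, 8, 15] s ((incr 15).exec s4) := (a1.trans b1).trans c1
      have rr : RealEq [6, 7, 8, 9] s ((incr 15).exec s4) := (a2.trans b2).trans c2
      have z4 : ((incr 15).exec s4).real 6 = Smoothed.point (s.real 6) (s.real 7) σ := by
        funext q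
        rw [c2 6 (by decide), b2 6 (by decide), a4]
        split_ifs with h
        · rfl
        · rw [Smoothed.point, hs.tail q (by omega)]; ring
      refine ⟨⟨hs.setup.congr nn rr, ?_, fun i => ?_, fun q => ?_, fun j hj => ?_, fun j hj => ?_,
        ?_⟩, z4⟩
      · rw [exec_incr]
        simp [b1 15 (by decide), a1 15 (by decide), hs.round]
      · rw [rr 2 (by decide), hs.blank]
      · rw [c2 7 (by decide), b2 7 (by decide), a5]
        split_ifs with h
        · rfl
        · exact hs.tail q (by omega)
      · rw [z4, c2 8 (by decide), b4, if_pos hj, load_point, hs.loadZ j hj, hs.loadR j hj]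
      · rw [c2 9 (by decide), b5, if_pos hj]
      · rw [z4]
        exact hs.inv.point_inBox hσ.le
    · have : (BExpr.natLt (nvar 8) (.get 0 (.const 0))).cost = 5 := rfl
      rw [this]
      omega
  · have : (BExpr.natLt (nvar 13) (nvar 11)).cost = 5 := rfl
    rw [this]
    omega

/-- One run: the expected objective afterwards. -/
theorem bounds_run {I : Inst} (hI : I.OK) (r : ℕ) {u : ℕ → ℝ} (hu : I.smoothed.InBox u)
    (hobj : 0 ≤ I.smoothed.obj u) {T : ℕ}
    (hT : ∀ k < T, 1 ≤ I.smoothed.L * (1 - I.smoothed.τ) ^ (k + 1))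
    (hT' : I.smoothed.L * (1 - I.smoothed.τ) ^ (T + 1) < 1) :
    Bounds descentRun (RoundState I r) (RoundState I (r + 1))
      ((T + 1) * stepCost I + ((I.Q + I.m + 4) * 50 : ℕ))
      (fun s => I.smoothed.obj u +
        5 / 4 * (1 - I.smoothed.τ) ^ T * I.smoothed.obj (s.real 6))
      (fun s => I.smoothed.obj (s.real 6)) := by
  have hD := hI.valid
  have hτ1 := hD.τ_le
  set σ := (1 - I.smoothed.τ) ^ T with hσ
  have hσ0 : 0 < σ := pow_pos (by linarith) _
  have h1 : Bounds (.setReal 14 (.const 0) (.const 1)) (RoundState I r) (RunState I r 1) (3 : ℕ)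
      (fun s => I.smoothed.obj u + 5 / 4 * σ * I.smoothed.obj (s.real 6))
      (fun s => I.smoothed.obj u + σ / 2 * I.smoothed.potential u (s.real 6) (s.real 7) 1) :=
    Bounds.of_ends fun s hs => (ends_startRun hs).imp le_rfl fun s' ⟨a1, a2, a3⟩ => ⟨a1, by
      rw [a2, a3]
      exact hD.potential_start hs.inBox hu hσ0.le hobj⟩
  have h2 := (bounds_steps hI r hu hT hT').affine (σ / 2) (I.smoothed.obj u) (by positivity)
  have h3 : Bounds restart (RunState I r σ) (RoundState I (r + 1))
      (((I.Q + 1) * 50 + (I.m + 1) * 50 + 50 : ℕ) : ℝ≥0∞)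
      (fun s => I.smoothed.obj u + σ / 2 * I.smoothed.potential u (s.real 6) (s.real 7) σ)
      (fun s => I.smoothed.obj (s.real 6)) :=
    Bounds.of_ends fun s hs => (ends_restart hσ0 hs).imp le_rfl fun s' ⟨a1, a2⟩ => ⟨a1, by
      rw [a2]
      exact hD.obj_le_potential hσ0⟩
  refine (h1.seq (h2.seq h3)).imp (fun _ h => h) (fun _ h => h) ?_ (fun _ _ => le_rfl)
    (fun _ _ => le_rfl)
  have h4 : (((3 : ℕ) : ℝ≥0∞) + ((T + 1) * stepCost I +
      (((I.Q + 1) * 50 + (I.m + 1) * 50 + 50 : ℕ) : ℝ≥0∞) + 1) + 1) =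
      (T + 1) * stepCost I + (((3 + ((I.Q + 1) * 50 + (I.m + 1) * 50 + 50) + 1 + 1 : ℕ)) : ℝ≥0∞) := by
    push_cast; ring
  rw [h4]
  gcongr
  omega

end Covering

/-! ### All runs, and the output -/

namespace Covering

open RealRAM Finset

/-- All runs: iteration of the affine bound of a single run. -/
theorem bounds_rounds {I : Inst} (hI : I.OK) {u : ℕ → ℝ} (hu : I.smoothed.InBox u)
    (hobj : 0 ≤ I.smoothed.obj u) {T : ℕ}
    (hT : ∀ k < T, 1 ≤ I.smoothed.L * (1 - I.smoothed.τ) ^ (k + 1))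
    (hT' : I.smoothed.L * (1 - I.smoothed.τ) ^ (T + 1) < 1) :
    Bounds (.loop (.natLt (nvar 15) (nvar 12)) descentRun) (RoundState I 0) (RoundState I I.lam)
      ((I.lam + 1) * ((T + 1) * stepCost I + ((I.Q + I.m + 5) * 50 : ℕ)))
      (fun s => I.smoothed.obj u * ∑ i ∈ range I.lam, (5 / 4 * (1 - I.smoothed.τ) ^ T) ^ i +
        (5 / 4 * (1 - I.smoothed.τ) ^ T) ^ I.lam * I.smoothed.obj (s.real 6))
      (fun s => I.smoothed.obj (s.real 6)) := by
  have hτ1 := hI.valid.τ_le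
  set σ := 5 / 4 * (1 - I.smoothed.τ) ^ T with hσ
  have hσ0 : 0 ≤ σ := mul_nonneg (by norm_num) (pow_nonneg (by linarith) _)
  have h := Bounds.loop (b := .natLt (nvar 15) (nvar 12)) (P := descentRun) (RoundState I)
    (fun r s => I.smoothed.obj u * ∑ i ∈ range (I.lam - r), σ ^ i +
      σ ^ (I.lam - r) * I.smoothed.obj (s.real 6)) I.lam
    (c := (T + 1) * stepCost I + ((I.Q + I.m + 4) * 50 : ℕ)) ?_ ?_ ?_
  · refine h.imp (fun _ h => h) (fun _ h => h) ?_ (fun _ _ => by simp) (fun _ _ => by simp)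
    refine mul_le_mul' le_rfl ?_
    have h2 : (BExpr.natLt (nvar 15) (nvar 12)).cost = 5 := rfl
    rw [h2, add_assoc, add_assoc]
    refine add_le_add le_rfl ?_
    have h3 : (I.Q + I.m + 4) * 50 + (5 + 1) ≤ (I.Q + I.m + 5) * 50 := by omega
    calc (((I.Q + I.m + 4) * 50 : ℕ) : ℝ≥0∞) + (((5 : ℕ) : ℝ≥0∞) + 1)
        = (((I.Q + I.m + 4) * 50 + (5 + 1) : ℕ) : ℝ≥0∞) := by push_cast; ring
      _ ≤ _ := Nat.cast_le.2 h3
  · intro r hr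
    have h1 := (bounds_run hI r hu hobj hT hT').affine (σ ^ (I.lam - (r + 1)))
      (I.smoothed.obj u * ∑ i ∈ range (I.lam - (r + 1)), σ ^ i) (by positivity)
    refine h1.imp (fun _ h => h) (fun _ h => h) le_rfl (fun s _ => le_of_eq ?_) (fun _ _ => le_rfl)
    obtain ⟨d, hd⟩ : ∃ d, I.lam - r = d + 1 := ⟨I.lam - r - 1, by omega⟩
    have hd' : I.lam - (r + 1) = d := by omega
    rw [hd, hd', sum_range_succ, pow_succ, hσ]
    ring
  · intro r hr s hs
    change s.nat 15 0 < s.nat 12 0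
    rw [hs.round, hs.setup.lam]
    exact hr
  · intro s hs
    change ¬ s.nat 15 0 < s.nat 12 0
    rw [hs.round, hs.setup.lam]
    omega

theorem geom_le {σ : ℝ} (h0 : 0 ≤ σ) (h1 : σ ≤ 1 / 2) (n : ℕ) :
    ∑ i ∈ range n, σ ^ i ≤ 1 + 2 * σ := by
  induction n with
  | zero => simp; linarith
  | succ n ih =>
    rw [sum_range_succ']
    have e : ∑ k ∈ range n, σ ^ (k + 1) = σ * ∑ k ∈ range n, σ ^ k := by
      rw [mul_sum]; exact sum_congr rfl fun k _ => by ring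
    rw [e, pow_zero]
    nlinarith

/-- After all runs, the expected objective is nearly optimal. -/
theorem initial_value_le {I : Inst} (hI : I.OK) {o : ℝ} (ho : I.IsOpt o) {u : ℕ → ℝ}
    (hu : I.smoothed.obj u ≤ (1 + 6 * I.ε) * o) {T : ℕ}
    (hT' : I.smoothed.L * (1 - I.smoothed.τ) ^ (T + 1) < 1) :
    I.smoothed.obj u * ∑ i ∈ range I.lam, (5 / 4 * (1 - I.smoothed.τ) ^ T) ^ i +
        (5 / 4 * (1 - I.smoothed.τ) ^ T) ^ I.lam * I.smoothed.obj I.smoothed.box ≤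
      (1 + 11 * I.ε) * o := by
  have hD := hI.valid
  have hτ1 := hD.τ_le
  have hε := hI.ε_pos
  have hε1 := hI.ε_le
  have ho0 := hI.opt_pos ho
  have hvo := hI.v_le ho
  have hlam : (1 : ℝ) ≤ I.lam := by exact_mod_cast hI.lam_pos
  have hm : (I.m : ℝ) ≤ I.N := by exact_mod_cast hI.m_le
  have hμε : I.smoothed.μ ≤ I.ε := by
    have : I.smoothed.μ = I.ε / (32 * I.lam) := rfl
    rw [this]
    exact div_le_self hε.le (by linarith)
  set σ := 5 / 4 * (1 - I.smoothed.τ) ^ T with hσ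
  have hσ0 : 0 ≤ σ := mul_nonneg (by norm_num) (pow_nonneg (by linarith) _)
  -- a run ends with `(1 - τ) ^ T` of order `1 / L = μ / 16`
  have hσ1 : σ ≤ I.ε / 12 := by
    have h1 : 0 ≤ (1 - I.smoothed.τ) ^ T := pow_nonneg (by linarith) _
    have h2 : I.smoothed.L * ((1 - I.smoothed.τ) ^ T * (31 / 32)) < 1 := by
      refine lt_of_le_of_lt ?_ hT'
      rw [pow_succ]
      have := hD.L_pos
      gcongr
      linarith
    have h3 : (1 - I.smoothed.τ) ^ T * (31 / 32) < I.smoothed.μ / 16 := by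
      have h4 : I.smoothed.L = 16 / I.smoothed.μ := rfl
      have h5 := hD.μ_pos
      rw [h4, div_mul_eq_mul_div, div_lt_one h5] at h2
      linarith
    linarith
  have hgeom := geom_le hσ0 (by linarith) I.lam
  have h1 : I.smoothed.obj u * ∑ i ∈ range I.lam, σ ^ i ≤
      (1 + 6 * I.ε) * o * (1 + 2 * (I.ε / 12)) := by
    apply mul_le_mul hu (by linarith) (sum_nonneg fun i _ => pow_nonneg hσ0 i) (by positivity)
  have hbox0 : 0 ≤ I.smoothed.obj I.smoothed.box :=
    ho0.le.trans (hI.opt_le_obj ho fun q hq => (hD.box_pos hq).le)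
  have hbox : I.smoothed.obj I.smoothed.box ≤ 9 * (I.N : ℝ) ^ 2 * o := by
    refine hI.obj_box_le.trans ?_
    have : I.v ≤ I.N * o := hvo.trans (by gcongr)
    calc 9 * I.N * I.v ≤ 9 * I.N * (I.N * o) := by gcongr
      _ = 9 * (I.N : ℝ) ^ 2 * o := by ring
  -- `σ ≤ 1 / 4`, and `2 ^ lam` exceeds the starting objective in units of `ε * o`
  have h2 : σ ^ I.lam ≤ (1 / 2) ^ I.lam * (1 / 2) ^ I.lam := by
    rw [← mul_pow]
    exact pow_le_pow_left₀ hσ0 (by linarith) _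
  have h3 : ((1 : ℝ) / 2) ^ I.lam ≤ 1 / 2 := by
    calc ((1 : ℝ) / 2) ^ I.lam ≤ (1 / 2) ^ 1 :=
          pow_le_pow_of_le_one (by norm_num) (by norm_num) hI.lam_pos
      _ = 1 / 2 := by norm_num
  have h4 : ((1 : ℝ) / 2) ^ I.lam * (2 * (I.N : ℝ) ^ 2) ≤ I.ε := by
    rw [div_pow, one_pow, div_mul_eq_mul_div, div_le_iff₀ (by positivity), one_mul]
    linarith [hI.lam_large]
  have h5 : σ ^ I.lam * I.smoothed.obj I.smoothed.box ≤
      (1 / 2) ^ I.lam * (1 / 2) * (9 * (I.N : ℝ) ^ 2 * o) := by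
    apply mul_le_mul (h2.trans (by gcongr)) hbox hbox0 (by positivity)
  have h6 : (1 / 2) ^ I.lam * (1 / 2) * (9 * (I.N : ℝ) ^ 2 * o) ≤ 9 / 4 * (I.ε * o) := by
    have := mul_le_mul_of_nonneg_right h4 ho0.le
    linarith
  have h7 : I.ε * I.ε * o ≤ 1 * I.ε * o := by gcongr
  have h8 : 0 < I.ε * o := by positivity
  linarith

/-- The output is the averaged iterate, divided by its smallest row value `w`. -/
theorem ends_finish {I : Inst} {s : State} (hI : I.OK) (hs : RoundState I I.lam s) :
    Ends finish s ((I.m + 1) * 50 + (I.Q + 1) * 50 + 50) fun s' => ∃ w,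
      (∀ j < I.m, w ≤ I.smoothed.load (s.real 6) j) ∧
      (∃ j < I.m, w = I.smoothed.load (s.real 6) j) ∧
      ∀ i, s'.real 2 i = I.out (s.real 6) w i := by
  classical
  have h1 : Ends (.block [.setReal 18 (.const 0) (.get 8 (.const 0)),
      .setNat 8 (.const 0) (.const 0)]) s 20 fun s' => NatEq [8] s s' ∧ RealEq [18] s s' ∧
      s'.nat 8 0 = 0 ∧ (∀ j < 0, s'.real 18 0 ≤ s.real 8 j) ∧
      ∃ j < I.m, s'.real 18 0 = s.real 8 j := by
    refine (Cmd.Straight.ends' ?_ ?_).imp (by decide) fun _ h => h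
    · simp [Cmd.block, Cmd.Straight]
    · refine ⟨fun a ha => ?_, fun a ha => ?_, ?_, ?_, 0, hI.m_pos, ?_⟩
      · simp only [List.mem_singleton] at ha
        simp [exec_block_cons, exec_block_nil, exec_setReal, exec_setNat, ha]
      · simp only [List.mem_singleton] at ha
        simp [exec_block_cons, exec_block_nil, exec_setReal, exec_setNat, ha]
      · simp [exec_block_cons, exec_block_nil, exec_setReal, exec_setNat, NExpr.eval]
      · simp
      · simp [exec_block_cons, exec_block_nil, exec_setReal, exec_setNat, NExpr.eval, RExpr.eval]
  refine (h1.seq (l := (I.m + 1) * 50 + (I.Q + 1) * 50 + 25) fun s1 hs1 => ?_).imp (by omega)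
    fun _ h => h
  refine ((Ends.loop_const (fun t s' => NatEq [8] s s' ∧ RealEq [18] s s' ∧
      s'.nat 8 0 = t ∧ (∀ j < t, s'.real 18 0 ≤ s.real 8 j) ∧
      ∃ j < I.m, s'.real 18 0 = s.real 8 j) I.m 40 ?_ ?_ hs1).seq
      (l := (I.Q + 1) * 50 + 20) fun s2 hs2 => ?_).imp ?_ fun _ h => h
  · rintro t ht s2 ⟨a1, a2, a3, a4, j, hj, a5⟩
    constructor
    · change s2.nat 8 0 < s2.nat 0 0
      rw [a3, a1 0 (by decide), hs.setup.m]
      exact ht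
    · refine (Cmd.Straight.ends' ?_ ?_).imp (by decide) fun _ h => h
      · simp [Cmd.block, Cmd.Straight, incr, Cmd.condReal]
      · have e : (Cmd.block [.condReal (.realLt (.get 8 (nvar 8)) (rvar 18)) 18 (.const 0)
            (.get 8 (nvar 8)) (rvar 18), incr 8]).exec s2 =
            (s2.writeReal 18 0 (min (s.real 8 t) (s2.real 18 0))).writeNat 8 0 (t + 1) := by
          simp only [exec_block_cons, exec_block_nil, exec_condReal, exec_incr, NExpr.eval,
            RExpr.eval, eval_nvar, eval_rvar, a3, BExpr.Holds, nat_writeReal, a2 8 (by decide)]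
          congr 2
          split_ifs with h
          · rw [min_eq_left h.le]
          · rw [min_eq_right (not_lt.1 h)]
        rw [e]
        refine ⟨fun a ha => ?_, fun a ha => ?_, ?_, fun j hj => ?_, ?_⟩
        · have ha' := ha
          simp only [List.mem_singleton] at ha
          simp [ha, a1 a ha']
        · have ha' := ha
          simp only [List.mem_singleton] at ha
          simp [ha, a2 a ha']
        · simp
        · simp only [real_writeNat, real_writeReal_self, Function.update_self]
          rcases Nat.lt_succ_iff_lt_or_eq.1 hj with h | h
          · exact (min_le_right _ _).trans (a4 j h)
          · rw [h]; exact min_le_left _ _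
        · simp only [real_writeNat, real_writeReal_self, Function.update_self]
          rcases min_choice (s.real 8 t) (s2.real 18 0) with h | h
          · exact ⟨t, ht, h⟩
          · exact ⟨j, hj, h.trans a5⟩
  · rintro s2 ⟨a1, -, a3, -, -⟩
    change ¬ s2.nat 8 0 < s2.nat 0 0
    rw [a3, a1 0 (by decide), hs.setup.m]
    omega
  · obtain ⟨a1, a2, -, a4, j, hj, a5⟩ := hs2
    set w := s2.real 18 0 with hw
    have S2 : Setup I s2 := hs.setup.congr a1 a2
    have h2 : Ends (.setNat 13 (.const 0) (.const 0)) s2 3 fun s' => NatEq [13] s2 s' ∧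
        RealEq [2] s2 s' ∧ s'.nat 13 0 = 0 ∧ ∀ i, s'.real 2 i =
          ∑ q ∈ range 0, if I.own q = i then s.real 6 q / w else 0 := by
      refine (Cmd.Straight.ends' (P := .setNat 13 (.const 0) (.const 0)) trivial ?_).imp
        (by decide) fun _ h => h
      refine ⟨fun a ha => ?_, fun a _ => rfl, ?_, fun i => ?_⟩
      · simp only [List.mem_singleton] at ha
        simp [exec_setNat, ha]
      · simp [exec_setNat, NExpr.eval]
      · simp [exec_setNat, a2 2 (by decide), hs.blank]
    refine (h2.seq (l := (I.Q + 1) * 50) fun s3 hs3 => ?_).imp (by omega) fun _ h => h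
    refine (Ends.loop_const (fun t s' => NatEq [13] s2 s' ∧
        RealEq [2] s2 s' ∧ s'.nat 13 0 = t ∧ ∀ i, s'.real 2 i =
          ∑ q ∈ range t, if I.own q = i then s.real 6 q / w else 0) I.Q 40 ?_ ?_ hs3).imp ?_ ?_
    · rintro t ht s3 ⟨b1, b2, b3, b4⟩
      constructor
      · change s3.nat 13 0 < s3.nat 11 0
        rw [b3, b1 11 (by decide), S2.Q]
        exact ht
      · refine (Cmd.Straight.ends' ?_ ?_).imp (by decide) fun _ h => h
        · simp [Cmd.block, Cmd.Straight, incr]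
        · refine ⟨fun a ha => ?_, fun a ha => ?_, ?_, fun i => ?_⟩
          · have ha' := ha
            simp only [List.mem_singleton] at ha
            simp [exec_block_cons, exec_block_nil, exec_setReal, exec_incr, ha, b1 a ha']
          · have ha' := ha
            simp only [List.mem_singleton] at ha
            simp [exec_block_cons, exec_block_nil, exec_setReal, exec_incr, ha, b2 a ha']
          · simp [exec_block_cons, exec_block_nil, exec_setReal, exec_incr, b3]
          · simp only [exec_block_cons, exec_block_nil, exec_setReal, exec_incr, NExpr.eval,
              RExpr.eval, eval_nvar, eval_rvar, b3, real_writeNat, real_writeReal_self,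
              Function.update_apply, b4, b2 6 (by decide), b2 18 (by decide), a2 6 (by decide),
              b1 10 (by decide), S2.own t ht, sum_range_succ, ← hw]
            by_cases h : i = I.own t
            · simp [h]
            · simp [h, Ne.symm h]
    · rintro s3 ⟨b1, -, b3, -⟩
      change ¬ s3.nat 13 0 < s3.nat 11 0
      rw [b3, b1 11 (by decide), S2.Q]
      omega
    · have : (BExpr.natLt (nvar 13) (nvar 11)).cost = 5 := rfl
      rw [this]
      omega
    · rintro s4 ⟨-, -, -, b4⟩
      exact ⟨w, fun j' hj' => by rw [← hs.loadZ j' hj']; exact a4 j' hj',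
        ⟨j, hj, by rw [← hs.loadZ j hj]; exact a5⟩, b4⟩
  · have : (BExpr.natLt (nvar 8) (.get 0 (.const 0))).cost = 5 := rfl
    rw [this]
    omega

/-- The probability that a memory in which the expected objective is small leads to a good output, by
Markov's inequality for the nonnegative quantity `obj - o`. -/
theorem markov {p f o ε : ℝ} {V : ℝ≥0∞} (ho : 0 < o) (hε : 0 < ε) (hf : o ≤ f)
    (hV : f ≤ (1 + 110 * ε) * o → 1 ≤ V) (hp : p = 110 * ε * o) :
    ENNReal.ofReal ((1 + o / p) - 1 / p * f) ≤ V := by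
  have hp0 : 0 < p := by rw [hp]; positivity
  have e : (1 + o / p) - 1 / p * f = 1 - (f - o) / p := by ring
  rw [e]
  by_cases h : f ≤ (1 + 110 * ε) * o
  · refine le_trans ?_ (hV h)
    rw [ENNReal.ofReal_le_one]
    have : 0 ≤ (f - o) / p := div_nonneg (by linarith) hp0.le
    linarith
  · rw [ENNReal.ofReal_of_nonpos]
    · exact bot_le
    · have : 1 ≤ (f - o) / p := by
        rw [le_div_iff₀ hp0]
        push Not at h
        rw [hp]
        linarith
      linarith

end Covering

/-! ### The preparation -/

namespace RealRAM

theorem Ends.exists_state {P : Cmd} {s : State} {k : ℕ} {Q : State → Prop} (h : Ends P s k Q) :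
    ∃ s', Q s' ∧ Ends P s k (fun t => t = s') := by
  obtain ⟨s', h1, h2⟩ := h
  exact ⟨s', h1, s', rfl, h2⟩

end RealRAM

namespace Covering

open RealRAM Finset

/-- The properties of the input data. -/
structure RawOK (m n N : ℕ) (row col : ℕ → ℕ) (val : ℕ → ℝ) (ε : ℝ) : Prop where
  m_pos : 0 < m
  row_lt : ∀ k < N, row k < m
  col_lt : ∀ k < N, col k < n
  val_pos : ∀ k < N, 0 < val k
  inj : ∀ k < N, ∀ k' < N, row k = row k' → col k = col k' → k = k'
  surj : ∀ j < m, ∃ k < N, row k = j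
  ε_pos : 0 < ε
  ε_le : ε ≤ 1

/-- The memory at the beginning. -/
structure RawState (m N : ℕ) (row col : ℕ → ℕ) (val : ℕ → ℝ) (ε : ℝ) (s : State) : Prop where
  m : s.nat 0 0 = m
  N : s.nat 0 2 = N
  row : s.nat 1 = row
  col : s.nat 2 = col
  val : s.real 0 = val
  ε : s.real 1 0 = ε
  nat_zero : ∀ a, 3 ≤ a → ∀ i, s.nat a i = 0
  real_zero : ∀ a, 2 ≤ a → ∀ i, s.real a i = 0

/-- The memory after the first `K` entries have been read. -/
structure ReadState (row col : ℕ → ℕ) (val : ℕ → ℝ) (s₀ : State) (K : ℕ) (s : State) :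
    Prop where
  nat_eq : NatEq [3, 4, 5, 6, 7] s₀ s
  real_eq : RealEq [3] s₀ s
  count : s.nat 3 0 = K
  head : ∀ i, s.nat 4 i = last col K i
  link : ∀ k < K, s.nat 5 k = last col k (col k)
  cols_mem : ∀ i < s.nat 7 0, ∃ k < K, col k = s.nat 6 i
  cols_surj : ∀ k < K, ∃ i < s.nat 7 0, s.nat 6 i = col k
  cols_inj : ∀ i < s.nat 7 0, ∀ i' < s.nat 7 0, s.nat 6 i = s.nat 6 i' → i = i'
  le_max : ∀ k < K, val k ≤ s.real 3 (row k)
  max_mem : ∀ j, s.real 3 j = 0 ∨ ∃ k < K, row k = j ∧ s.real 3 j = val k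

theorem readEntry_step {m N : ℕ} {row col : ℕ → ℕ} {val : ℕ → ℝ} {ε : ℝ} {s₀ s : State} {K : ℕ}
    (h₀ : RawState m N row col val ε s₀) (h : ReadState row col val s₀ K s) :
    Ends readEntry s 200 (ReadState row col val s₀ (K + 1)) := by
  classical
  refine (Cmd.Straight.ends' (P := readEntry) ?_ ?_).imp (by decide) fun _ h => h
  · simp [readEntry, Cmd.block, Cmd.Straight, Cmd.condReal, Cmd.condNat, incr]
  · have hrow : s.nat 1 = row := by rw [h.nat_eq 1 (by decide), h₀.row]
    have hcol : s.nat 2 = col := by rw [h.nat_eq 2 (by decide), h₀.col]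
    have hval : s.real 0 = val := by rw [h.real_eq 0 (by decide), h₀.val]
    obtain ⟨s', hs'⟩ : ∃ s', s' = readEntry.exec s := ⟨_, rfl⟩
    have e3 : s'.nat 3 = Function.update (s.nat 3) 0 (K + 1) := by
      rw [hs']
      simp [readEntry, exec_block_cons, exec_block_nil, exec_condReal, exec_condNat, exec_setNat,
        exec_incr, h.count]
    have e4 : s'.nat 4 = Function.update (s.nat 4) (col K) (K + 1) := by
      rw [hs']
      simp [readEntry, exec_block_cons, exec_block_nil, exec_condReal, exec_condNat, exec_setNat,
        exec_incr, NExpr.eval, h.count, hcol]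
    have e5 : s'.nat 5 = Function.update (s.nat 5) K (s.nat 4 (col K)) := by
      rw [hs']
      simp [readEntry, exec_block_cons, exec_block_nil, exec_condReal, exec_condNat, exec_setNat,
        exec_incr, NExpr.eval, h.count, hcol]
    have e6 : s'.nat 6 = Function.update (s.nat 6) (s.nat 7 0) (col K) := by
      rw [hs']
      simp [readEntry, exec_block_cons, exec_block_nil, exec_condReal, exec_condNat, exec_setNat,
        exec_incr, NExpr.eval, h.count, hcol]
    have e7 : s'.nat 7 0 = if s.nat 4 (col K) = 0 then s.nat 7 0 + 1 else s.nat 7 0 := by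
      rw [hs']
      simp [readEntry, exec_block_cons, exec_block_nil, exec_condReal, exec_condNat, exec_setNat,
        exec_incr, NExpr.eval, BExpr.Holds, h.count, hcol]
    have r3 : s'.real 3 = Function.update (s.real 3) (row K) (max (s.real 3 (row K)) (val K)) := by
      have e : max (s.real 3 (row K)) (val K) =
          if s.real 3 (row K) < val K then val K else s.real 3 (row K) := by
        split_ifs with h'
        · exact max_eq_right h'.le
        · exact max_eq_left (not_lt.1 h')
      rw [hs', e]
      simp [readEntry, exec_block_cons, exec_block_nil, exec_condReal, exec_condNat, exec_setNat,
        exec_incr, NExpr.eval, RExpr.eval, BExpr.Holds, h.count, hrow, hval]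
    have hn : NatEq [3, 4, 5, 6, 7] s s' := fun a ha => by
      simp only [List.mem_cons, not_or] at ha
      rw [hs']
      simp [readEntry, exec_block_cons, exec_block_nil, exec_condReal, exec_condNat, exec_setNat,
        exec_incr, ha]
    have hr : RealEq [3] s s' := fun a ha => by
      simp only [List.mem_singleton] at ha
      rw [hs']
      simp [readEntry, exec_block_cons, exec_block_nil, exec_condReal, exec_condNat, exec_setNat,
        exec_incr, ha]
    rw [← hs']
    have hnew : ∀ i < s.nat 7 0, s'.nat 6 i = s.nat 6 i := fun i hi => by
      rw [e6, Function.update_of_ne hi.ne]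
    -- the column of the new entry is new if and only if its list is empty
    rw [h.head] at e7
    refine ⟨(h.nat_eq.trans hn).mono (by decide), (h.real_eq.trans hr).mono (by decide), ?_,
      fun i => ?_, fun k hk => ?_, fun i hi => ?_, fun k hk => ?_, fun i hi i' hi' hii => ?_,
      fun k hk => ?_, fun j => ?_⟩
    · rw [e3]; simp
    · rw [e4, Function.update_apply, h.head]
      simp only [last]
      by_cases hi : i = col K
      · simp [hi]
      · simp [hi, Ne.symm hi]
    · rw [e5, Function.update_apply]
      rcases Nat.lt_succ_iff_lt_or_eq.1 hk with h1 | h1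
      · rw [if_neg h1.ne, h.link k h1]
      · rw [if_pos h1, h1, h.head]
    · rcases lt_trichotomy i (s.nat 7 0) with h1 | h1 | h1
      · obtain ⟨k, hk, hkc⟩ := h.cols_mem i h1
        exact ⟨k, by omega, by rw [hnew i h1, hkc]⟩
      · exact ⟨K, by omega, by rw [e6, h1, Function.update_self]⟩
      · exfalso
        rw [e7] at hi
        split_ifs at hi <;> omega
    · have hle : s.nat 7 0 ≤ s'.nat 7 0 := by rw [e7]; split_ifs <;> omega
      rcases Nat.lt_succ_iff_lt_or_eq.1 hk with h1 | h1
      · obtain ⟨i, hi, hic⟩ := h.cols_surj k h1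
        exact ⟨i, by omega, by rw [hnew i hi, hic]⟩
      · rw [h1]
        by_cases hl : last col K (col K) = 0
        · rw [if_pos hl] at e7
          exact ⟨s.nat 7 0, by omega, by rw [e6, Function.update_self]⟩
        · rw [last_eq_zero_iff] at hl
          push Not at hl
          obtain ⟨k', hk', hkc⟩ := hl
          obtain ⟨i, hi, hic⟩ := h.cols_surj k' hk'
          exact ⟨i, by omega, by rw [hnew i hi, hic, hkc]⟩
    · by_cases hl : last col K (col K) = 0
      · rw [if_pos hl] at e7
        have hno := last_eq_zero_iff.1 hl
        have hcase : ∀ i < s.nat 7 0, s'.nat 6 i ≠ s'.nat 6 (s.nat 7 0) := by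
          intro i hi h1
          obtain ⟨k, hk, hkc⟩ := h.cols_mem i hi
          rw [hnew i hi, e6, Function.update_self] at h1
          exact hno k hk (by rw [hkc, h1])
        rcases Nat.lt_succ_iff_lt_or_eq.1 (e7 ▸ hi) with h1 | h1 <;>
          rcases Nat.lt_succ_iff_lt_or_eq.1 (e7 ▸ hi') with h2 | h2
        · rw [hnew i h1, hnew i' h2] at hii
          exact h.cols_inj i h1 i' h2 hii
        · exact absurd (by rw [hii, h2]) (hcase i h1)
        · exact absurd (by rw [← hii, h1]) (hcase i' h2)
        · rw [h1, h2]
      · rw [if_neg hl] at e7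
        rw [e7] at hi hi'
        rw [hnew i hi, hnew i' hi'] at hii
        exact h.cols_inj i hi i' hi' hii
    · rw [r3, Function.update_apply]
      rcases Nat.lt_succ_iff_lt_or_eq.1 hk with h1 | h1
      · split_ifs with h2
        · rw [← h2]; exact (h.le_max k h1).trans (le_max_left _ _)
        · exact h.le_max k h1
      · rw [h1, if_pos rfl]; exact le_max_right _ _
    · rw [r3, Function.update_apply]
      split_ifs with h2
      · rcases max_choice (s.real 3 (row K)) (val K) with h3 | h3
        · rw [h3]
          rcases h.max_mem (row K) with h4 | ⟨k, hk, hkr, h4⟩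
          · exact Or.inl h4
          · exact Or.inr ⟨k, by omega, by rw [hkr, h2], h4⟩
        · exact Or.inr ⟨K, by omega, h2.symm, h3⟩
      · rcases h.max_mem j with h4 | ⟨k, hk, hkr, h4⟩
        · exact Or.inl h4
        · exact Or.inr ⟨k, by omega, hkr, h4⟩

theorem ends_read {m N : ℕ} {row col : ℕ → ℕ} {val : ℕ → ℝ} {ε : ℝ} {s₀ : State}
    (h₀ : RawState m N row col val ε s₀) :
    Ends (.loop (.natLt (nvar 3) (.get 0 (.const 2))) readEntry) s₀ ((N + 1) * 210)
      (ReadState row col val s₀ N) := by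
  refine (Ends.loop_const (ReadState row col val s₀) N 200
    (fun t ht s hs => ⟨?_, readEntry_step h₀ hs⟩) (fun s hs => ?_) ?_).imp ?_ fun _ h => h
  · change s.nat 3 0 < s.nat 0 2
    rw [hs.count, hs.nat_eq 0 (by decide), h₀.N]
    exact ht
  · change ¬ s.nat 3 0 < s.nat 0 2
    rw [hs.count, hs.nat_eq 0 (by decide), h₀.N]
    omega
  · have h7 : s₀.nat 7 0 = 0 := h₀.nat_zero 7 (by norm_num) 0
    refine ⟨fun _ _ => rfl, fun _ _ => rfl, h₀.nat_zero 3 (by norm_num) 0,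
      fun i => h₀.nat_zero 4 (by norm_num) i, by simp, ?_, by simp, ?_, by simp,
      fun j => Or.inl (h₀.real_zero 3 (by norm_num) j)⟩
    · intro i hi; omega
    · intro i hi; omega
  · have : (BExpr.natLt (nvar 3) (.get 0 (.const 2))).cost = 5 := rfl
    rw [this]
    omega

/-- The maximum of the inverses of the row maxima. -/
theorem ends_bound {s : State} {m : ℕ} (hm : s.nat 0 0 = m) (h8 : s.nat 8 0 = 0)
    (h4 : s.real 4 0 = 0) (hpos : ∀ j < m, 0 < s.real 3 j) :
    Ends (.loop (.natLt (nvar 8) (.get 0 (.const 0))) boundRow) s ((m + 1) * 100) fun s' =>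
      NatEq [8] s s' ∧ RealEq [4] s s' ∧ (∀ j < m, 1 / s.real 3 j ≤ s'.real 4 0) ∧
        (0 < m → ∃ j < m, s'.real 4 0 = 1 / s.real 3 j) := by
  classical
  refine (Ends.loop_const (fun t s' => NatEq [8] s s' ∧ RealEq [4] s s' ∧ s'.nat 8 0 = t ∧
      (∀ j < t, 1 / s.real 3 j ≤ s'.real 4 0) ∧ (t = 0 → s'.real 4 0 = 0) ∧
      (0 < t → ∃ j < t, s'.real 4 0 = 1 / s.real 3 j)) m 90 ?_ ?_
      ⟨fun _ _ => rfl, fun _ _ => rfl, h8, by simp, fun _ => h4, by simp⟩).imp ?_ ?_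
  · rintro t ht s2 ⟨a1, a2, a3, a4, a5, a6⟩
    constructor
    · change s2.nat 8 0 < s2.nat 0 0
      rw [a3, a1 0 (by decide), hm]
      exact ht
    · refine (Cmd.Straight.ends' (P := boundRow) ?_ ?_).imp (by decide) fun _ h => h
      · simp [boundRow, Cmd.block, Cmd.Straight, Cmd.condReal, incr]
      · have e : boundRow.exec s2 =
            (s2.writeReal 4 0 (max (s2.real 4 0) (1 / s.real 3 t))).writeNat 8 0 (t + 1) := by
          simp only [boundRow, exec_block_cons, exec_block_nil, exec_condReal, exec_incr,
            NExpr.eval, RExpr.eval, eval_nvar, eval_rvar, a3, BExpr.Holds, nat_writeReal,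
            a2 3 (by decide), Rat.cast_one]
          congr 2
          split_ifs with h
          · rw [max_eq_right h.le]
          · rw [max_eq_left (not_lt.1 h)]
        rw [e]
        refine ⟨fun a ha => ?_, fun a ha => ?_, ?_, fun j hj => ?_, by simp, fun _ => ?_⟩
        · have ha' := ha
          simp only [List.mem_singleton] at ha
          simp [ha, a1 a ha']
        · have ha' := ha
          simp only [List.mem_singleton] at ha
          simp [ha, a2 a ha']
        · simp
        · simp only [real_writeNat, real_writeReal_self, Function.update_self]
          rcases Nat.lt_succ_iff_lt_or_eq.1 hj with h | h
          · exact (a4 j h).trans (le_max_left _ _)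
          · rw [h]; exact le_max_right _ _
        · simp only [real_writeNat, real_writeReal_self, Function.update_self]
          rcases max_choice (s2.real 4 0) (1 / s.real 3 t) with h | h
          · rcases Nat.eq_zero_or_pos t with h0 | h0
            · exfalso
              rw [max_eq_left_iff, a5 h0] at h
              have := one_div_pos.2 (hpos t ht)
              linarith
            · obtain ⟨j, hj, hj'⟩ := a6 h0
              exact ⟨j, by omega, h.trans hj'⟩
          · exact ⟨t, by omega, h⟩
  · rintro s2 ⟨a1, -, a3, -, -⟩
    change ¬ s2.nat 8 0 < s2.nat 0 0
    rw [a3, a1 0 (by decide), hm]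
    omega
  · have : (BExpr.natLt (nvar 8) (.get 0 (.const 0))).cost = 5 := rfl
    rw [this]
    omega
  · rintro s' ⟨a1, a2, -, a4, -, a6⟩
    exact ⟨a1, a2, a4, a6⟩

/-- The memory while the variables are created: `t` levels are complete, and `i` variables of the next
level have been created. -/
structure LevelState (s₀ : State) (nc : ℕ) (v : ℝ) (t i : ℕ) (s : State) : Prop where
  nat_eq : NatEq [9, 10, 11, 12] s₀ s
  real_eq : RealEq [5, 6, 10] s₀ s
  power : s.real 5 0 = 2 ^ t
  levels : s.nat 12 0 = t
  total : s.nat 11 0 = t * nc + i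
  own : ∀ q < t * nc + i, s.nat 10 q = s₀.nat 6 (q % nc)
  cap : ∀ q < t * nc + i, s.real 10 q = 2 ^ (q / nc) / v
  box : ∀ q < t * nc + i, s.real 6 q = 4 / (2 ^ (q / nc) / v)

theorem ends_makeLevel {s₀ s : State} {nc t : ℕ} {v : ℝ} (hnc : s₀.nat 7 0 = nc)
    (hv : s₀.real 19 0 = v) (h : LevelState s₀ nc v t 0 s) :
    Ends makeLevel s ((nc + 1) * 100 + 50) (LevelState s₀ nc v (t + 1) 0) := by
  have h1 : Ends (.setNat 9 (.const 0) (.const 0)) s 3 fun s' =>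
      LevelState s₀ nc v t 0 s' ∧ s'.nat 9 0 = 0 := by
    refine (Cmd.Straight.ends' (P := .setNat 9 (.const 0) (.const 0)) trivial ?_).imp
      (by decide) fun _ h => h
    have hn : ∀ a, a ≠ 9 → ((Cmd.setNat 9 (.const 0) (.const 0)).exec s).nat a = s.nat a :=
      fun a ha => by simp [exec_setNat, ha]
    refine ⟨⟨fun a ha => ?_, h.real_eq, h.power, ?_, ?_, ?_, h.cap, h.box⟩, ?_⟩
    · rw [← h.nat_eq a ha]
      simp only [List.mem_cons, not_or] at ha
      exact hn a ha.1
    · rw [hn 12 (by decide), h.levels]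
    · rw [hn 11 (by decide), h.total]
    · rw [hn 10 (by decide)]; exact h.own
    · simp [exec_setNat, NExpr.eval]
  refine (h1.seq (l := (nc + 1) * 100 + 40) fun s1 hs1 => ?_).imp (by omega) fun _ h => h
  refine ((Ends.loop_const (fun i s' => LevelState s₀ nc v t i s' ∧ s'.nat 9 0 = i) nc 90 ?_ ?_
    hs1).seq (l := 30) fun s2 hs2 => ?_).imp ?_ fun _ h => h
  · rintro i hi s2 ⟨a, a9⟩
    constructor
    · change s2.nat 9 0 < s2.nat 7 0
      rw [a9, a.nat_eq 7 (by decide), hnc]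
      exact hi
    · refine (Cmd.Straight.ends' (P := makeVar) ?_ ?_).imp (by decide) fun _ h => h
      · simp [makeVar, Cmd.block, Cmd.Straight, incr]
      · have hmod : (t * nc + i) % nc = i := by
          rw [mul_comm, Nat.mul_add_mod, Nat.mod_eq_of_lt hi]
        have hdiv : (t * nc + i) / nc = t := by
          rw [mul_comm, Nat.mul_add_div (by omega), Nat.div_eq_of_lt hi, add_zero]
        have hv2 : s2.real 19 0 = v := by rw [a.real_eq 19 (by decide), hv]
        refine ⟨⟨fun b hb => ?_, fun b hb => ?_, ?_, ?_, ?_, fun q hq => ?_, fun q hq => ?_,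
          fun q hq => ?_⟩, ?_⟩
        · rw [← a.nat_eq b hb]
          simp only [List.mem_cons, not_or] at hb
          simp [makeVar, exec_block_cons, exec_block_nil, exec_setNat, exec_setReal, exec_incr, hb]
        · rw [← a.real_eq b hb]
          simp only [List.mem_cons, not_or] at hb
          simp [makeVar, exec_block_cons, exec_block_nil, exec_setNat, exec_setReal, exec_incr, hb]
        · simp [makeVar, exec_block_cons, exec_block_nil, exec_setNat, exec_setReal, exec_incr,
            a.power]
        · simp [makeVar, exec_block_cons, exec_block_nil, exec_setNat, exec_setReal, exec_incr,
            a.levels]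
        · simp [makeVar, exec_block_cons, exec_block_nil, exec_setNat, exec_setReal, exec_incr,
            a.total]
          ring
        · simp only [makeVar, exec_block_cons, exec_block_nil, exec_setNat, exec_setReal,
            exec_incr, nat_writeReal, nat_writeNat_self, ne_eq, Nat.reduceEqDiff,
            not_false_eq_true, nat_writeNat_ne, NExpr.eval, eval_nvar, a.total, a9,
            Function.update_apply]
          split_ifs with h2
          · rw [h2, hmod, a.nat_eq 6 (by decide)]
          · exact a.own q (by omega)
        · simp only [makeVar, exec_block_cons, exec_block_nil, exec_setNat, exec_setReal,
            exec_incr, real_writeNat, nat_writeReal, real_writeReal_self, ne_eq, Nat.reduceEqDiff,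
            not_false_eq_true, real_writeReal_ne, nat_writeNat_ne, RExpr.eval, eval_nvar,
            eval_rvar, a.total, a.power, hv2, Function.update_apply]
          split_ifs with h2
          · rw [h2, hdiv]
          · exact a.cap q (by omega)
        · simp only [makeVar, exec_block_cons, exec_block_nil, exec_setNat, exec_setReal,
            exec_incr, real_writeNat, nat_writeReal, real_writeReal_self, ne_eq, Nat.reduceEqDiff,
            not_false_eq_true, real_writeReal_ne, nat_writeNat_ne, RExpr.eval, eval_nvar,
            eval_rvar, a.total, a.power, hv2, Function.update_apply]
          split_ifs with h2
          · rw [h2, hdiv]; norm_num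
          · exact a.box q (by omega)
        · simp [makeVar, exec_block_cons, exec_block_nil, exec_setNat, exec_setReal, exec_incr, a9]
  · rintro s2 ⟨a, a9⟩
    change ¬ s2.nat 9 0 < s2.nat 7 0
    rw [a9, a.nat_eq 7 (by decide), hnc]
    omega
  · obtain ⟨a, -⟩ := hs2
    refine (Cmd.Straight.ends' ?_ ?_).imp (by decide) fun _ h => h
    · simp [Cmd.block, Cmd.Straight, incr]
    · have e : (t + 1) * nc + 0 = t * nc + nc := by ring
      refine ⟨fun b hb => ?_, fun b hb => ?_, ?_, ?_, ?_, fun q hq => ?_, fun q hq => ?_,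
        fun q hq => ?_⟩
      · rw [← a.nat_eq b hb]
        simp only [List.mem_cons, not_or] at hb
        simp [exec_block_cons, exec_block_nil, exec_setReal, exec_incr, hb]
      · rw [← a.real_eq b hb]
        simp only [List.mem_cons, not_or] at hb
        simp [exec_block_cons, exec_block_nil, exec_setReal, exec_incr, hb]
      · simp [exec_block_cons, exec_block_nil, exec_setReal, exec_incr, NExpr.eval, RExpr.eval,
          a.power, pow_succ]
        ring
      · simp [exec_block_cons, exec_block_nil, exec_setReal, exec_incr, a.levels]
      · rw [e]
        simp [exec_block_cons, exec_block_nil, exec_setReal, exec_incr, a.total]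
      · rw [← a.own q (by omega)]
        simp [exec_block_cons, exec_block_nil, exec_setReal, exec_incr]
      · rw [← a.cap q (by omega)]
        simp [exec_block_cons, exec_block_nil, exec_setReal, exec_incr]
      · rw [← a.box q (by omega)]
        simp [exec_block_cons, exec_block_nil, exec_setReal, exec_incr]
  · have : (BExpr.natLt (nvar 9) (nvar 7)).cost = 5 := rfl
    rw [this]
    omega

/-- The number of levels: the smallest `lam` with `2 * N ^ 2 < 2 ^ lam * ε`.  The machine finds it by
comparing reals, without rounding a logarithm. -/
theorem exists_levels {N : ℕ} {ε : ℝ} (hN : 0 < N) (hε : 0 < ε) (hε1 : ε ≤ 1) :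
    ∃ lam : ℕ, 0 < lam ∧ 2 * (N : ℝ) ^ 2 < 2 ^ lam * ε ∧
      ∀ t < lam, 2 ^ t * ε ≤ 2 * (N : ℝ) ^ 2 := by
  classical
  have hex : ∃ l : ℕ, 2 * (N : ℝ) ^ 2 < 2 ^ l * ε := by
    obtain ⟨l, hl⟩ := pow_unbounded_of_one_lt (2 * (N : ℝ) ^ 2 / ε) (by norm_num : (1 : ℝ) < 2)
    exact ⟨l, by rwa [div_lt_iff₀ hε] at hl⟩
  refine ⟨Nat.find hex, ?_, Nat.find_spec hex, fun t ht => not_lt.1 (Nat.find_min hex ht)⟩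
  rw [Nat.find_pos]
  have : (1 : ℝ) ≤ N := by exact_mod_cast hN
  simp only [pow_zero, one_mul]
  nlinarith

/-- The image of the starting point `z` is built up column by column. -/
theorem ends_initVar {I : Inst} {s₀ s : State} {t : ℕ} (hS : Setup I s) (ht : t < I.Q)
    (h13 : s.nat 13 0 = t)
    (hz : s.real 6 = s₀.real 6) (h8 : ∀ j, s.real 8 j = ∑ q ∈ range t, I.B j q * s₀.real 6 q)
    (h9 : ∀ j, s.real 9 j = 0) :
    Ends initVar s (deg I (I.own t) * 100 + 150) fun s' => NatEq [13, 14] s s' ∧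
      RealEq [8, 9, 16, 17, 18] s s' ∧ s'.nat 13 0 = t + 1 ∧
      (∀ j, s'.real 8 j = ∑ q ∈ range (t + 1), I.B j q * s₀.real 6 q) ∧ ∀ j, s'.real 9 j = 0 := by
  have h1 : Ends (.setReal 16 (.const 0) (.get 6 (nvar 13))) s 10 fun s' => NatEq [] s s' ∧
      RealEq [16] s s' ∧ s'.real 16 0 = s₀.real 6 t := by
    refine (Cmd.Straight.ends' (P := .setReal 16 (.const 0) (.get 6 (nvar 13))) trivial ?_).imp
      (by decide) fun _ h => h
    refine ⟨fun _ _ => rfl, fun a ha => ?_, ?_⟩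
    · simp only [List.mem_singleton] at ha
      simp [exec_setReal, ha]
    · simp [exec_setReal, NExpr.eval, RExpr.eval, h13, hz]
  refine (h1.seq (l := deg I (I.own t) * 100 + 135) fun s1 ⟨a1, a2, a3⟩ => ?_).imp
    (by omega) fun _ h => h
  have h2 : Ends (.setReal 17 (.const 0) (.const 0)) s1 10 fun s' => NatEq [] s s' ∧
      RealEq [16, 17] s s' ∧ s'.real 16 0 = s₀.real 6 t ∧ s'.real 17 0 = 0 := by
    refine (Cmd.Straight.ends' (P := .setReal 17 (.const 0) (.const 0)) trivial ?_).imp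
      (by decide) fun _ h => h
    refine ⟨a1, fun a ha => ?_, ?_, ?_⟩
    · simp only [List.mem_cons, List.not_mem_nil, or_false, not_or] at ha
      rw [← a2 a (by simpa using ha.1)]
      simp [exec_setReal, ha]
    · simp [exec_setReal, a3]
    · simp [exec_setReal, NExpr.eval, RExpr.eval]
  refine (h2.seq (l := deg I (I.own t) * 100 + 120) fun s2 ⟨b1, b2, b3, b4⟩ => ?_).imp
    (by omega) fun _ h => h
  have S2 : Setup I s2 := hS.congr b1 b2
  refine ((ends_addColumn S2 ht (by rw [b1 13 (by decide), h13])).seq (l := 10)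
    fun s3 ⟨c1, c2, c3, c4⟩ => ?_).imp (by omega) fun _ h => h
  refine (Cmd.Straight.ends' (P := incr 13) trivial ?_).imp (by decide) fun _ h => h
  have hn : NatEq [13, 14] s ((incr 13).exec s3) := fun a ha => by
    have ha' := ha
    simp only [List.mem_cons, List.not_mem_nil, or_false, not_or] at ha
    rw [exec_incr, nat_writeNat_ne _ _ _ ha.1, c1 a (by simpa using ha.2), b1 a (by simp)]
  have hr : RealEq ([16, 17] ++ [8, 9, 18]) s s3 := b2.trans c2
  refine ⟨hn, hr.mono (by decide), ?_, fun j => ?_, fun j => ?_⟩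
  · simp [exec_incr, c1 13 (by decide), b1 13 (by decide), h13]
  · rw [exec_incr, real_writeNat, c3, b2 8 (by decide), h8, b3, sum_range_succ]
  · rw [exec_incr, real_writeNat, c4, b2 9 (by decide), h9, b4, mul_zero, zero_add]

end Covering

namespace RealRAM

/-- Composition through a known intermediate memory. -/
theorem Ends.seq_of_eq {P P' : Cmd} {s t : State} {k l : ℕ} {R : State → Prop}
    (h : Ends P s k fun s' => s' = t) (h' : Ends P' t l R) :
    Ends (.seq P P') s (k + l + 1) R :=
  h.seq fun s' hs' => by rw [hs']; exact h'

end RealRAM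

namespace Covering

open RealRAM Finset

theorem Smoothed.obj_congr (D : Smoothed) {x y : ℕ → ℝ} (h : ∀ q < D.Q, x q = y q) :
    D.obj x = D.obj y := by
  have h1 : ∀ j, D.load x j = D.load y j := fun j =>
    sum_congr rfl fun q hq => by rw [h q (mem_range.1 hq)]
  unfold Smoothed.obj Smoothed.pen
  rw [sum_congr rfl fun q hq => h q (mem_range.1 hq)]
  simp only [h1]

/-- The computation of the bound `v`, and the initialization of the powers of two. -/
theorem ends_scale {s : State} {m : ℕ} (hm : s.nat 0 0 = m) :
    Ends (.block [.setReal 19 (.const 0) (.mul (.ofNat (.get 0 (.const 0))) (rvar 4)),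
      .setReal 5 (.const 0) (.const 1)]) s 20 fun s' => NatEq [] s s' ∧ RealEq [5, 19] s s' ∧
        s'.real 19 0 = m * s.real 4 0 ∧ s'.real 5 0 = 1 := by
  refine (Cmd.Straight.ends' ?_ ?_).imp (by decide) fun _ h => h
  · simp [Cmd.block, Cmd.Straight]
  · refine ⟨fun a _ => ?_, fun a ha => ?_, ?_, ?_⟩
    · simp [exec_block_cons, exec_block_nil, exec_setReal]
    · simp only [List.mem_cons, List.not_mem_nil, or_false, not_or] at ha
      simp [exec_block_cons, exec_block_nil, exec_setReal, ha]
    · simp [exec_block_cons, exec_block_nil, exec_setReal, NExpr.eval, RExpr.eval, hm]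
    · simp [exec_block_cons, exec_block_nil, exec_setReal, NExpr.eval, RExpr.eval]

/-- The creation of all variables. -/
theorem ends_levels {s : State} {nc N lam : ℕ} {v ε : ℝ} (hN : s.nat 0 2 = N) (hε : s.real 1 0 = ε)
    (hnc : s.nat 7 0 = nc) (hv : s.real 19 0 = v) (h5 : s.real 5 0 = 1) (h11 : s.nat 11 0 = 0)
    (h12 : s.nat 12 0 = 0) (hlam : 2 * (N : ℝ) ^ 2 < 2 ^ lam * ε)
    (hlam' : ∀ t < lam, 2 ^ t * ε ≤ 2 * (N : ℝ) ^ 2) :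
    Ends (.loop (.not (.realLt (.mul (.const 2) (.mul (.ofNat (.get 0 (.const 2)))
      (.ofNat (.get 0 (.const 2))))) (.mul (rvar 5) (rvar 1)))) makeLevel) s
      ((lam + 1) * ((nc + 1) * 100 + 70)) (LevelState s nc v lam 0) := by
  have hguard : ∀ t s', LevelState s nc v t 0 s' → (BExpr.Holds s' (.not (.realLt
      (.mul (.const 2) (.mul (.ofNat (.get 0 (.const 2)))
      (.ofNat (.get 0 (.const 2))))) (.mul (rvar 5) (rvar 1)))) ↔
        ¬ 2 * (N : ℝ) ^ 2 < 2 ^ t * ε) := by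
    intro t s' h
    simp only [BExpr.Holds, RExpr.eval, NExpr.eval, eval_rvar, h.power, h.real_eq 1 (by decide),
      h.nat_eq 0 (by decide), hN, hε]
    norm_num [sq]
  refine (Ends.loop_const (fun t => LevelState s nc v t 0) lam ((nc + 1) * 100 + 50)
    (fun t ht s' hs => ⟨?_, ends_makeLevel hnc hv hs⟩) (fun s' hs => ?_) ?_).imp ?_ fun _ h => h
  · rw [hguard t s' hs]
    exact not_lt.2 (hlam' t ht)
  · rw [hguard lam s' hs]
    exact not_not.2 hlam
  · refine ⟨fun _ _ => rfl, fun _ _ => rfl, by simpa using h5, h12, by simpa using h11,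
      ?_, ?_, ?_⟩ <;> intro q hq <;> omega
  · refine Nat.mul_le_mul_left _ ?_
    have : (BExpr.not (.realLt (.mul (.const 2) (.mul (.ofNat (.get 0 (.const 2)))
      (.ofNat (.get 0 (.const 2))))) (.mul (rvar 5) (rvar 1)))).cost = 16 := rfl
    omega

/-- The computation of the parameters `μ`, `L` and `τ`. -/
theorem ends_parameters {I : Inst} {s : State} (hε : s.real 1 0 = I.ε) (h11 : s.nat 11 0 = I.Q)
    (h12 : s.nat 12 0 = I.lam) :
    Ends (.block
      [.setReal 11 (.const 0) (.div (rvar 1) (.mul (.const 32) (.ofNat (nvar 12)))),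
      .setReal 12 (.const 0) (.div (.const 16) (rvar 11)),
      .setReal 13 (.const 0) (.div (.const 1) (.mul (.mul (.const 2) (.ofNat (nvar 11)))
        (rvar 12)))]) s 40 fun s' => NatEq [] s s' ∧ RealEq [11, 12, 13] s s' ∧
        s'.real 11 0 = I.smoothed.μ ∧ s'.real 12 0 = I.smoothed.L ∧
        s'.real 13 0 = I.smoothed.τ := by
  refine (Cmd.Straight.ends' ?_ ?_).imp (by decide) fun _ h => h
  · simp [Cmd.block, Cmd.Straight]
  · refine ⟨fun a _ => ?_, fun a ha => ?_, ?_, ?_, ?_⟩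
    · simp [exec_block_cons, exec_block_nil, exec_setReal]
    · simp only [List.mem_cons, List.not_mem_nil, or_false, not_or] at ha
      simp [exec_block_cons, exec_block_nil, exec_setReal, ha]
    all_goals
      simp [exec_block_cons, exec_block_nil, exec_setReal, NExpr.eval, RExpr.eval, hε, h11, h12,
        Smoothed.τ, Smoothed.L, Inst.smoothed]

/-- The computation of the image of the starting point. -/
theorem ends_initLoads {I : Inst} (hI : I.OK) {s : State} (hS : Setup I s) (h13 : s.nat 13 0 = 0)
    (h8 : ∀ j, s.real 8 j = 0) (h9 : ∀ j, s.real 9 j = 0) :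
    Ends (.loop (.natLt (nvar 13) (nvar 11)) initVar) s (300 * (I.lam * I.N)) fun s' =>
      NatEq [13, 14] s s' ∧ RealEq [8, 9, 16, 17, 18] s s' ∧
      (∀ j, s'.real 8 j = I.smoothed.load (s.real 6) j) ∧ ∀ j, s'.real 9 j = 0 := by
  refine (Ends.loop (fun t s' => NatEq [13, 14] s s' ∧ RealEq [8, 9, 16, 17, 18] s s' ∧
      s'.nat 13 0 = t ∧ (∀ j, s'.real 8 j = ∑ q ∈ range t, I.B j q * s.real 6 q) ∧
      ∀ j, s'.real 9 j = 0) I.Q (fun t => deg I (I.own t) * 100 + 150)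
      (fun t ht s' hs => ⟨?_, ?_⟩) (fun s' hs => ?_)
      ⟨fun _ _ => rfl, fun _ _ => rfl, h13, by simpa using h8, h9⟩).imp ?_ ?_
  · obtain ⟨a1, a2, a3, -⟩ := hs
    change s'.nat 13 0 < s'.nat 11 0
    rw [a3, a1 11 (by decide), hS.Q]
    exact ht
  · obtain ⟨a1, a2, a3, a4, a5⟩ := hs
    refine (ends_initVar (hS.congr a1 a2) ht a3 (s₀ := s) (a2 6 (by decide)) a4 a5).imp le_rfl ?_
    rintro s'' ⟨b1, b2, b3, b4, b5⟩
    exact ⟨(a1.trans b1).mono (by decide), (a2.trans b2).mono (by decide), b3, b4, b5⟩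
  · obtain ⟨a1, a2, a3, -⟩ := hs
    change ¬ s'.nat 13 0 < s'.nat 11 0
    rw [a3, a1 11 (by decide), hS.Q]
    omega
  · have hc : (BExpr.natLt (nvar 13) (nvar 11)).cost = 5 := rfl
    have h1 := sum_deg_le hI
    have h2 : I.Q ≤ I.lam * I.N := Nat.mul_le_mul_left _ hI.nc_le
    have h3 : 0 < I.Q := hI.Q_pos
    rw [hc]
    simp only [add_assoc, sum_add_distrib, ← sum_mul, sum_const, card_range, smul_eq_mul]
    omega
  · rintro s' ⟨a1, a2, -, a4, a5⟩
    exact ⟨a1, a2, a4, a5⟩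

/-- The outcome of the preparation: the runs start from the box corner `box`. -/
def Prepared (I : Inst) (s : State) : Prop :=
  RoundState I 0 s ∧ ∀ q < I.Q, s.real 6 q = I.smoothed.box q

/-- The preparation computes a valid instance, with the starting point `box`. -/
theorem ends_prepare {m n N : ℕ} {row col : ℕ → ℕ} {val : ℕ → ℝ} {ε : ℝ} {s₀ : State}
    (hr : RawOK m n N row col val ε) (h₀ : RawState m N row col val ε s₀) :
    ∃ I : Inst, I.OK ∧ I.m = m ∧ I.n = n ∧ I.N = N ∧ I.row = row ∧ I.col = col ∧ I.val = val ∧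
      I.ε = ε ∧ Ends prepare s₀ (2000 * (I.lam * I.N)) (Prepared I) := by
  have hN : 0 < N := by
    obtain ⟨k, hk, -⟩ := hr.surj 0 hr.m_pos
    omega
  have hm0 : (0 : ℝ) < m := by exact_mod_cast hr.m_pos
  obtain ⟨s1, r1, E1⟩ := (ends_read h₀).exists_state
  have hpos : ∀ j < m, 0 < s1.real 3 j := fun j hj => by
    obtain ⟨k, hk, rfl⟩ := hr.surj j hj
    exact (hr.val_pos k hk).trans_le (r1.le_max k hk)
  have hm1 : s1.nat 0 0 = m := by rw [r1.nat_eq 0 (by decide), h₀.m]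
  obtain ⟨s2, ⟨n2, r2, hle, hmem⟩, E2⟩ := (ends_bound hm1
    (by rw [r1.nat_eq 8 (by decide)]; exact h₀.nat_zero 8 (by norm_num) 0)
    (by rw [r1.real_eq 4 (by decide)]; exact h₀.real_zero 4 (by norm_num) 0) hpos).exists_state
  have hm2 : s2.nat 0 0 = m := by rw [n2 0 (by decide), hm1]
  obtain ⟨s3, ⟨n3, r3, hv, h5⟩, E3⟩ := (ends_scale hm2).exists_state
  have N3 : NatEq [3, 4, 5, 6, 7, 8] s₀ s3 :=
    ((r1.nat_eq.trans n2).trans n3).mono (by decide)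
  have R3 : RealEq [3, 4, 5, 19] s₀ s3 :=
    ((r1.real_eq.trans r2).trans r3).mono (by decide)
  obtain ⟨lam, hlam0, hlam, hlam'⟩ := exists_levels hN hr.ε_pos hr.ε_le
  set v : ℝ := m * s2.real 4 0 with hvdef
  obtain ⟨s4, l4, E4⟩ := (ends_levels (nc := s3.nat 7 0)
    (by rw [N3 0 (by decide)]; exact h₀.N)
    (by rw [R3 1 (by decide)]; exact h₀.ε) rfl hv h5
    (by rw [N3 11 (by decide)]; exact h₀.nat_zero 11 (by norm_num) 0)
    (by rw [N3 12 (by decide)]; exact h₀.nat_zero 12 (by norm_num) 0) hlam hlam').exists_state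
  have N31 : NatEq [8] s1 s3 := (n2.trans n3).mono (by decide)
  let I : Inst :=
    { m := m, n := n, N := N, nc := s3.nat 7 0, lam := lam, row := row, col := col,
      cols := s3.nat 6, val := val, ε := ε, v := v }
  have e7 : s3.nat 7 = s1.nat 7 := N31 7 (by decide)
  have e6 : s3.nat 6 = s1.nat 6 := N31 6 (by decide)
  have hI : I.OK :=
    { m_pos := hr.m_pos
      row_lt := hr.row_lt
      col_lt := hr.col_lt
      val_pos := hr.val_pos
      inj := hr.inj
      surj := hr.surj
      cols_mem := by
        change ∀ i < s3.nat 7 0, ∃ k < N, col k = s3.nat 6 i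
        rw [e7, e6]; exact r1.cols_mem
      cols_surj := by
        change ∀ k < N, ∃ i < s3.nat 7 0, s3.nat 6 i = col k
        rw [e7, e6]; exact r1.cols_surj
      cols_inj := by
        change ∀ i < s3.nat 7 0, ∀ i' < s3.nat 7 0, s3.nat 6 i = s3.nat 6 i' → i = i'
        rw [e7, e6]; exact r1.cols_inj
      ε_pos := hr.ε_pos
      ε_le := hr.ε_le
      v_max := fun j hj => by
        have hj : j < m := hj
        have hp := hpos j hj
        rcases r1.max_mem j with h | ⟨k, hk, hkr, h⟩
        · rw [h] at hp; exact absurd hp (lt_irrefl _)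
        · refine ⟨k, hk, hkr, ?_⟩
          have h1 := hle j hj
          rw [h] at h1 hp
          rw [div_le_iff₀ hp] at h1
          change (m : ℝ) ≤ m * s2.real 4 0 * val k
          nlinarith
      v_row := by
        obtain ⟨j, hj, h⟩ := hmem hr.m_pos
        refine ⟨j, hj, fun k hk hkr => ?_⟩
        have hp := hpos j hj
        have h1 := r1.le_max k hk
        have hkr : row k = j := hkr
        rw [hkr] at h1
        change (m : ℝ) * s2.real 4 0 * val k ≤ m
        rw [h, mul_assoc]
        refine mul_le_of_le_one_right hm0.le ?_
        rw [one_div_mul_eq_div, div_le_one hp]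
        exact h1
      lam_pos := hlam0
      lam_large := hlam
      lam_small := hlam' (lam - 1) (by omega) }
  have hQ : I.Q = lam * s3.nat 7 0 + 0 := rfl
  have N4 : NatEq [3, 4, 5, 6, 7, 8, 9, 10, 11, 12] s₀ s4 := (N3.trans l4.nat_eq).mono (by decide)
  have R4 : RealEq [3, 4, 5, 6, 10, 19] s₀ s4 := (R3.trans l4.real_eq).mono (by decide)
  obtain ⟨s5, ⟨n5, r5, hμ, hL, hτ⟩, E5⟩ := (ends_parameters (I := I)
    (by rw [R4 1 (by decide)]; exact h₀.ε) l4.total l4.levels).exists_state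
  have N5 : NatEq [3, 4, 5, 6, 7, 8, 9, 10, 11, 12] s₀ s5 := (N4.trans n5).mono (by decide)
  have R5 : RealEq [3, 4, 5, 6, 10, 11, 12, 13, 19] s₀ s5 := (R4.trans r5).mono (by decide)
  have N51 : NatEq [8, 9, 10, 11, 12] s1 s5 :=
    ((N31.trans l4.nat_eq).trans n5).mono (by decide)
  have N54 : s5.nat = s4.nat := funext fun a => n5 a (by simp)
  have S5 : Setup I s5 :=
    { m := by rw [N5 0 (by decide)]; exact h₀.m
      row := by rw [N5 1 (by decide)]; exact h₀.row
      head := by rw [N51 4 (by decide)]; exact r1.head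
      link := by rw [N51 5 (by decide)]; exact r1.link
      own := by rw [N54]; exact l4.own
      Q := by rw [N54]; exact l4.total
      lam := by rw [N54]; exact l4.levels
      val := by rw [R5 0 (by decide)]; exact h₀.val
      cap := by rw [r5 10 (by decide)]; exact l4.cap
      μ := hμ
      L := hL
      τ := hτ
      v := by rw [r5 19 (by decide), l4.real_eq 19 (by decide)]; exact hv }
  have E6 := ends_initLoads hI S5
    (by rw [N5 13 (by decide)]; exact h₀.nat_zero 13 (by norm_num) 0)
    (by rw [R5 8 (by decide)]; exact h₀.real_zero 8 (by norm_num))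
    (by rw [R5 9 (by decide)]; exact h₀.real_zero 9 (by norm_num))
  refine ⟨I, hI, rfl, rfl, rfl, rfl, rfl, rfl, rfl, ?_⟩
  have hall := E1.seq_of_eq (E2.seq_of_eq (E3.seq_of_eq (E4.seq_of_eq (E5.seq_of_eq E6))))
  refine hall.imp ?_ fun s' hs' => ?_
  · have h1 : m ≤ N := hI.m_le
    have h2 : s3.nat 7 0 ≤ N := hI.nc_le
    have h3 : N ≤ lam * N := Nat.le_mul_of_pos_left N hlam0
    have h4 : (lam + 1) * ((s3.nat 7 0 + 1) * 100 + 70) ≤ (2 * lam) * (270 * N) :=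
      Nat.mul_le_mul (by omega) (by omega)
    have h5 : (2 * lam) * (270 * N) = 540 * (lam * N) := by ring
    change _ ≤ 2000 * (lam * N)
    change _ + (_ + (_ + (_ + (_ + 300 * (lam * N) + 1) + 1) + 1) + 1) + 1 ≤ _
    omega
  · obtain ⟨a1, a2, a3, a4⟩ := hs'
    have hbox : ∀ q < I.Q, s'.real 6 q = I.smoothed.box q := by
      rw [a2 6 (by decide), r5 6 (by decide)]
      exact l4.box
    refine ⟨⟨S5.congr a1 a2, ?_, ?_, ?_, fun j _ => ?_, fun j _ => a4 j, fun q hq => ?_⟩, hbox⟩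
    · rw [a1 15 (by decide), N5 15 (by decide)]
      exact h₀.nat_zero 15 (by norm_num) 0
    · rw [a2 2 (by decide), R5 2 (by decide)]
      exact h₀.real_zero 2 (by norm_num)
    · rw [a2 7 (by decide), R5 7 (by decide)]
      exact h₀.real_zero 7 (by norm_num)
    · rw [a2 6 (by decide)]
      exact a3 j
    · rw [hbox q hq]
      exact ⟨(div_pos (by norm_num) (hI.cap_pos q)).le, le_rfl⟩

end Covering

/-! ### Success probability and running time of the program -/

namespace Covering

open RealRAM Finset

/-- The expected final objective is at most `(1 + 11 * ε) * o`, so by Markov its excess over `o` is at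
most `110 * ε * o` with probability at least `9 / 10`. -/
theorem haltProb_solver {I : Inst} (hI : I.OK) {s₀ : State} {k : ℕ}
    (hp : Ends prepare s₀ k (Prepared I)) {o : ℝ} (ho : I.IsOpt o) {S : Set State}
    (hS : ∀ s', I.Feas (s'.real 2) → ∑ i ∈ range I.n, s'.real 2 i ≤ (1 + 221 * I.ε) * o → s' ∈ S) :
    9 / 10 ≤ haltProb solver s₀ S := by
  have ho0 := hI.opt_pos ho
  have hε := hI.ε_pos
  obtain ⟨u, hu, hobj⟩ := hI.exists_comparison ho
  have hu0 : 0 ≤ I.smoothed.obj u := ho0.le.trans (hI.opt_le_obj ho fun q hq => (hu q hq).1)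
  obtain ⟨T, hT, hT', -⟩ := exists_steps hI.valid
  have hrounds := bounds_rounds hI hu hu0 hT hT'
  have hinit := initial_value_le hI ho hobj hT'
  set p := 110 * I.ε * o with hpdef
  have hp0 : 0 < p := by positivity
  have hfin : ∀ s', RoundState I I.lam s' →
      ENNReal.ofReal ((1 + o / p) - 1 / p * I.smoothed.obj (s'.real 6)) ≤
        haltFrom S ⟨[finish], s'⟩ := by
    intro s' hs'
    have hy : ∀ q < I.Q, 0 ≤ s'.real 6 q := fun q hq => (hs'.inBox q hq).1
    refine markov ho0 hε (hI.opt_le_obj ho hy) (fun hle => ?_) hpdef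
    obtain ⟨t, ⟨w, h1, h2, h3⟩, l, -, h4⟩ := ends_finish hI hs'
    have h5 : t.real 2 = I.out (s'.real 6) w := funext h3
    obtain ⟨h6, h7⟩ := hI.out_approx ho hy h1 h2 hle
    rw [← h5] at h6 h7
    exact (haltFrom_nil S (hS t h6 h7)).trans ((h4 []).haltFrom S)
  obtain ⟨s1, ⟨hs1, hbox⟩, l, -, hl⟩ := hp
  have h1 := hrounds.value S [finish] (1 + o / p) (1 / p) (by positivity) hfin s1 hs1
  rw [I.smoothed.obj_congr hbox] at h1
  rw [haltProb_eq]
  have e1 : step ⟨[solver], s₀⟩ = PMF.pure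
    ⟨[prepare, .seq (.loop (.natLt (nvar 15) (nvar 12)) descentRun) finish], s₀⟩ := rfl
  have e2 : step ⟨[.seq (.loop (.natLt (nvar 15) (nvar 12)) descentRun) finish], s1⟩ = PMF.pure
    ⟨[.loop (.natLt (nvar 15) (nvar 12)) descentRun, finish], s1⟩ := rfl
  refine le_trans (le_trans ?_ h1) ((haltFrom_of_pure S e2).trans
    (((hl _).haltFrom S).trans (haltFrom_of_pure S e1)))
  have e3 : (9 / 10 : ℝ≥0∞) = ENNReal.ofReal (9 / 10) := by
    rw [ENNReal.ofReal_div_of_pos (by norm_num)]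
    norm_num
  rw [e3]
  apply ENNReal.ofReal_le_ofReal
  have h2 := mul_le_mul_of_nonneg_left hinit (by positivity : 0 ≤ 1 / p)
  have h3 : 1 + o / p - 1 / p * ((1 + 11 * I.ε) * o) = 9 / 10 := by
    rw [hpdef]
    field_simp
    ring
  linarith

/-- The costs of the preparation, the runs and the output added up; `T` is the number of steps of a run. -/
theorem expectedTime_le {I : Inst} (hI : I.OK) {s₀ : State} {k : ℕ}
    (hp : Ends prepare s₀ k (Prepared I)) :
    ∃ T : ℕ, (T : ℝ) ≤ 2 * I.Q * I.smoothed.L * Real.log I.smoothed.L ∧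
      expectedTime solver s₀ ≤ k + ((I.lam + 1) * ((T + 1) * stepCost I +
        ((I.Q + I.m + 5) * 50 : ℕ)) + ((I.m + 1) * 50 + (I.Q + 1) * 50 + 52 : ℕ)) := by
  have hbox0 : ∀ q < I.Q, 0 ≤ I.smoothed.box q := fun q _ =>
    (div_pos (by norm_num) (hI.cap_pos q)).le
  have hu0 : 0 ≤ I.smoothed.obj I.smoothed.box :=
    (sum_nonneg fun q hq => hbox0 q (mem_range.1 hq)).trans
      (Smoothed.sum_le_obj hI.valid _)
  obtain ⟨T, hT, hT', hTL⟩ := exists_steps hI.valid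
  refine ⟨T, hTL, ?_⟩
  have hrounds := bounds_rounds hI (fun q hq => ⟨hbox0 q hq, le_rfl⟩) hu0 hT hT'
  obtain ⟨s1, ⟨hs1, -⟩, l, hlk, hl⟩ := hp
  have hfin : ∀ s', RoundState I I.lam s' →
      timeFrom ⟨[finish], s'⟩ ≤ (((I.m + 1) * 50 + (I.Q + 1) * 50 + 50 : ℕ) : ℝ≥0∞) := by
    intro s' hs'
    obtain ⟨t, -, l, hl, h4⟩ := ends_finish hI hs'
    rw [(h4 []).timeFrom, timeFrom_nil, add_zero]
    exact_mod_cast hl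
  have h1 := hrounds.time [finish] _ hfin s1 hs1
  rw [expectedTime_eq]
  have e1 : step ⟨[solver], s₀⟩ = PMF.pure
    ⟨[prepare, .seq (.loop (.natLt (nvar 15) (nvar 12)) descentRun) finish], s₀⟩ := rfl
  have e2 : step ⟨[.seq (.loop (.natLt (nvar 15) (nvar 12)) descentRun) finish], s1⟩ = PMF.pure
    ⟨[.loop (.natLt (nvar 15) (nvar 12)) descentRun, finish], s1⟩ := rfl
  rw [timeFrom_of_pure e1, (hl _).timeFrom, timeFrom_of_pure e2]
  have c1 : (Config.cost ⟨[solver], s₀⟩ : ℝ≥0∞) = 1 := by simp [Config.cost, solver, Cmd.cost]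
  have c2 : (Config.cost ⟨[.seq (.loop (.natLt (nvar 15) (nvar 12)) descentRun) finish], s1⟩ :
      ℝ≥0∞) = 1 := by simp [Config.cost, Cmd.cost]
  rw [c1, c2]
  have hlk' : (l : ℝ≥0∞) ≤ k := by exact_mod_cast hlk
  refine (add_le_add le_rfl (add_le_add hlk' (add_le_add le_rfl h1))).trans (le_of_eq ?_)
  push_cast
  ring

/-- The number of levels is logarithmic, by its minimality. -/
theorem Inst.OK.lam_le {I : Inst} (hI : I.OK) :
    (I.lam : ℝ) ≤ 3 * (1 + Real.log (I.N / I.ε)) := by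
  have hε := hI.ε_pos
  have hε1 := hI.ε_le
  have hN : (1 : ℝ) ≤ I.N := by exact_mod_cast hI.N_pos
  have h1 := hI.lam_small
  have hlogε : Real.log I.ε ≤ 0 := Real.log_nonpos hε.le hε1
  have h2 := Real.log_le_log (by positivity) h1
  rw [Real.log_mul (by positivity) hε.ne', Real.log_mul (by norm_num) (by positivity),
    Real.log_pow, Real.log_pow, Nat.cast_sub hI.lam_pos] at h2
  rw [Real.log_div (by linarith) hε.ne']
  have h3 := Real.log_two_gt_d9
  have h4 : 0 ≤ Real.log I.N := Real.log_nonneg hN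
  push_cast at h2
  have h5 : (1 : ℝ) ≤ I.lam := by exact_mod_cast hI.lam_pos
  nlinarith

theorem Inst.OK.log_L_le {I : Inst} (hI : I.OK) :
    Real.log I.smoothed.L ≤ 11 * (1 + Real.log (I.N / I.ε)) := by
  have hε := hI.ε_pos
  have hN : (1 : ℝ) ≤ I.N := by exact_mod_cast hI.N_pos
  have hlam : (0 : ℝ) < I.lam := by exact_mod_cast hI.lam_pos
  have e : I.smoothed.L = 2 ^ 9 * (I.lam * (1 / I.ε)) := by
    change 16 / (I.ε / (32 * I.lam)) = _
    field_simp
    norm_num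
  have h1 := hI.lam_le
  have h2 : Real.log I.lam ≤ I.lam := (Real.log_le_sub_one_of_pos hlam).trans (by linarith)
  have h3 : Real.log (1 / I.ε) ≤ Real.log (I.N / I.ε) :=
    Real.log_le_log (by positivity) (by gcongr)
  have h4 := Real.log_two_lt_d9
  have h5 : 0 ≤ Real.log (1 / I.ε) := Real.log_nonneg (by
    rw [le_div_iff₀ hε]; linarith [hI.ε_le])
  rw [e, Real.log_mul (by norm_num) (by positivity), Real.log_mul (by positivity) (by positivity),
    Real.log_pow]
  push_cast
  linarith

/-- The total expected time is dominated by the coordinate steps: there are about `Q * L` of them in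
each of the `lam` runs, and one step costs about `N / nc` on average. -/
theorem expectedTime_solver {I : Inst} (hI : I.OK) {s₀ : State}
    (hp : Ends prepare s₀ (2000 * (I.lam * I.N)) (Prepared I)) :
    expectedTime solver s₀ ≤
      ENNReal.ofReal (10 ^ 9 * (I.N / I.ε) * (1 + Real.log (I.N / I.ε)) ^ 4) := by
  obtain ⟨T, hT, h⟩ := expectedTime_le hI hp
  refine h.trans ?_
  have hε := hI.ε_pos
  have hε1 := hI.ε_le
  have hN : (1 : ℝ) ≤ I.N := by exact_mod_cast hI.N_pos
  have hlam : (1 : ℝ) ≤ I.lam := by exact_mod_cast hI.lam_pos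
  have hnc0 : (0 : ℝ) < I.nc := by exact_mod_cast hI.nc_pos
  have hnc : (I.nc : ℝ) ≤ I.N := by exact_mod_cast hI.nc_le
  have hm : (I.m : ℝ) ≤ I.N := by exact_mod_cast hI.m_le
  have hNε : (I.N : ℝ) ≤ I.N / I.ε := by
    rw [le_div_iff₀ hε]; nlinarith
  have hQ : (I.Q : ℝ) = I.lam * I.nc := by simp [Inst.Q]
  have hx := hI.lam_le
  have hL := hI.log_L_le
  have hl0 : 0 ≤ Real.log (I.N / I.ε) := Real.log_nonneg (hN.trans hNε)
  set x := 1 + Real.log (I.N / I.ε) with hxdef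
  set y := (I.N : ℝ) / I.ε with hydef
  have hx1 : 1 ≤ x := by linarith
  have hy1 : 1 ≤ y := by linarith
  have hLε : I.smoothed.L = 512 * I.lam / I.ε := by
    change 16 / (I.ε / (32 * I.lam)) = _
    field_simp
    norm_num
  have hn0 : (I.nc : NNReal) ≠ 0 := by exact_mod_cast hI.nc_pos.ne'
  have hcoe : ((2000 * (I.lam * I.N) : ℕ) : ℝ≥0∞) + ((I.lam + 1) * ((T + 1) * stepCost I +
        ((I.Q + I.m + 5) * 50 : ℕ)) + ((I.m + 1) * 50 + (I.Q + 1) * 50 + 52 : ℕ)) =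
      (((2000 * (I.lam * I.N) : ℕ) + ((I.lam + 1) * ((T + 1) * (600 + 200 * (I.N / I.nc)) +
        ((I.Q + I.m + 5) * 50 : ℕ)) + ((I.m + 1) * 50 + (I.Q + 1) * 50 + 52 : ℕ)) : NNReal) :
          ℝ≥0∞) := by
    unfold stepCost
    push_cast [ENNReal.coe_div hn0]
    rfl
  rw [hcoe, ENNReal.le_ofReal_iff_toReal_le ENNReal.coe_ne_top (by positivity),
    ENNReal.coe_toReal]
  push_cast
  -- the cost of a run
  have hstep : ((T : ℝ) + 1) * (600 + 200 * (I.N / I.nc)) ≤ 9 * 10 ^ 7 * (y * x ^ 3) := by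
    have h1 : (600 + 200 * ((I.N : ℝ) / I.nc)) ≤ 800 * (I.N / I.nc) := by
      have : 1 ≤ (I.N : ℝ) / I.nc := by rw [le_div_iff₀ hnc0]; linarith
      linarith
    have h2 : (T : ℝ) + 1 ≤ I.nc * (102400 * x ^ 3 / I.ε) := by
      have h3 : (1 : ℝ) ≤ I.nc := by exact_mod_cast hI.nc_pos
      have h4 : (1 : ℝ) ≤ x ^ 3 / I.ε := by
        rw [le_div_iff₀ hε]
        have : 1 ≤ x ^ 3 := one_le_pow₀ hx1
        linarith
      have h5 : 2 * (I.Q : ℝ) * I.smoothed.L * Real.log I.smoothed.L ≤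
          I.nc * (102399 * (x ^ 3 / I.ε)) := by
        rw [hQ, hLε]
        rw [hLε] at hL
        have h6 : 0 ≤ Real.log (512 * I.lam / I.ε) := Real.log_nonneg (by
          rw [le_div_iff₀ hε]; linarith)
        calc 2 * ((I.lam : ℝ) * I.nc) * (512 * I.lam / I.ε) * Real.log (512 * I.lam / I.ε)
            ≤ 2 * ((3 * x) * I.nc) * (512 * (3 * x) / I.ε) * (11 * x) := by gcongr
          _ = I.nc * (101376 * (x ^ 3 / I.ε)) := by ring
          _ ≤ _ := by gcongr; norm_num
      have h6 : (1 : ℝ) ≤ I.nc * (x ^ 3 / I.ε) := one_le_mul_of_one_le_of_one_le h3 h4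
      have h7 : I.nc * (102400 * x ^ 3 / I.ε) =
          I.nc * (102399 * (x ^ 3 / I.ε)) + I.nc * (x ^ 3 / I.ε) := by ring
      linarith
    calc ((T : ℝ) + 1) * (600 + 200 * (I.N / I.nc))
        ≤ (I.nc * (102400 * x ^ 3 / I.ε)) * (800 * (I.N / I.nc)) := by gcongr
      _ = 81920000 * (y * x ^ 3) := by rw [hydef]; field_simp; norm_num
      _ ≤ _ := by gcongr; norm_num
  have hx2 : x ≤ x ^ 2 := le_self_pow₀ hx1 (by norm_num)
  have hx3 : x ^ 2 ≤ x ^ 3 := pow_le_pow_right₀ hx1 (by norm_num)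
  have hx4 : x ^ 3 ≤ x ^ 4 := pow_le_pow_right₀ hx1 (by norm_num)
  have hlN : (I.lam : ℝ) * I.N ≤ 3 * (y * x) := by
    calc (I.lam : ℝ) * I.N ≤ (3 * x) * y := by gcongr
      _ = _ := by ring
  have hQy : (I.Q : ℝ) ≤ 3 * (y * x) := by
    rw [hQ]
    exact le_trans (by gcongr) hlN
  have hyx : y ≤ y * x := le_mul_of_one_le_right (by linarith) hx1
  have a1 : y * x ≤ y * x ^ 3 := by gcongr; linarith
  have a2 : y * x ≤ y * x ^ 4 := by gcongr; linarith
  have a3 : (I.lam + 1 : ℝ) ≤ 4 * x := by linarith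
  have hrest : ((I.Q : ℝ) + I.m + 5) * 50 ≤ 450 * (y * x ^ 3) := by
    linarith
  have hmain : (I.lam + 1 : ℝ) * (((T : ℝ) + 1) * (600 + 200 * (I.N / I.nc)) +
      ((I.Q : ℝ) + I.m + 5) * 50) ≤ 4 * x * (91 * 10 ^ 6 * (y * x ^ 3)) := by
    have h0 : 0 ≤ y * x ^ 3 := by positivity
    gcongr
    linarith
  have e4 : 4 * x * (91 * 10 ^ 6 * (y * x ^ 3)) = 364 * 10 ^ 6 * (y * x ^ 4) := by ring
  rw [e4] at hmain
  rw [mul_assoc (10 ^ 9)]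
  linarith

end Covering

/-! ### The input -/

namespace Covering

open RealRAM Finset

section

variable {m n : ℕ} {A : Matrix (Fin m) (Fin n) ℝ} (e : Fin (nnz A) ≃ NonzeroEntry A) (ε : ℝ)

/-- The row of the `k`-th entry of the input. -/
noncomputable def inRow : ℕ → ℕ := fun k => (input A e ε).nat 1 k

/-- The column of the `k`-th entry of the input. -/
noncomputable def inCol : ℕ → ℕ := fun k => (input A e ε).nat 2 k

/-- The value of the `k`-th entry of the input. -/
noncomputable def inVal : ℕ → ℝ := fun k => (input A e ε).real 0 k

theorem inRow_eq (k : Fin (nnz A)) : inRow e ε k = (e k).1.1 := by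
  simp [inRow, input]

theorem inCol_eq (k : Fin (nnz A)) : inCol e ε k = (e k).1.2 := by
  simp [inCol, input]

theorem inVal_eq (k : Fin (nnz A)) : inVal e ε k = A (e k).1.1 (e k).1.2 := by
  simp [inVal, input]

theorem rawState_input : RawState m (nnz A) (inRow e ε) (inCol e ε) (inVal e ε) ε
    (input A e ε) where
  m := rfl
  N := rfl
  row := rfl
  col := rfl
  val := rfl
  ε := rfl
  nat_zero a ha i := by
    obtain ⟨b, rfl⟩ := Nat.exists_eq_add_of_le ha
    rw [add_comm]
    rfl
  real_zero a ha i := by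
    obtain ⟨b, rfl⟩ := Nat.exists_eq_add_of_le ha
    rw [add_comm]
    rfl

theorem rawOK_input (hm : 0 < m) (hA : ∀ j i, 0 ≤ A j i) (hf : (feasible A).Nonempty)
    (hε : 0 < ε) (hε1 : ε ≤ 1) :
    RawOK m n (nnz A) (inRow e ε) (inCol e ε) (inVal e ε) ε where
  m_pos := hm
  row_lt k hk := by
    rw [inRow_eq e ε ⟨k, hk⟩]; exact Fin.is_lt _
  col_lt k hk := by
    rw [inCol_eq e ε ⟨k, hk⟩]; exact Fin.is_lt _
  val_pos k hk := by
    rw [inVal_eq e ε ⟨k, hk⟩]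
    exact lt_of_le_of_ne (hA _ _) (e ⟨k, hk⟩).2.symm
  inj k hk k' hk' h1 h2 := by
    rw [inRow_eq e ε ⟨k, hk⟩, inRow_eq e ε ⟨k', hk'⟩] at h1
    rw [inCol_eq e ε ⟨k, hk⟩, inCol_eq e ε ⟨k', hk'⟩] at h2
    have h3 : e ⟨k, hk⟩ = e ⟨k', hk'⟩ :=
      Subtype.ext (Prod.ext (Fin.ext h1) (Fin.ext h2))
    exact congrArg Fin.val (e.injective h3)
  surj j hj := by
    obtain ⟨x, -, hx⟩ := hf
    -- a zero row cannot be covered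
    obtain ⟨i, hi⟩ : ∃ i, A ⟨j, hj⟩ i ≠ 0 := by
      by_contra! h
      have h1 := hx ⟨j, hj⟩
      simp only [Matrix.mulVec, dotProduct, h, zero_mul, sum_const_zero] at h1
      linarith
    refine ⟨e.symm ⟨(⟨j, hj⟩, i), hi⟩, Fin.is_lt _, ?_⟩
    rw [inRow_eq, Equiv.apply_symm_apply]
  ε_pos := hε
  ε_le := hε1

/-- The instance `I` has the data of the input. -/
structure Represents (I : Inst) : Prop where
  m : I.m = m
  n : I.n = n
  N : I.N = nnz A
  row : I.row = inRow e ε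
  col : I.col = inCol e ε
  val : I.val = inVal e ε

variable {e ε} {I : Inst}

theorem Represents.cover_eq (h : Represents e ε I) (X : ℕ → ℝ) (j : Fin m) :
    I.cover X j = A.mulVec (fun i => X i) j := by
  classical
  unfold Inst.cover
  rw [h.N, ← Fin.sum_univ_eq_sum_range
    (fun k => if I.row k = j then I.val k * X (I.col k) else 0), h.row, h.col, h.val]
  simp only [inRow_eq, inCol_eq, inVal_eq]
  rw [e.sum_comp fun p : NonzeroEntry A =>
    if (p.1.1 : ℕ) = j then A p.1.1 p.1.2 * X p.1.2 else 0]
  have h1 : ∑ p : NonzeroEntry A, (if (p.1.1 : ℕ) = j then A p.1.1 p.1.2 * X p.1.2 else 0) =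
      ∑ p : Fin m × Fin n, if (p.1 : ℕ) = j then A p.1 p.2 * X p.2 else 0 := by
    rw [← sum_subtype (univ.filter fun p : Fin m × Fin n => A p.1 p.2 ≠ 0) (by simp)
      fun p : Fin m × Fin n => if (p.1 : ℕ) = j then A p.1 p.2 * X p.2 else 0]
    refine sum_subset (subset_univ _) fun p _ hp => ?_
    have hp : A p.1 p.2 = 0 := by simpa using hp
    simp [hp]
  rw [h1, Fintype.sum_prod_type]
  simp [Matrix.mulVec, dotProduct, Fin.val_inj]

theorem Represents.feas_iff (h : Represents e ε I) (X : ℕ → ℝ) :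
    I.Feas X ↔ (fun i : Fin n => X i) ∈ feasible A := by
  unfold Inst.Feas feasible
  rw [h.m, h.n]
  constructor
  · rintro ⟨h1, h2⟩
    exact ⟨fun i => h1 i i.2, fun j => by rw [← h.cover_eq]; exact h2 j j.2⟩
  · rintro ⟨h1, h2⟩
    refine ⟨fun i hi => h1 ⟨i, hi⟩, fun j hj => ?_⟩
    have := h2 ⟨j, hj⟩
    rwa [← h.cover_eq] at this

theorem Represents.isOpt (h : Represents e ε I) (hf : (feasible A).Nonempty) :
    I.IsOpt (opt A) := by
  have hb : BddBelow ((fun x : Fin n → ℝ => ∑ i, x i) '' feasible A) := by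
    refine ⟨0, ?_⟩
    rintro _ ⟨x, hx, rfl⟩
    exact sum_nonneg fun i _ => hx.1 i
  constructor
  · intro X hX
    rw [h.n, ← Fin.sum_univ_eq_sum_range]
    exact csInf_le hb ⟨_, (h.feas_iff X).1 hX, rfl⟩
  · intro δ hδ
    obtain ⟨_, ⟨x, hx, rfl⟩, hlt⟩ := exists_lt_of_csInf_lt (hf.image _)
      (lt_add_of_pos_right (opt A) hδ)
    -- extension of `x` by zero
    set X : ℕ → ℝ := fun i => if hi : i < n then x ⟨i, hi⟩ else 0 with hXdef
    have hX : (fun i : Fin n => X i) = x := funext fun i => by simp [hXdef]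
    refine ⟨X, (h.feas_iff X).2 (by rw [hX]; exact hx), ?_⟩
    rw [h.n, ← Fin.sum_univ_eq_sum_range]
    have : ∑ i : Fin n, X i = ∑ i, x i := sum_congr rfl fun i _ => congrFun hX i
    rw [this]
    exact hlt.le

end

end Covering

theorem theorem2 :
    ∃ (P : RealRAM.Cmd) (K C : ℝ) (d : ℕ),
      ∀ (m n : ℕ) (A : Matrix (Fin m) (Fin n) ℝ) (ε : ℝ)
        (e : Fin (Covering.nnz A) ≃ Covering.NonzeroEntry A),
        0 < m → (∀ j i, 0 ≤ A j i) → (Covering.feasible A).Nonempty → 0 < ε → ε ≤ 1 →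
          (9 / 10 : ℝ≥0∞) ≤ RealRAM.haltProb P (Covering.input A e ε)
              {s | Covering.IsApprox A (K * ε) (Covering.output n s)} ∧
          RealRAM.expectedTime P (Covering.input A e ε) ≤
            ENNReal.ofReal (C * ((Covering.nnz A : ℝ) / ε) *
              (1 + Real.log ((Covering.nnz A : ℝ) / ε)) ^ d) := by
  refine ⟨Covering.solver, 221, 10 ^ 9, 4, fun m n A ε e hm hA hf hε hε1 => ?_⟩
  obtain ⟨I, hI, h1, h2, h3, h4, h5, h6, h7, hp⟩ := Covering.ends_prepare
    (Covering.rawOK_input e ε hm hA hf hε hε1) (Covering.rawState_input e ε)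
  have hrep : Covering.Represents e ε I := ⟨h1, h2, h3, h4, h5, h6⟩
  constructor
  · refine Covering.haltProb_solver hI hp (hrep.isOpt hf) fun s hs hsum => ?_
    refine ⟨(hrep.feas_iff _).1 hs, ?_⟩
    rw [h2, h7, ← Fin.sum_univ_eq_sum_range] at hsum
    exact hsum
  · have := Covering.expectedTime_solver hI hp
    rwa [h3, h7] at this
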